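/- Let $P\ge 0$ and let $S_Z$ be the power spectral density of a real stationary Gaussian noise process, i.e. an integrable function on the unit circle with $S_Z(e^{-i\theta})=S_Z(e^{i\theta})>0$ for almost every $\theta$, and assume $\int_{-\pi}^{\pi}|\log S_Z(e^{i\theta})|\,\frac{d\theta}{2\pi}<\infty$. Consider the problem of maximizing $$\int_{-\pi}^{\pi}\log\bigl(S_V(e^{i\theta})+|1+B(e^{i\theta})|^2S_Z(e^{i\theta})\bigr)\,\frac{d\theta}{2\pi}$$ over all integrable $S_V\ge 0$ and all strictly causal polynomials $B(e^{i\theta})=\sum_{k=1}^m b_ke^{ik\theta}$ ($m\ge 0$, $b_k\in\mathbb R$) subject to $$\int_{-\pi}^{\pi}\bigl(S_V(e^{i\theta})+|B(e^{i\theta})|^2S_Z(e^{i\theta})\bigr)\,\frac{d\theta}{2\pi}\le P .$$ Call $(S_V^\star,B^\star)$ optimal if $S_V^\star\in L_1$, $S_V^\star\ge 0$, $B^\star=\sum_{k\ge1}b_ke^{ik\theta}\in H_2$ with real $b_k$ (polynomials included), the pair satisfies the power constraint, and its objective value equals the supremum of the problem. Every optimal $(S_V^\star,B^\star)$ satisfies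 the following conditions. (i) Power: $\int_{-\pi}^{\pi}\bigl(S_V^\star+|B^\star|^2S_Z\bigr)\,\frac{d\theta}{2\pi}=P$. (ii) Water-filling: $S_V^\star(e^{i\theta})\,(S_Y^\star(e^{i\theta})-\lambda^\star)=0$ for almost every $\theta$, where $S_Y^\star=S_V^\star+|1+B^\star|^2S_Z$ and $\lambda^\star=\operatorname{ess\,inf}_\theta S_Y^\star(e^{i\theta})$. (iii) Orthogonality: if $\{V_n\}$ and $\{Z_n\}$ ($n\in\mathbb Z$) are independent centered stationary Gaussian processes with spectral densities $S_V^\star$ and $S_Z$, $X_n=V_n+\sum_{k\ge1}b_kZ_{n-k}$ (the sum denoting the output of the filter $B^\star$, an $L_2$ limit of polynomial filters) and $Y_n=X_n+Z_n$, then the current input $X_n$ is independent of the past output $\{Y_i\}_{i<n}$, for every $n$. Equivalently, $S_V^\star+B^\star S_Z(1+\overline{B^\star})$ is anticausal, i.e. $\int_{-\pi}^{\pi}\bigl(S_V^\star+B^\star S_Z(1+\overline{B^\star})\bigr)e^{-in\theta}\,\frac{d\theta}{2\pi}=0$ for all $n\ge1$. Both forms hold. Furthermore, if $\operatorname{ess\,inf}_\theta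 S_Z(e^{i\theta})>0$, then there exists an optimal pair, with $S_V^\star\in L_1$ and $B^\star=\sum_{k\ge1}b_ke^{ik\theta}\in H_2$. -/

import Mathlib

open MeasureTheory ProbabilityTheory Filter Topology
open scoped ENNReal ComplexConjugate

noncomputable section

/-- The unit circle, parametrized by the angle `θ` modulo `2π`; the point `θ` stands for
`e^{iθ}`. -/
abbrev Torus : Type := AddCircle (2 * Real.pi)

instance torusPeriodPos : Fact (0 < 2 * Real.pi) := ⟨Real.two_pi_pos⟩

/-- The normalized Lebesgue measure `dθ / 2π` on the circle. -/
abbrev circleMeasure : Measure Torus := AddCircle.haarAddCircle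

/-- `f ∈ L₁` is anticausal: its Fourier coefficients `∫ f(e^{iθ}) e^{-inθ} dθ/2π` vanish for all
`n > 0`. -/
def Anticausal (f : Torus → ℂ) : Prop :=
  Integrable f circleMeasure ∧ ∀ n : ℤ, 0 < n → fourierCoeff f n = 0

/-- Strictly causal functions in the Hardy space `H₂` with real Fourier coefficients, that is
`B(e^{iθ}) = ∑_{k ≥ 1} b_k e^{ikθ}` with real square-summable `b_k`.  The space `H₂` is identified
with the space of `L₂` functions on the circle with vanishing coefficients of negative index. -/
structure StrictlyCausalH2 (B : Torus → ℂ) : Prop where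
  memLp : MemLp B 2 circleMeasure
  coeff_eq_zero : ∀ n : ℤ, n ≤ 0 → fourierCoeff B n = 0
  coeff_real : ∀ n : ℤ, (fourierCoeff B n).im = 0

/-- The strictly causal polynomial `∑_{k=1}^m b_k e^{ikθ}` with real coefficients. -/
def causalPoly (m : ℕ) (b : ℕ → ℝ) (θ : Torus) : ℂ :=
  ∑ k ∈ Finset.Icc 1 m, (b k : ℂ) * fourier (k : ℤ) θ

/-- The Paley–Wiener condition `log S ∈ L₁`.  Since `Real.log 0 = 0`, positivity almost everywhere
has to be said separately. -/
structure PaleyWiener (S : Torus → ℝ) : Prop where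
  pos : ∀ᵐ θ ∂circleMeasure, 0 < S θ
  integrable_log : Integrable (fun θ => Real.log (S θ)) circleMeasure

/-- The output spectrum `S_Y = S_V + |1 + B|² S_Z`. -/
def outputSpectrum (SZ SV : Torus → ℝ) (B : Torus → ℂ) (θ : Torus) : ℝ :=
  SV θ + ‖1 + B θ‖ ^ 2 * SZ θ

/-- The power `∫ (S_V + |B|² S_Z) dθ/2π` of the input. -/
def inputPower (SZ SV : Torus → ℝ) (B : Torus → ℂ) : ℝ :=
  ∫ θ, (SV θ + ‖B θ‖ ^ 2 * SZ θ) ∂circleMeasure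

/-- The objective `∫ log S_Y dθ/2π`. -/
def logOutput (SZ SV : Torus → ℝ) (B : Torus → ℂ) : ℝ :=
  ∫ θ, Real.log (outputSpectrum SZ SV B θ) ∂circleMeasure

/-- `S_V ≥ 0`, and the input power is finite and at most `P`. -/
structure PowerFeasible (SZ : Torus → ℝ) (P : ℝ) (SV : Torus → ℝ) (B : Torus → ℂ) : Prop where
  nonneg : ∀ᵐ θ ∂circleMeasure, 0 ≤ SV θ
  integrable : Integrable SV circleMeasure
  integrable_filter : Integrable (fun θ => ‖B θ‖ ^ 2 * SZ θ) circleMeasure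
  power_le : inputPower SZ SV B ≤ P

/-- The finite values of the objective on the feasible pairs `(S_V, B)` with `B` a strictly causal
polynomial.  (On a feasible pair the positive part of `log S_Y` is integrable, so the pairs that
fail `PaleyWiener` are those on which the objective is `-∞`; they do not affect the supremum.) -/
def objectiveValues (SZ : Torus → ℝ) (P : ℝ) : Set ℝ :=
  {v | ∃ (SV : Torus → ℝ) (m : ℕ) (b : ℕ → ℝ),
    PowerFeasible SZ P SV (causalPoly m b) ∧
    PaleyWiener (outputSpectrum SZ SV (causalPoly m b)) ∧
    v = logOutput SZ SV (causalPoly m b)}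

/-- `(S_V, B)`, with `S_V ∈ L₁` and `B` a polynomial or, more generally, a filter in `H₂`, is
feasible and attains the supremum of the variational problem. -/
structure IsOptimalPair (SZ : Torus → ℝ) (P : ℝ) (SV : Torus → ℝ) (B : Torus → ℂ) : Prop where
  strictlyCausal : StrictlyCausalH2 B
  feasible : PowerFeasible SZ P SV B
  paleyWiener : PaleyWiener (outputSpectrum SZ SV B)
  isLUB : IsLUB (objectiveValues SZ P) (logOutput SZ SV B)

/-- `W` is a two-sided centered stationary Gaussian process with power spectral density `S`:
`E W_m W_n = ∫ S(e^{iθ}) e^{-i(n-m)θ} dθ/2π`. -/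
structure IsStationaryGaussian {Ω : Type*} [MeasurableSpace Ω] (S : Torus → ℝ)
    (W : ℤ → Ω → ℝ) (μ : Measure Ω) : Prop where
  gaussian : IsGaussianProcess W μ
  mean_zero : ∀ n : ℤ, ∫ ω, W n ω ∂μ = 0
  covariance : ∀ m n : ℤ,
    ((∫ ω, W m ω * W n ω ∂μ : ℝ) : ℂ) = fourierCoeff (fun θ => (S θ : ℂ)) (n - m)

/-- `U` is the output at time `n` of the filter `B` driven by `Z`: the limit in `L₂` of
`∑_k b_k Z_{n-k}` along strictly causal polynomials `∑_k b_k e^{ikθ}` that tend to `B` in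
`L₂(S_Z dθ)`.  When `B` is a polynomial this is `∑_k b_k Z_{n-k}` itself. -/
def IsFilterOutput {Ω : Type*} [MeasurableSpace Ω] (SZ : Torus → ℝ) (B : Torus → ℂ)
    (Z : ℤ → Ω → ℝ) (μ : Measure Ω) (n : ℤ) (U : Ω → ℝ) : Prop :=
  MemLp U 2 μ ∧ ∃ (m : ℕ → ℕ) (b : ℕ → ℕ → ℝ),
    Tendsto (fun j => ∫⁻ θ, ENNReal.ofReal (‖B θ - causalPoly (m j) (b j) θ‖ ^ 2 * SZ θ)
      ∂circleMeasure) atTop (𝓝 0) ∧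
    Tendsto (fun j => eLpNorm
      (fun ω => U ω - ∑ k ∈ Finset.Icc 1 (m j), b j k * Z (n - (k : ℤ)) ω) 2 μ) atTop (𝓝 0)

/-- The stationary channel `Y_n = X_n + Z_n` with input `X_n = V_n + ∑_k b_k Z_{n-k}`, where `V`
and `Z` are independent stationary Gaussian processes with spectral densities `S_V` and `S_Z`. -/
structure IsFeedbackChannel {Ω : Type*} [MeasurableSpace Ω] (SZ SV : Torus → ℝ) (B : Torus → ℂ)
    (μ : Measure Ω) (Z V X Y : ℤ → Ω → ℝ) : Prop where
  noise : IsStationaryGaussian SZ Z μ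
  signal : IsStationaryGaussian SV V μ
  indep : IndepFun (fun ω (n : ℤ) => V n ω) (fun ω (n : ℤ) => Z n ω) μ
  input : ∀ n : ℤ, IsFilterOutput SZ B Z μ n (fun ω => X n ω - V n ω)
  output : ∀ (n : ℤ) (ω : Ω), Y n ω = X n ω + Z n ω

end

/-!
The problem is concave in the pair `(S_X, B)` with `S_X = S_V + |B|² S_Z`, since
`S_Y = S_X + 2 Re B S_Z + S_Z` is affine in it and the power is `∫ S_X`.  On a segment between two
pairs the filter is interpolated affinely and `S_V` gains the positive term `t(1-t)|B₀ - B₁|² S_Z`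
(`mixSignal`, `outputSpectrum_mix`).

Filters in `H₂` do not raise the supremum over polynomials (`logOutput_le_of_upperBound`), so an
optimal pair may be compared with every feasible pair in `H₂`.  This rests on the density of the
polynomials in `H₂ ∩ L₂(S_Z)` (`exists_causalPoly_approx`), for a weight `S_Z` that is merely
integrable.  By duality in `L₂` the density amounts to the vanishing of `∫ F B` for `F ∈ H₁`,
`B ∈ H₂` with `B(0) = 0` and `F B ∈ L₁`, a form of Smirnov's theorem
(`integral_mul_eq_zero_of_analytic`); it is obtained by damping `F` with bounded analytic functions
`exp (-f)`, whose boundary values are built from the Fourier multiplier that completes a real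
function to an analytic one.

The necessary conditions are first-order conditions.  Unused power could be added to `S_V`
(`IsOptimalPair.inputPower_eq`).  Moving signal power to frequencies where `S_Y` is smaller would
raise the objective (`IsOptimalPair.waterFilling`).  Replacing `1 + B` by `(1 - t zⁿ)(1 + B)` and
`S_V` by `|1 - t zⁿ|² S_V` leaves the objective unchanged, as `∫ log |1 - t zⁿ| = 0`, while the
power changes to first order by `-2 t` times the real part of the `n`-th coefficient of the
cross-spectrum; as all of the power is needed, that real part vanishes (`IsOptimalPair.anticausal`).  The
coefficients are real because water-filling makes `S_V` even.  In the channel they are the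
covariances of `X_n` and `Y_i`, `i < n`; all these variables are mean square limits of linear
combinations of one Gaussian process, so that uncorrelated means independent
(`IsFeedbackChannel.indepFun`).

For existence, a maximizing sequence is taken with almost minimal filter power.  By the
parallelogram law its filters form a Cauchy sequence in `L₂(S_Z)`, hence in `L₂` when `S_Z` is
bounded below, and by the strict concavity of the logarithm the functions `√S_Y` form a Cauchy
sequence in `L₁`.  Fatou's lemma shows that the limits are feasible and attain the supremum (`exists_isOptimalPair`).
-/

/-! ### Fourier coefficients of square integrable functions -/

lemma norm_fourier_apply (n : ℤ) (θ : Torus) : ‖(fourier n θ : ℂ)‖ = 1 := by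
  rw [fourier_apply]; exact Circle.norm_coe _

lemma MeasureTheory.Integrable.fourier_mul {f : Torus → ℂ} (hf : Integrable f circleMeasure)
    (n : ℤ) : Integrable (fun θ => fourier n θ * f θ) circleMeasure :=
  hf.fourier_smul n

lemma inner_fourierLp (f : Lp ℂ 2 circleMeasure) (n : ℤ) :
    inner ℂ (fourierLp 2 n : Lp ℂ 2 circleMeasure) f = fourierCoeff f n := by
  rw [← fourierBasis_repr, HilbertBasis.repr_apply_apply, coe_fourierBasis]

lemma fourierCoeff_memLp_toLp {f : Torus → ℂ} (hf : MemLp f 2 circleMeasure) (n : ℤ) :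
    fourierCoeff (hf.toLp f) n = fourierCoeff f n :=
  congrFun (fourierCoeff_congr_ae hf.coeFn_toLp) n

lemma ae_eq_zero_of_fourierCoeff {f : Torus → ℂ} (hf : MemLp f 2 circleMeasure)
    (h : ∀ n, fourierCoeff f n = 0) : f =ᵐ[circleMeasure] 0 := by
  have h0 : hf.toLp f = 0 := by
    apply fourierBasis.repr.injective
    ext n
    rw [fourierBasis_repr, fourierCoeff_memLp_toLp, h]
    simp
  have := hf.coeFn_toLp
  rw [h0] at this
  exact this.symm.trans (Lp.coeFn_zero _ _ _)

/-- Functions whose Fourier coefficients have complementary supports (up to reflection) have a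
product of mean zero. -/
lemma integral_mul_eq_zero_of_fourierCoeff {u v : Torus → ℂ} (hu : MemLp u 2 circleMeasure)
    (hv : MemLp v 2 circleMeasure)
    (h : ∀ n : ℤ, ∫ θ, fourier n θ * u θ ∂circleMeasure = 0 ∨ fourierCoeff v n = 0) :
    ∫ θ, u θ * v θ ∂circleMeasure = 0 := by
  have hu' : MemLp (fun θ => conj (u θ)) 2 circleMeasure := hu.star
  have key := fourierBasis.hasSum_inner_mul_inner (hu'.toLp _) (hv.toLp v)
  have hz : ∀ n : ℤ, inner ℂ (hu'.toLp _) (fourierBasis n) * inner ℂ (fourierBasis n) (hv.toLp v)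
      = 0 := by
    intro n
    rw [coe_fourierBasis, inner_fourierLp, fourierCoeff_memLp_toLp, ← inner_conj_symm, inner_fourierLp,
      fourierCoeff_memLp_toLp]
    rcases h n with h | h
    · have : fourierCoeff (fun θ => conj (u θ)) n = conj (∫ θ, fourier n θ * u θ ∂circleMeasure) := by
        rw [← integral_conj, fourierCoeff]
        congr 1; ext θ
        rw [fourier_neg, map_mul, smul_eq_mul]
      rw [this, h]; simp
    · rw [h]; simp
  simp_rw [hz] at key
  have h0 := key.unique hasSum_zero
  rw [L2.inner_def] at h0
  rw [← h0]
  apply integral_congr_ae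
  filter_upwards [hu'.coeFn_toLp, hv.coeFn_toLp] with θ h1 h2
  rw [h1, h2]
  simp [mul_comm]

/-! ### Boundary values of bounded analytic functions -/

/-- The disc algebra, seen on the circle: the uniform closure of the polynomials in `e^{iθ}`. -/
noncomputable def discAlgebra : Subalgebra ℂ C(Torus, ℂ) :=
  (Algebra.adjoin ℂ {fourier 1}).topologicalClosure

lemma fourier_natCast_eq_pow (n : ℕ) : (fourier (n : ℤ) : C(Torus, ℂ)) = fourier 1 ^ n := by
  induction n with
  | zero => ext θ; simp
  | succ n ih =>
    rw [pow_succ, ← ih]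
    ext θ
    push_cast
    rw [fourier_add]; rfl

lemma fourier_mem_discAlgebra (n : ℕ) : (fourier (n : ℤ) : C(Torus, ℂ)) ∈ discAlgebra := by
  rw [fourier_natCast_eq_pow]
  exact pow_mem (Subalgebra.le_topologicalClosure _ (Algebra.self_mem_adjoin_singleton ℂ _)) n

lemma integrable_continuousMap_mul {G : Torus → ℂ} (hG : Integrable G circleMeasure)
    (a : C(Torus, ℂ)) : Integrable (fun θ => a θ * G θ) circleMeasure :=
  hG.bdd_mul a.continuous.aestronglyMeasurable (ae_of_all _ a.norm_coe_le_norm)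

/-- An integrable function annihilated by `e^{inθ}`, `n ≥ 0`, is annihilated by the disc algebra. -/
lemma integral_discAlgebra_mul {G : Torus → ℂ} (hG : Integrable G circleMeasure)
    (h : ∀ n : ℕ, ∫ θ, fourier (n : ℤ) θ * G θ ∂circleMeasure = 0) {a : C(Torus, ℂ)}
    (ha : a ∈ discAlgebra) : ∫ θ, a θ * G θ ∂circleMeasure = 0 := by
  let Λ : C(Torus, ℂ) →ₗ[ℂ] ℂ :=
    { toFun := fun a => ∫ θ, a θ * G θ ∂circleMeasure
      map_add' := fun a b => by
        rw [← integral_add (integrable_continuousMap_mul hG a) (integrable_continuousMap_mul hG b)]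
        simp [add_mul]
      map_smul' := fun c a => by
        simp only [ContinuousMap.smul_apply, smul_eq_mul, mul_assoc, integral_const_mul,
          RingHom.id_apply] }
  have hcont : Continuous Λ := by
    refine AddMonoidHomClass.continuous_of_bound Λ (∫ θ, ‖G θ‖ ∂circleMeasure) fun a => ?_
    rw [mul_comm _ ‖a‖, ← integral_const_mul]
    refine norm_integral_le_of_norm_le (hG.norm.const_mul _) (ae_of_all _ fun θ => ?_)
    rw [norm_mul]
    gcongr
    exact a.norm_coe_le_norm θ
  have hpoly : ((Algebra.adjoin ℂ {fourier 1} : Subalgebra ℂ C(Torus, ℂ)) : Set C(Torus, ℂ)) ⊆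
      {a | Λ a = 0} := by
    intro a ha
    rw [SetLike.mem_coe, Algebra.adjoin_singleton_eq_range_aeval] at ha
    obtain ⟨p, rfl⟩ := ha
    change Λ (Polynomial.aeval (fourier 1) p) = 0
    rw [Polynomial.aeval_eq_sum_range, map_sum]
    refine Finset.sum_eq_zero fun n _ => ?_
    rw [map_smul, ← fourier_natCast_eq_pow]
    exact (congrArg _ (h n)).trans (smul_zero _)
  exact closure_minimal hpoly (isClosed_eq hcont continuous_const) ha

lemma exp_mem_discAlgebra {a : C(Torus, ℂ)} (ha : a ∈ discAlgebra) :
    NormedSpace.exp a ∈ discAlgebra := by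
  have hc : IsClosed (discAlgebra : Set C(Torus, ℂ)) := Subalgebra.isClosed_topologicalClosure _
  refine hc.mem_of_tendsto (NormedSpace.exp_series_hasSum_exp' (𝕂 := ℂ) a) (Eventually.of_forall ?_)
  intro s
  exact sum_mem fun n _ => Subalgebra.smul_mem _ (pow_mem ha n) _

lemma exp_continuousMap_apply (a : C(Torus, ℂ)) (θ : Torus) :
    NormedSpace.exp a θ = Complex.exp (a θ) := by
  have := NormedSpace.map_exp (ContinuousMap.evalAlgHom ℂ ℂ θ : C(Torus, ℂ) →ₐ[ℂ] ℂ)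
    (ContinuousEvalConst.continuous_eval_const θ) a
  rw [← Complex.exp_eq_exp_ℂ] at this
  exact this

/-- The Fourier multiplier on `L₂` with symbol `0, 1, 2` at negative, zero and positive frequencies.
It sends a real function to the boundary values of an analytic function with that real part. -/
lemma exists_analyticCompletion : ∃ T : Lp ℂ 2 circleMeasure →L[ℂ] Lp ℂ 2 circleMeasure,
    ∀ v n, fourierCoeff (T v) n = (if n < 0 then 0 else if n = 0 then 1 else 2) * fourierCoeff v n := by
  let e : ℤ → Lp ℂ 2 circleMeasure := fun n => fourierLp 2 n
  let K : Submodule ℂ (Lp ℂ 2 circleMeasure) :=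
    (Submodule.span ℂ (Set.range fun n : ℕ => e n)).topologicalClosure
  have : CompleteSpace K := (Submodule.isClosed_topologicalClosure _).completeSpace_coe
  have hon : ∀ i j : ℤ, inner ℂ (e i) (e j) = if i = j then (1 : ℂ) else 0 :=
    orthonormal_iff_ite.1 (orthonormal_fourier (T := 2 * Real.pi))
  refine ⟨(2 : ℂ) • K.starProjection - (innerSL ℂ (e 0)).smulRight (e 0), fun v n => ?_⟩
  rw [← inner_fourierLp, ← inner_fourierLp]
  change inner ℂ (e n) _ = _ * inner ℂ (e n) v
  simp only [sub_apply, smul_apply,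
    ContinuousLinearMap.smulRight_apply, innerSL_apply_apply, inner_sub_right, inner_smul_right, hon]
  rw [← K.inner_starProjection_left_eq_right]
  rcases lt_trichotomy n 0 with h | h | h
  · have : K.starProjection (e n) = 0 := by
      rw [Submodule.starProjection_apply_eq_zero_iff]
      rw [Submodule.orthogonal_closure]
      rw [Submodule.mem_orthogonal]
      intro u hu
      induction hu using Submodule.span_induction with
      | mem x hx =>
        obtain ⟨k, rfl⟩ := hx
        simp only [hon]
        rw [if_neg]; omega
      | zero => simp
      | add x y _ _ hx hy => rw [inner_add_left, hx, hy, add_zero]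
      | smul a x _ hx => rw [inner_smul_left, hx, mul_zero]
    rw [this, if_pos h, if_neg h.ne]; simp
  all_goals
    have : K.starProjection (e n) = e n := by
      rw [Submodule.starProjection_eq_self_iff]
      apply Submodule.le_topologicalClosure
      apply Submodule.subset_span
      exact ⟨n.toNat, by simp only; congr 1; omega⟩
    rw [this]
  · subst h; simp; ring
  · simp [h.ne', h.not_gt]

lemma fourierCoeff_conj (f : Torus → ℂ) (n : ℤ) :
    fourierCoeff (fun θ => conj (f θ)) n = conj (fourierCoeff f (-n)) := by
  rw [fourierCoeff, fourierCoeff, ← integral_conj]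
  congr 1; ext θ
  rw [fourier_neg, smul_eq_mul, smul_eq_mul, map_mul, neg_neg]

/-- Nonnegative trigonometric polynomials are dense among the nonnegative functions of `L₂`. -/
lemma exists_nonneg_trigPoly {φ : Torus → ℝ} (hφ : MemLp φ 2 circleMeasure)
    (h0 : ∀ᵐ θ ∂circleMeasure, 0 ≤ φ θ) {δ : ℝ} (hδ : 0 < δ) :
    ∃ p : C(Torus, ℂ), p ∈ Submodule.span ℂ (Set.range fun n : ℤ => (fourier n : C(Torus, ℂ))) ∧
      (∀ θ, ∃ r : ℝ, 0 ≤ r ∧ p θ = r) ∧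
      eLpNorm (fun θ => p θ - (φ θ : ℂ)) 2 circleMeasure ≤ ENNReal.ofReal δ := by
  obtain ⟨g, hg, -⟩ := hφ.exists_boundedContinuous_eLpNorm_sub_le (by simp)
    (ε := ENNReal.ofReal (δ / 2)) (by simpa using hδ)
  let g' : C(Torus, ℂ) := ⟨fun θ => ((max (g θ) 0 : ℝ) : ℂ), by fun_prop⟩
  have hmem : g' ∈ (fourierSubalgebra (T := 2 * Real.pi)).topologicalClosure := by
    rw [fourierSubalgebra_closure_eq_top]; trivial
  obtain ⟨s, hs, hsg⟩ := Metric.mem_closure_iff.1 hmem (δ / 4) (by positivity)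
  have hpm : (1 / 2 : ℂ) • (s + star s) + algebraMap ℂ C(Torus, ℂ) ((δ / 4 : ℝ) : ℂ) ∈
      fourierSubalgebra (T := 2 * Real.pi) :=
    add_mem (SMulMemClass.smul_mem _ (add_mem hs (star_mem hs))) (algebraMap_mem _ _)
  have hval : ∀ θ, ((1 / 2 : ℂ) • (s + star s) + algebraMap ℂ C(Torus, ℂ) ((δ / 4 : ℝ) : ℂ)) θ =
      (((s θ).re + δ / 4 : ℝ) : ℂ) := by
    intro θ
    simp only [ContinuousMap.add_apply, ContinuousMap.smul_apply, ContinuousMap.star_apply,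
      smul_eq_mul]
    rw [RCLike.star_def, Complex.add_conj]
    simp
  have hclose : ∀ θ, |(s θ).re - max (g θ) 0| ≤ δ / 4 := by
    intro θ
    have h1 : ‖g' θ - s θ‖ ≤ δ / 4 := by
      rw [← dist_eq_norm]
      exact (ContinuousMap.dist_apply_le_dist θ).trans hsg.le
    have h2 := (Complex.abs_re_le_norm (g' θ - s θ)).trans h1
    rw [abs_sub_comm]
    simpa [g'] using h2
  refine ⟨_, ?_, fun θ => ⟨_, ?_, hval θ⟩, ?_⟩
  · rw [← fourierSubalgebra_coe]; exact hpm
  · have := abs_le.1 (hclose θ)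
    have := le_max_right (g θ) 0
    linarith
  · calc _ ≤ eLpNorm ((fun θ => ‖(φ - g) θ‖) + fun _ => δ / 2) 2 circleMeasure := by
          apply eLpNorm_mono_ae
          filter_upwards [h0] with θ hθ
          rw [hval, ← Complex.ofReal_sub, Complex.norm_real, Real.norm_eq_abs]
          have h1 := hclose θ
          have h2 : |max (g θ) 0 - φ θ| ≤ |φ θ - g θ| := by
            have := abs_max_sub_max_le_abs (g θ) (φ θ) 0
            rwa [max_eq_left hθ, abs_sub_comm (g θ)] at this
          simp only [Pi.add_apply, Pi.sub_apply, Real.norm_eq_abs]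
          refine le_trans ?_ (le_abs_self _)
          calc |(s θ).re + δ / 4 - φ θ|
              = |((s θ).re - max (g θ) 0) + (max (g θ) 0 - φ θ) + δ / 4| := by congr 1; ring
            _ ≤ |(s θ).re - max (g θ) 0| + |max (g θ) 0 - φ θ| + |δ / 4| :=
                abs_add_three _ _ _
            _ ≤ _ := by rw [abs_of_pos (by positivity : 0 < δ / 4)]; linarith
      _ ≤ eLpNorm (fun θ => ‖(φ - g) θ‖) 2 circleMeasure +
          eLpNorm (fun _ : Torus => δ / 2) 2 circleMeasure := by
          apply eLpNorm_add_le _ (by fun_prop) (by norm_num)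
          exact (hφ.aestronglyMeasurable.sub g.continuous.aestronglyMeasurable).norm
      _ ≤ ENNReal.ofReal (δ / 2) + ENNReal.ofReal (δ / 2) := by
          gcongr
          · rwa [eLpNorm_norm]
          · rw [eLpNorm_const' _ (by norm_num) (by norm_num), Real.enorm_of_nonneg (by positivity)]
            simp
      _ = ENNReal.ofReal δ := by
          rw [← ENNReal.ofReal_add (by positivity) (by positivity), add_halves]

/-- The Fourier coefficients of `T v + conj (T v)` are those of `2 v` when `v` is real. -/
lemma re_analyticCompletion {T : Lp ℂ 2 circleMeasure →L[ℂ] Lp ℂ 2 circleMeasure}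
    (hT : ∀ v n, fourierCoeff (T v) n =
      (if n < 0 then 0 else if n = 0 then 1 else 2) * fourierCoeff v n)
    {φ : Torus → ℝ} (hφ : MemLp φ 2 circleMeasure) {v : Lp ℂ 2 circleMeasure}
    (hv : v =ᵐ[circleMeasure] fun θ => (φ θ : ℂ)) :
    ∀ᵐ θ ∂circleMeasure, (T v θ).re = φ θ := by
  have hf : MemLp (T v) 2 circleMeasure := Lp.memLp _
  have hf' : MemLp (fun θ => conj (T v θ)) 2 circleMeasure := hf.star
  have hφ' : MemLp (fun θ => (φ θ : ℂ)) 2 circleMeasure := hφ.ofReal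
  have hφ2 := hφ'.const_smul (-2 : ℂ)
  have hg := (hf.add hf').add hφ2
  have hz := ae_eq_zero_of_fourierCoeff hg fun n => by
    have i1 : Integrable (T v) circleMeasure := hf.integrable (by norm_num)
    have i2 : Integrable (fun θ => conj (T v θ)) circleMeasure := hf'.integrable (by norm_num)
    have i3 : Integrable ((-2 : ℂ) • fun θ => (φ θ : ℂ)) circleMeasure :=
      hφ2.integrable (by norm_num)
    have hsym : conj (fourierCoeff (fun θ => (φ θ : ℂ)) (-n)) =
        fourierCoeff (fun θ => (φ θ : ℂ)) n := by
      rw [← fourierCoeff_conj]; simp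
    rw [fourierCoeff.add (i1.add i2) i3, fourierCoeff.add i1 i2]
    simp only [Pi.add_apply]
    rw [fourierCoeff.const_smul, fourierCoeff_conj, hT, hT, fourierCoeff_congr_ae hv, map_mul,
      hsym]
    rcases lt_trichotomy n 0 with h | h | h
    · simp [h, h.not_gt, h.ne]
      rw [Complex.conj_ofNat]; ring
    · subst h; simp; ring
    · simp [h, h.not_gt, h.ne']
  filter_upwards [hz] with θ hθ
  have := congrArg Complex.re hθ
  simp at this
  linarith

/-- The analytic completion of a trigonometric polynomial is a polynomial in `e^{iθ}`. -/
lemma analyticCompletion_trigPoly {T : Lp ℂ 2 circleMeasure →L[ℂ] Lp ℂ 2 circleMeasure}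
    (hT : ∀ v n, fourierCoeff (T v) n =
      (if n < 0 then 0 else if n = 0 then 1 else 2) * fourierCoeff v n)
    {p : C(Torus, ℂ)}
    (hp : p ∈ Submodule.span ℂ (Set.range fun n : ℤ => (fourier n : C(Torus, ℂ)))) :
    ∃ q ∈ discAlgebra, T (ContinuousMap.toLp 2 circleMeasure ℂ p) =
      ContinuousMap.toLp 2 circleMeasure ℂ q := by
  induction hp using Submodule.span_induction with
  | mem x hx =>
    obtain ⟨k, rfl⟩ := hx
    refine ⟨(if k < 0 then 0 else if k = 0 then 1 else 2 : ℂ) • fourier k, ?_, ?_⟩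
    · rcases lt_or_ge k 0 with h | h
      · rw [if_pos h, zero_smul]; exact zero_mem _
      · obtain ⟨n, rfl⟩ := Int.eq_ofNat_of_zero_le h
        exact Subalgebra.smul_mem _ (fourier_mem_discAlgebra n) _
    · apply fourierBasis.repr.injective
      ext n
      rw [fourierBasis_repr, fourierBasis_repr, hT, map_smul,
        fourierCoeff_congr_ae (Lp.coeFn_smul _ _), fourierCoeff.const_smul, fourierCoeff_toLp,
        fourierCoeff_fourier, Pi.single_apply, smul_eq_mul]
      split_ifs <;> simp_all
  | zero => exact ⟨0, zero_mem _, by simp⟩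
  | add x y _ _ hx hy =>
    obtain ⟨a, ha, hxa⟩ := hx
    obtain ⟨b, hb, hyb⟩ := hy
    exact ⟨a + b, add_mem ha hb, by rw [map_add, map_add, map_add, hxa, hyb]⟩
  | smul c x _ hx =>
    obtain ⟨a, ha, hxa⟩ := hx
    exact ⟨c • a, Subalgebra.smul_mem _ ha c, by rw [map_smul, map_smul, map_smul, hxa]⟩

lemma exists_subseq_tendsto_ae {α E : Type*} [MeasurableSpace α] {ν : Measure α}
    [NormedAddCommGroup E] {p : ℝ≥0∞} (hp : p ≠ 0) {f : ℕ → α → E} {g : α → E}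
    (hf : ∀ n, AEStronglyMeasurable (f n) ν) (hg : AEStronglyMeasurable g ν)
    (h : Tendsto (fun n => eLpNorm (f n - g) p ν) atTop (𝓝 0)) :
    ∃ ns : ℕ → ℕ, StrictMono ns ∧ ∀ᵐ x ∂ν, Tendsto (fun i => f (ns i) x) atTop (𝓝 (g x)) :=
  (tendstoInMeasure_of_tendsto_eLpNorm hp hf hg h).exists_seq_tendsto_ae

/-- Every nonnegative `φ ∈ L₂` is the real part of some `f`, linear and continuous in `φ`, such that
`exp (-f)` is a bounded analytic function: it annihilates what the polynomials annihilate. -/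
lemma exists_bounded_analytic_exp : ∃ T : Lp ℂ 2 circleMeasure →L[ℂ] Lp ℂ 2 circleMeasure,
    ∀ (φ : Torus → ℝ) (hφ : MemLp (fun θ => (φ θ : ℂ)) 2 circleMeasure),
      (∀ᵐ θ ∂circleMeasure, 0 ≤ φ θ) →
      (∀ᵐ θ ∂circleMeasure, (T (hφ.toLp _) θ).re = φ θ) ∧
      ∀ G : Torus → ℂ, Integrable G circleMeasure →
        (∀ n : ℕ, ∫ θ, fourier (n : ℤ) θ * G θ ∂circleMeasure = 0) →
        ∫ θ, Complex.exp (-T (hφ.toLp _) θ) * G θ ∂circleMeasure = 0 := by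
  obtain ⟨T, hT⟩ := exists_analyticCompletion
  refine ⟨T, fun φ hφc h0 => ?_⟩
  have hφ : MemLp φ 2 circleMeasure := by simpa using hφc.re
  have hre := re_analyticCompletion hT hφ hφc.coeFn_toLp
  refine ⟨hre, fun G hG hG0 => ?_⟩
  have hδ : ∀ j : ℕ, (0 : ℝ) < 1 / (j + 1) := fun j => by positivity
  choose p hp hpos hclose using fun j : ℕ => exists_nonneg_trigPoly hφ h0 (hδ j)
  choose q hq hTq using fun j => analyticCompletion_trigPoly hT (hp j)
  have hlim : Tendsto (fun j => ContinuousMap.toLp 2 circleMeasure ℂ (p j)) atTop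
      (𝓝 (hφc.toLp _)) := by
    rw [Lp.tendsto_Lp_iff_tendsto_eLpNorm']
    have h1 : Tendsto (fun j : ℕ => ENNReal.ofReal (1 / ((j : ℝ) + 1))) atTop (𝓝 0) := by
      simpa using ENNReal.tendsto_ofReal (tendsto_one_div_add_atTop_nhds_zero_nat (𝕜 := ℝ))
    refine tendsto_of_tendsto_of_tendsto_of_le_of_le tendsto_const_nhds h1 (fun _ => zero_le)
      fun j => ?_
    refine le_trans (le_of_eq ?_) (hclose j)
    apply eLpNorm_congr_ae
    filter_upwards [ContinuousMap.coeFn_toLp (p := 2) (𝕜 := ℂ) circleMeasure (p j), hφc.coeFn_toLp]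
      with θ h1 h2
    rw [Pi.sub_apply, h1, h2]
  have hlimT := (T.continuous.tendsto _).comp hlim
  simp only [Function.comp_def, hTq] at hlimT
  rw [Lp.tendsto_Lp_iff_tendsto_eLpNorm'] at hlimT
  obtain ⟨ns, -, hns⟩ := exists_subseq_tendsto_ae (by norm_num) (fun j => Lp.aestronglyMeasurable _)
    (Lp.aestronglyMeasurable _) hlimT
  have hqre : ∀ j, ∀ᵐ θ ∂circleMeasure, 0 ≤ (q j θ).re := by
    intro j
    have hpm : MemLp (fun θ => (p j θ).re) 2 circleMeasure :=
      MemLp.of_bound (by fun_prop) ‖p j‖ (ae_of_all _ fun θ =>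
        (Complex.abs_re_le_norm _).trans ((p j).norm_coe_le_norm θ))
    have hpe : ContinuousMap.toLp 2 circleMeasure ℂ (p j) =ᵐ[circleMeasure]
        fun θ => (((p j θ).re : ℝ) : ℂ) := by
      filter_upwards [ContinuousMap.coeFn_toLp (p := 2) (𝕜 := ℂ) circleMeasure (p j)] with θ h
      obtain ⟨r, -, hr⟩ := hpos j θ
      rw [h, hr]; simp
    have := re_analyticCompletion hT hpm hpe
    rw [hTq] at this
    filter_upwards [this, ContinuousMap.coeFn_toLp (p := 2) (𝕜 := ℂ) circleMeasure (q j)] with θ h1 h2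
    obtain ⟨r, hr0, hr⟩ := hpos j θ
    rw [← h2, h1, hr]; simpa using hr0
  have hae : ∀ᵐ θ ∂circleMeasure, ∀ j, 0 ≤ (q j θ).re ∧
      ContinuousMap.toLp 2 circleMeasure ℂ (q j) θ = q j θ := by
    rw [ae_all_iff]
    intro j
    filter_upwards [hqre j, ContinuousMap.coeFn_toLp (p := 2) (𝕜 := ℂ) circleMeasure (q j)]
      with θ h1 h2 using ⟨h1, h2⟩
  have hint : ∀ j, ∫ θ, Complex.exp (-q j θ) * G θ ∂circleMeasure = 0 := by
    intro j
    have := integral_discAlgebra_mul hG hG0 (exp_mem_discAlgebra (neg_mem (hq j)))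
    simpa only [exp_continuousMap_apply, ContinuousMap.neg_apply] using this
  have hconv := tendsto_integral_of_dominated_convergence
    (F := fun i θ => Complex.exp (-q (ns i) θ) * G θ)
    (f := fun θ => Complex.exp (-T (hφc.toLp _) θ) * G θ) (fun θ => ‖G θ‖)
    (fun i => (by fun_prop : Continuous fun θ => Complex.exp (-q (ns i) θ)).aestronglyMeasurable.mul
      hG.aestronglyMeasurable) hG.norm ?_ ?_
  · simp only [hint] at hconv
    exact (tendsto_nhds_unique hconv tendsto_const_nhds)
  · intro i
    filter_upwards [hqre (ns i)] with θ hθ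
    rw [norm_mul, Complex.norm_exp, Complex.neg_re]
    exact mul_le_of_le_one_left (norm_nonneg _) (Real.exp_le_one_iff.2 (by linarith))
  · filter_upwards [hns, hae] with θ h1 h2
    have h3 : Tendsto (fun i => q (ns i) θ) atTop (𝓝 (T (hφc.toLp _) θ)) := by
      refine h1.congr fun i => (h2 _).2
    exact ((Complex.continuous_exp.tendsto _).comp h3.neg).mul_const _

/-! ### Products of functions in Hardy spaces and polynomial approximation -/

lemma norm_toLp_sq {f : Torus → ℂ} (hf : MemLp f 2 circleMeasure) :
    ‖hf.toLp f‖ ^ 2 = ∫ θ, ‖f θ‖ ^ 2 ∂circleMeasure := by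
  rw [← RCLike.ofReal_inj (K := ℂ), RCLike.ofReal_pow, ← inner_self_eq_norm_sq_to_K (𝕜 := ℂ),
    L2.inner_def, ← integral_ofReal]
  apply integral_congr_ae
  filter_upwards [hf.coeFn_toLp] with θ h
  rw [h, inner_self_eq_norm_sq_to_K]
  norm_cast

/-- Smirnov's maximum principle: if `F ∈ H₁`, `B ∈ H₂` vanishes at the origin and `F B ∈ L₁`, then
`F B` has mean zero.  Multiplying `F` by a bounded analytic function of modulus
`exp (-√(|F| / (n + 1)))` makes it bounded, and these multipliers tend to `1`. -/
lemma integral_mul_eq_zero_of_analytic {F B : Torus → ℂ} (hF : Integrable F circleMeasure)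
    (hF0 : ∀ k : ℕ, ∫ θ, fourier ((k + 1 : ℕ) : ℤ) θ * F θ ∂circleMeasure = 0)
    (hB : MemLp B 2 circleMeasure) (hB0 : ∀ n : ℤ, n ≤ 0 → fourierCoeff B n = 0)
    (hFB : Integrable (fun θ => F θ * B θ) circleMeasure) :
    ∫ θ, F θ * B θ ∂circleMeasure = 0 := by
  obtain ⟨T, hT⟩ := exists_bounded_analytic_exp
  let φ : ℕ → Torus → ℝ := fun n θ => Real.sqrt (‖F θ‖ / (n + 1))
  have hφ0 : ∀ n θ, 0 ≤ φ n θ := fun n θ => Real.sqrt_nonneg _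
  have hφm : ∀ n, AEStronglyMeasurable (φ n) circleMeasure := fun n =>
    ((hF.norm.div_const _).aestronglyMeasurable.aemeasurable.sqrt).aestronglyMeasurable
  have hφsq : ∀ n θ, ‖(φ n θ : ℂ)‖ ^ 2 = ‖F θ‖ / (n + 1) := by
    intro n θ
    rw [Complex.norm_real, Real.norm_of_nonneg (hφ0 n θ), Real.sq_sqrt (by positivity)]
  have hφ : ∀ n, MemLp (fun θ => (φ n θ : ℂ)) 2 circleMeasure := by
    intro n
    rw [memLp_two_iff_integrable_sq_norm (Complex.continuous_ofReal.comp_aestronglyMeasurable (hφm n))]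
    simp only [hφsq]
    exact hF.norm.div_const _
  let f : ℕ → Lp ℂ 2 circleMeasure := fun n => T ((hφ n).toLp _)
  have hfre : ∀ n, ∀ᵐ θ ∂circleMeasure, (f n θ).re = φ n θ := fun n =>
    (hT (φ n) (hφ n) (ae_of_all _ (hφ0 n))).1
  -- `f n → 0` in `L₂`
  have hφlim : Tendsto (fun n => (hφ n).toLp _) atTop (𝓝 0) := by
    rw [tendsto_zero_iff_norm_tendsto_zero]
    have hn : ∀ n : ℕ, ‖(hφ n).toLp _‖ = Real.sqrt ((∫ θ, ‖F θ‖ ∂circleMeasure) / (n + 1)) := by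
      intro n
      rw [eq_comm, Real.sqrt_eq_iff_mul_self_eq (by positivity) (norm_nonneg _), ← pow_two,
        ← integral_div]
      rw [norm_toLp_sq]
      simp only [hφsq]
    simp_rw [hn]
    rw [← Real.sqrt_zero]
    refine (Real.continuous_sqrt.tendsto 0).comp ?_
    exact tendsto_const_nhds.div_atTop
      (tendsto_atTop_add_const_right _ _ tendsto_natCast_atTop_atTop)
  have hflim : Tendsto f atTop (𝓝 0) := by
    rw [← map_zero T]
    exact (T.continuous.tendsto 0).comp hφlim
  rw [Lp.tendsto_Lp_iff_tendsto_eLpNorm'] at hflim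
  obtain ⟨ns, -, hns⟩ := exists_subseq_tendsto_ae (by norm_num) (fun j => Lp.aestronglyMeasurable _)
    (Lp.aestronglyMeasurable _) hflim
  have hexpm : ∀ n, AEStronglyMeasurable (fun θ => Complex.exp (-f n θ)) circleMeasure := fun n =>
    Complex.continuous_exp.comp_aestronglyMeasurable (Lp.aestronglyMeasurable (f n)).neg
  have hzero : ∀ n, ∫ θ, (Complex.exp (-f n θ) * F θ) * B θ ∂circleMeasure = 0 := by
    intro n
    have hu : MemLp (fun θ => Complex.exp (-f n θ) * F θ) 2 circleMeasure := by
      refine MemLp.of_bound ((hexpm n).mul hF.aestronglyMeasurable) (2 * (n + 1)) ?_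
      filter_upwards [hfre n] with θ hθ
      rw [norm_mul, Complex.norm_exp, Complex.neg_re, hθ, Real.exp_neg]
      have h1 : ‖F θ‖ = φ n θ ^ 2 * (n + 1) := by
        rw [Real.sq_sqrt (by positivity)]; field_simp
      have h2 := Real.quadratic_le_exp_of_nonneg (hφ0 n θ)
      have h3 : φ n θ ^ 2 ≤ 2 * Real.exp (φ n θ) := by nlinarith [hφ0 n θ]
      rw [h1, inv_mul_le_iff₀ (Real.exp_pos _)]
      have : (0 : ℝ) ≤ n + 1 := by positivity
      nlinarith
    refine integral_mul_eq_zero_of_fourierCoeff hu hB fun m => ?_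
    rcases le_or_gt m 0 with h | h
    · exact Or.inr (hB0 m h)
    · left
      obtain ⟨k, rfl⟩ : ∃ k : ℕ, m = ((k + 1 : ℕ) : ℤ) := ⟨(m - 1).toNat, by push_cast; omega⟩
      have := (hT (φ n) (hφ n) (ae_of_all _ (hφ0 n))).2 (fun θ => fourier ((k + 1 : ℕ) : ℤ) θ * F θ)
        (hF.fourier_mul _) fun j => ?_
      · rw [← this]; congr 1; ext θ; ring
      · rw [← hF0 (j + k)]
        congr 1; ext θ
        rw [← mul_assoc, ← fourier_add]
        congr 3
  have hconv := tendsto_integral_of_dominated_convergence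
    (F := fun i θ => (Complex.exp (-f (ns i) θ) * F θ) * B θ)
    (f := fun θ => F θ * B θ) (μ := circleMeasure) (fun θ => ‖F θ * B θ‖)
    (fun i => ((hexpm _).mul hF.aestronglyMeasurable).mul hB.aestronglyMeasurable) hFB.norm ?_ ?_
  · simp only [hzero] at hconv
    exact (tendsto_nhds_unique hconv tendsto_const_nhds)
  · intro i
    filter_upwards [hfre (ns i)] with θ hθ
    rw [mul_assoc, norm_mul, Complex.norm_exp, Complex.neg_re, hθ]
    exact mul_le_of_le_one_left (norm_nonneg _) (Real.exp_le_one_iff.2 (by linarith [hφ0 (ns i) θ]))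
  · filter_upwards [hns, Lp.coeFn_zero ℂ 2 circleMeasure] with θ h1 h2
    rw [h2] at h1
    have h3 := ((Complex.continuous_exp.tendsto _).comp h1.neg).mul_const (F θ)
    have h4 := h3.mul_const (B θ)
    simpa using h4

lemma norm_sqrt_mul_sq {w : ℝ} (hw : 0 ≤ w) (z : ℂ) : ‖(Real.sqrt w : ℂ) * z‖ ^ 2 = ‖z‖ ^ 2 * w := by
  rw [norm_mul, Complex.norm_real, Real.norm_of_nonneg (Real.sqrt_nonneg _), mul_pow,
    Real.sq_sqrt hw, mul_comm]

lemma aestronglyMeasurable_sqrt {w : Torus → ℝ} (hw : Integrable w circleMeasure) :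
    AEStronglyMeasurable (fun θ => (Real.sqrt (w θ) : ℂ)) circleMeasure :=
  Complex.continuous_ofReal.comp_aestronglyMeasurable
    (hw.aestronglyMeasurable.aemeasurable.sqrt).aestronglyMeasurable

lemma memLp_sqrt_mul {w : Torus → ℝ} (hw : Integrable w circleMeasure)
    (hw0 : ∀ᵐ θ ∂circleMeasure, 0 ≤ w θ) {g : Torus → ℂ}
    (hg : AEStronglyMeasurable g circleMeasure)
    (hgw : Integrable (fun θ => ‖g θ‖ ^ 2 * w θ) circleMeasure) :
    MemLp (fun θ => (Real.sqrt (w θ) : ℂ) * g θ) 2 circleMeasure := by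
  refine (memLp_two_iff_integrable_sq_norm ((aestronglyMeasurable_sqrt hw).mul hg)).2 ?_
  refine hgw.congr ?_
  filter_upwards [hw0] with θ h
  exact (norm_sqrt_mul_sq h _).symm

lemma continuous_sum_fourier (m : ℕ) (c : ℕ → ℂ) :
    Continuous fun θ : Torus => ∑ k ∈ Finset.Icc 1 m, c k * fourier (k : ℤ) θ :=
  continuous_finsetSum _ fun k _ => continuous_const.mul (fourier (k : ℤ)).continuous

lemma Integrable.continuous_norm_sq_mul {w : Torus → ℝ} (hw : Integrable w circleMeasure)
    {g : Torus → ℂ} (hg : Continuous g) :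
    Integrable (fun θ => ‖g θ‖ ^ 2 * w θ) circleMeasure := by
  let a : C(Torus, ℂ) := ⟨g, hg⟩
  refine hw.bdd_mul (c := ‖a‖ ^ 2) (by fun_prop) (ae_of_all _ fun θ => ?_)
  rw [norm_pow, norm_norm]
  gcongr
  exact a.norm_coe_le_norm θ

/-- Strictly causal polynomials approximate `B` in `L₂(w)`.  Multiplication by `√w` carries `L₂(w)`
into `L₂`.  A function `g` orthogonal to the images of all `e^{ikθ}`, `k ≥ 1`, yields
`F = conj g √w ∈ H₁`, and `∫ F B = 0` shows that `g` is orthogonal to the image of `B` too. -/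
lemma exists_complex_causal_approx {w : Torus → ℝ} (hw : Integrable w circleMeasure)
    (hw0 : ∀ᵐ θ ∂circleMeasure, 0 ≤ w θ) {B : Torus → ℂ} (hB : MemLp B 2 circleMeasure)
    (hB0 : ∀ n : ℤ, n ≤ 0 → fourierCoeff B n = 0)
    (hBw : Integrable (fun θ => ‖B θ‖ ^ 2 * w θ) circleMeasure) {ε : ℝ} (hε : 0 < ε) :
    ∃ (m : ℕ) (c : ℕ → ℂ),
      ∫ θ, ‖B θ - ∑ k ∈ Finset.Icc 1 m, c k * fourier (k : ℤ) θ‖ ^ 2 * w θ ∂circleMeasure < ε := by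
  have hmem : ∀ g : Torus → ℂ, Continuous g →
      MemLp (fun θ => (Real.sqrt (w θ) : ℂ) * g θ) 2 circleMeasure := fun g hg =>
    memLp_sqrt_mul hw hw0 hg.aestronglyMeasurable (Integrable.continuous_norm_sq_mul hw hg)
  have hb := memLp_sqrt_mul hw hw0 hB.aestronglyMeasurable hBw
  let v : ℕ → Lp ℂ 2 circleMeasure := fun k =>
    (hmem (fourier ((k + 1 : ℕ) : ℤ)) (fourier _).continuous).toLp _
  let K := Submodule.span ℂ (Set.range v)
  have hbK : hb.toLp _ ∈ K.topologicalClosure := by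
    rw [← Submodule.orthogonal_orthogonal_eq_closure, Submodule.mem_orthogonal]
    intro g hg
    rw [Submodule.mem_orthogonal'] at hg
    have hgm : MemLp g 2 circleMeasure := Lp.memLp g
    have hg' : MemLp (fun θ => conj (g θ)) 2 circleMeasure := hgm.star
    have h1 : MemLp (fun θ => (Real.sqrt (w θ) : ℂ) * 1) 2 circleMeasure :=
      hmem (fun _ => 1) continuous_const
    have hF : Integrable (fun θ => conj (g θ) * ((Real.sqrt (w θ) : ℂ) * 1)) circleMeasure :=
      hg'.integrable_mul h1
    have hFB : Integrable (fun θ => conj (g θ) * ((Real.sqrt (w θ) : ℂ) * 1) * B θ)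
        circleMeasure := by
      refine (hg'.integrable_mul hb).congr (ae_of_all _ fun θ => ?_)
      simp only [Pi.mul_apply]; ring
    have key := integral_mul_eq_zero_of_analytic hF (fun k => ?_) hB hB0 hFB
    · rw [L2.inner_def, ← key]
      apply integral_congr_ae
      filter_upwards [hb.coeFn_toLp] with θ h
      rw [h, RCLike.inner_apply]
      ring
    · have := hg (v k) (Submodule.subset_span ⟨k, rfl⟩)
      rw [L2.inner_def] at this
      rw [← this]
      apply integral_congr_ae
      filter_upwards [(hmem (fourier ((k + 1 : ℕ) : ℤ)) (fourier _).continuous).coeFn_toLp] with θ h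
      rw [h, RCLike.inner_apply]
      ring
  obtain ⟨x, hx, hdist⟩ := Metric.mem_closure_iff.1 hbK (Real.sqrt ε) (Real.sqrt_pos.2 hε)
  obtain ⟨c, hc⟩ := Finsupp.mem_span_range_iff_exists_finsupp.1 hx
  let m := c.support.sup id + 1
  have hxm : x = ∑ k ∈ Finset.Icc 1 m, c (k - 1) • v (k - 1) := by
    rw [← hc, Finsupp.sum]
    rw [Finset.sum_subset (s₂ := Finset.range m)]
    · rw [Finset.range_eq_Ico, Finset.sum_Ico_eq_sum_range, ← Finset.Ico_succ_right_eq_Icc,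
        Finset.sum_Ico_eq_sum_range]
      simp
    · intro k hk
      rw [Finset.mem_range]
      exact Nat.lt_succ_of_le (Finset.le_sup (f := id) hk)
    · intro k _ hk
      rw [Finsupp.notMem_support_iff.1 hk, zero_smul]
  refine ⟨m, fun k => c (k - 1), ?_⟩
  let p : Torus → ℂ := fun θ => ∑ k ∈ Finset.Icc 1 m, c (k - 1) * fourier (k : ℤ) θ
  have hp : Continuous p := continuous_sum_fourier m _
  have hxp : x = (hmem p hp).toLp _ := by
    rw [hxm]
    apply Lp.ext
    have hv : ∀ᵐ θ ∂circleMeasure, ∀ k, v k θ =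
        (Real.sqrt (w θ) : ℂ) * fourier ((k + 1 : ℕ) : ℤ) θ := by
      rw [ae_all_iff]; intro k
      exact (hmem (fourier ((k + 1 : ℕ) : ℤ)) (fourier _).continuous).coeFn_toLp
    have hs : ∀ᵐ θ ∂circleMeasure, ∀ k, (c (k - 1) • v (k - 1) : Lp ℂ 2 circleMeasure) θ =
        c (k - 1) * v (k - 1) θ := by
      rw [ae_all_iff]; intro k
      exact Lp.coeFn_smul _ _
    filter_upwards [hv, hs, (hmem p hp).coeFn_toLp,
      Lp.coeFn_fun_finsetSum (Finset.Icc 1 m) (fun k => c (k - 1) • v (k - 1))] with θ h1 h2 h3 h4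
    rw [h4, h3, Finset.mul_sum]
    refine Finset.sum_congr rfl fun k hk => ?_
    rw [h2, h1, Nat.sub_add_cancel (Finset.mem_Icc.1 hk).1]
    ring
  have hsub := memLp_sqrt_mul hw hw0 (hB.aestronglyMeasurable.sub hp.aestronglyMeasurable) (by
    have := (memLp_two_iff_integrable_sq_norm (hb.sub (hmem p hp)).aestronglyMeasurable).1
      (hb.sub (hmem p hp))
    refine this.congr ?_
    filter_upwards [hw0] with θ h
    rw [← norm_sqrt_mul_sq h]
    simp [mul_sub])
  have hdist' : ‖hsub.toLp _‖ < Real.sqrt ε := by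
    rw [dist_eq_norm, hxp, ← MemLp.toLp_sub] at hdist
    refine lt_of_eq_of_lt (congrArg norm ?_) hdist
    apply Lp.ext
    filter_upwards [hsub.coeFn_toLp, (hb.sub (hmem p hp)).coeFn_toLp] with θ h1 h2
    rw [h1, h2]; simp [mul_sub]
  have hfin : ‖hsub.toLp _‖ ^ 2 < ε := by
    have := pow_lt_pow_left₀ hdist' (norm_nonneg _) two_ne_zero
    rwa [Real.sq_sqrt hε.le] at this
  rw [norm_toLp_sq] at hfin
  refine lt_of_eq_of_lt (integral_congr_ae ?_) hfin
  filter_upwards [hw0] with θ h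
  rw [norm_sqrt_mul_sq h]
  rfl

lemma fourier_neg_arg (n : ℤ) (θ : Torus) : (fourier n (-θ) : ℂ) = conj (fourier n θ) := by
  rw [← fourier_neg, fourier_apply, fourier_apply, smul_neg, neg_smul]

lemma ae_comp_neg {p : Torus → Prop} (h : ∀ᵐ θ ∂circleMeasure, p θ) :
    ∀ᵐ θ ∂circleMeasure, p (-θ) :=
  (Measure.measurePreserving_neg circleMeasure).quasiMeasurePreserving.ae h

lemma fourierCoeff_comp_neg (f : Torus → ℂ) (n : ℤ) :
    fourierCoeff (fun θ => f (-θ)) n = fourierCoeff f (-n) := by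
  rw [fourierCoeff, fourierCoeff, ← integral_neg_eq_self]
  congr 1; ext θ
  rw [neg_neg, fourier_neg_arg, fourier_neg, neg_neg, Complex.conj_conj]

lemma StrictlyCausalH2.comp_neg {B : Torus → ℂ} (hB : StrictlyCausalH2 B) :
    ∀ᵐ θ ∂circleMeasure, B (-θ) = conj (B θ) := by
  have h1 : MemLp (fun θ => B (-θ)) 2 circleMeasure :=
    hB.memLp.comp_measurePreserving (Measure.measurePreserving_neg circleMeasure)
  have h2 : MemLp (fun θ => conj (B θ)) 2 circleMeasure := hB.memLp.star
  have h3 := h2.const_smul (-1 : ℂ)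
  have := ae_eq_zero_of_fourierCoeff (h1.add h3) fun n => by
    rw [fourierCoeff.add (h1.integrable (by norm_num)) (h3.integrable (by norm_num)), Pi.add_apply,
      fourierCoeff.const_smul, fourierCoeff_conj, fourierCoeff_comp_neg,
      Complex.conj_eq_iff_im.2 (hB.coeff_real _)]
    simp
  filter_upwards [this] with θ h
  simp only [Pi.add_apply, Pi.smul_apply, Pi.zero_apply, smul_eq_mul] at h
  linear_combination h

lemma continuous_causalPoly (m : ℕ) (b : ℕ → ℝ) : Continuous (causalPoly m b) :=
  continuous_sum_fourier m fun k => (b k : ℂ)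

/-- Real strictly causal polynomials are dense in `H₂ ∩ L₂(w)` for the norm of `L₂(w)`.  The weight
being even, taking real parts of the coefficients does not worsen a complex approximation. -/
lemma exists_causalPoly_approx {w : Torus → ℝ} (hw : Integrable w circleMeasure)
    (hw0 : ∀ᵐ θ ∂circleMeasure, 0 ≤ w θ) (hEven : ∀ᵐ θ ∂circleMeasure, w (-θ) = w θ)
    {B : Torus → ℂ} (hB : StrictlyCausalH2 B)
    (hBw : Integrable (fun θ => ‖B θ‖ ^ 2 * w θ) circleMeasure) {ε : ℝ} (hε : 0 < ε) :
    ∃ (m : ℕ) (b : ℕ → ℝ), Integrable (fun θ => ‖B θ - causalPoly m b θ‖ ^ 2 * w θ) circleMeasure ∧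
      ∫ θ, ‖B θ - causalPoly m b θ‖ ^ 2 * w θ ∂circleMeasure < ε := by
  obtain ⟨m, c, hc⟩ := exists_complex_causal_approx hw hw0 hB.memLp hB.coeff_eq_zero hBw hε
  have hint : ∀ p : Torus → ℂ, Continuous p →
      Integrable (fun θ => ‖B θ - p θ‖ ^ 2 * w θ) circleMeasure := by
    intro p hp
    refine Integrable.mono' ((hBw.const_mul 2).add
      ((Integrable.continuous_norm_sq_mul hw hp).const_mul 2))
      (((hB.memLp.aestronglyMeasurable.sub hp.aestronglyMeasurable).norm.pow 2).mul
        hw.aestronglyMeasurable) ?_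
    filter_upwards [hw0] with θ h
    rw [Real.norm_of_nonneg (by positivity)]
    simp only [Pi.add_apply]
    have h1 := norm_sub_le (B θ) (p θ)
    have h2 : ‖B θ - p θ‖ ^ 2 ≤ 2 * ‖B θ‖ ^ 2 + 2 * ‖p θ‖ ^ 2 := by
      nlinarith [norm_nonneg (B θ - p θ), norm_nonneg (B θ), norm_nonneg (p θ),
        sq_nonneg (‖B θ‖ - ‖p θ‖)]
    nlinarith
  set p : Torus → ℂ := fun θ => ∑ k ∈ Finset.Icc 1 m, c k * fourier (k : ℤ) θ with hpdef
  have hp : Continuous p := continuous_sum_fourier m c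
  refine ⟨m, fun k => (c k).re, hint _ (continuous_causalPoly _ _), lt_of_le_of_lt ?_ hc⟩
  have hi := hint p hp
  have hi' : Integrable (fun θ => ‖B (-θ) - p (-θ)‖ ^ 2 * w (-θ)) circleMeasure :=
    hi.comp_neg
  have hsum : ∫ θ, ‖B θ - p θ‖ ^ 2 * w θ ∂circleMeasure =
      ∫ θ, (1 / 2 * (‖B θ - p θ‖ ^ 2 * w θ) +
        1 / 2 * (‖B (-θ) - p (-θ)‖ ^ 2 * w (-θ))) ∂circleMeasure := by
    rw [integral_add (hi.const_mul _) (hi'.const_mul _), integral_const_mul, integral_const_mul,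
      integral_neg_eq_self (fun θ => ‖B θ - p θ‖ ^ 2 * w θ) circleMeasure]
    ring
  change _ ≤ ∫ θ, ‖B θ - p θ‖ ^ 2 * w θ ∂circleMeasure
  rw [hsum]
  refine integral_mono_ae (hint _ (continuous_causalPoly _ _))
    ((hi.const_mul _).add (hi'.const_mul _)) ?_
  filter_upwards [hw0, hEven, hB.comp_neg] with θ h1 h2 h3
  have hre : causalPoly m (fun k => (c k).re) θ = (p θ + conj (p (-θ))) / 2 := by
    simp only [causalPoly, hpdef, map_sum, ← Finset.sum_add_distrib, Finset.sum_div]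
    refine Finset.sum_congr rfl fun k _ => ?_
    rw [map_mul, fourier_neg_arg, Complex.conj_conj, ← add_mul, Complex.add_conj]
    push_cast; ring
  have heq : B θ - causalPoly m (fun k => (c k).re) θ =
      ((B θ - p θ) + conj (B (-θ) - p (-θ))) / 2 := by
    rw [hre, map_sub, h3, Complex.conj_conj]; ring
  rw [heq, h2, norm_div]
  have h4 := norm_add_le (B θ - p θ) (conj (B (-θ) - p (-θ)))
  rw [Complex.norm_conj] at h4
  have h5 : (‖(B θ - p θ) + conj (B (-θ) - p (-θ))‖ / ‖(2 : ℂ)‖) ^ 2 ≤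
      1 / 2 * ‖B θ - p θ‖ ^ 2 + 1 / 2 * ‖B (-θ) - p (-θ)‖ ^ 2 := by
    rw [Complex.norm_ofNat]
    nlinarith [norm_nonneg ((B θ - p θ) + conj (B (-θ) - p (-θ))), norm_nonneg (B θ - p θ),
      norm_nonneg (B (-θ) - p (-θ)), sq_nonneg (‖B θ - p θ‖ - ‖B (-θ) - p (-θ)‖)]
  nlinarith

/-! ### The variational problem in concave form -/

lemma strictlyCausalH2_causalPoly (m : ℕ) (b : ℕ → ℝ) : StrictlyCausalH2 (causalPoly m b) := by
  have hmem : MemLp (causalPoly m b) 2 circleMeasure := by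
    let a : C(Torus, ℂ) := ⟨_, continuous_causalPoly m b⟩
    exact MemLp.of_bound (continuous_causalPoly m b).aestronglyMeasurable ‖a‖
      (ae_of_all _ a.norm_coe_le_norm)
  have hco : ∀ n : ℤ, fourierCoeff (causalPoly m b) n =
      ∑ k ∈ Finset.Icc 1 m, (b k : ℂ) * (Pi.single (k : ℤ) 1 : ℤ → ℂ) n := by
    intro n
    have h1 : causalPoly m b = ∑ k ∈ Finset.Icc 1 m, ((b k : ℂ) • ⇑(fourier (k : ℤ)) : Torus → ℂ) := by
      ext θ; simp [causalPoly]
    rw [h1, fourierCoeff.sum, Finset.sum_apply]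
    · simp_rw [fourierCoeff.const_smul, smul_eq_mul, fourierCoeff_fourier]
    · intro k _
      exact ((fourier (k : ℤ)).continuous.integrable_of_hasCompactSupport
        (HasCompactSupport.of_compactSpace _)).smul _
  refine ⟨hmem, fun n hn => ?_, fun n => ?_⟩
  · rw [hco]
    refine Finset.sum_eq_zero fun k hk => ?_
    have : n ≠ k := by have := (Finset.mem_Icc.1 hk).1; omega
    rw [Pi.single_eq_of_ne this, mul_zero]
  · rw [hco, Complex.im_sum]
    refine Finset.sum_eq_zero fun k _ => ?_
    rw [Pi.single_apply]
    split_ifs <;> simp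

/-- The signal spectrum that makes `S_X = S_V + |B|² S_Z` affine along the segment from
`(SV₀, B₀)` to `(SV₁, B₁)`. -/
noncomputable def mixSignal (SZ : Torus → ℝ) (t : ℝ) (SV₀ : Torus → ℝ) (B₀ : Torus → ℂ)
    (SV₁ : Torus → ℝ) (B₁ : Torus → ℂ) (θ : Torus) : ℝ :=
  (1 - t) * SV₀ θ + t * SV₁ θ + t * (1 - t) * (‖B₀ θ - B₁ θ‖ ^ 2 * SZ θ)

/-- The filter on the segment from `B₀` to `B₁`. -/
noncomputable def mixFilter (t : ℝ) (B₀ B₁ : Torus → ℂ) (θ : Torus) : ℂ :=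
  (1 - t : ℝ) * B₀ θ + t * B₁ θ

lemma norm_sq_segment (t : ℝ) (x y : ℂ) : ‖((1 - t : ℝ) : ℂ) * x + t * y‖ ^ 2 =
    (1 - t) * ‖x‖ ^ 2 + t * ‖y‖ ^ 2 - t * (1 - t) * ‖x - y‖ ^ 2 := by
  simp only [Complex.sq_norm, Complex.normSq_apply, Complex.add_re, Complex.add_im, Complex.mul_re,
    Complex.mul_im, Complex.ofReal_re, Complex.ofReal_im, Complex.sub_re, Complex.sub_im]
  ring

lemma mix_power (SZ : Torus → ℝ) (t : ℝ) (SV₀ : Torus → ℝ) (B₀ : Torus → ℂ)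
    (SV₁ : Torus → ℝ) (B₁ : Torus → ℂ) (θ : Torus) :
    mixSignal SZ t SV₀ B₀ SV₁ B₁ θ + ‖mixFilter t B₀ B₁ θ‖ ^ 2 * SZ θ =
      (1 - t) * (SV₀ θ + ‖B₀ θ‖ ^ 2 * SZ θ) + t * (SV₁ θ + ‖B₁ θ‖ ^ 2 * SZ θ) := by
  rw [mixSignal, mixFilter, norm_sq_segment]; ring

lemma outputSpectrum_mix (SZ : Torus → ℝ) (t : ℝ) (SV₀ : Torus → ℝ) (B₀ : Torus → ℂ)
    (SV₁ : Torus → ℝ) (B₁ : Torus → ℂ) (θ : Torus) :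
    outputSpectrum SZ (mixSignal SZ t SV₀ B₀ SV₁ B₁) (mixFilter t B₀ B₁) θ =
      (1 - t) * outputSpectrum SZ SV₀ B₀ θ + t * outputSpectrum SZ SV₁ B₁ θ := by
  have h : 1 + mixFilter t B₀ B₁ θ = ((1 - t : ℝ) : ℂ) * (1 + B₀ θ) + t * (1 + B₁ θ) := by
    rw [mixFilter]; push_cast; ring
  rw [outputSpectrum, outputSpectrum, outputSpectrum, h, norm_sq_segment, mixSignal,
    add_sub_add_left_eq_sub]
  ring

lemma StrictlyCausalH2.mix {B₀ B₁ : Torus → ℂ} (h₀ : StrictlyCausalH2 B₀)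
    (h₁ : StrictlyCausalH2 B₁) (t : ℝ) : StrictlyCausalH2 (mixFilter t B₀ B₁) := by
  have hm₀ := h₀.memLp.const_smul ((1 - t : ℝ) : ℂ)
  have hm₁ := h₁.memLp.const_smul (t : ℂ)
  have hco : ∀ n, fourierCoeff (mixFilter t B₀ B₁) n =
      (1 - t : ℝ) * fourierCoeff B₀ n + t * fourierCoeff B₁ n := by
    intro n
    have : mixFilter t B₀ B₁ = ((1 - t : ℝ) : ℂ) • B₀ + (t : ℂ) • B₁ := rfl
    rw [this, fourierCoeff.add (hm₀.integrable (by norm_num)) (hm₁.integrable (by norm_num)),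
      Pi.add_apply, fourierCoeff.const_smul, fourierCoeff.const_smul, smul_eq_mul, smul_eq_mul]
  refine ⟨hm₀.add hm₁, fun n hn => ?_, fun n => ?_⟩
  · rw [hco, h₀.coeff_eq_zero n hn, h₁.coeff_eq_zero n hn]; simp
  · rw [hco]; simp [h₀.coeff_real n, h₁.coeff_real n]

lemma norm_add_sq_le_two (x y : ℂ) : ‖x + y‖ ^ 2 ≤ 2 * ‖x‖ ^ 2 + 2 * ‖y‖ ^ 2 := by
  nlinarith [norm_add_le x y, norm_nonneg (x + y), norm_nonneg x, norm_nonneg y,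
    sq_nonneg (‖x‖ - ‖y‖)]

lemma integrable_norm_sq_add {w : Torus → ℝ} (hw0 : ∀ᵐ θ ∂circleMeasure, 0 ≤ w θ)
    (hw : AEStronglyMeasurable w circleMeasure) {f g : Torus → ℂ}
    (hf : AEStronglyMeasurable f circleMeasure) (hg : AEStronglyMeasurable g circleMeasure)
    (hfw : Integrable (fun θ => ‖f θ‖ ^ 2 * w θ) circleMeasure)
    (hgw : Integrable (fun θ => ‖g θ‖ ^ 2 * w θ) circleMeasure) :
    Integrable (fun θ => ‖f θ + g θ‖ ^ 2 * w θ) circleMeasure := by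
  refine Integrable.mono' ((hfw.const_mul 2).add (hgw.const_mul 2))
    (((hf.add hg).norm.pow 2).mul hw) ?_
  filter_upwards [hw0] with θ h
  rw [Real.norm_of_nonneg (by positivity)]
  simp only [Pi.add_apply]
  nlinarith [norm_add_sq_le_two (f θ) (g θ)]

lemma integrable_norm_sq_sub {w : Torus → ℝ} (hw0 : ∀ᵐ θ ∂circleMeasure, 0 ≤ w θ)
    (hw : AEStronglyMeasurable w circleMeasure) {f g : Torus → ℂ}
    (hf : AEStronglyMeasurable f circleMeasure) (hg : AEStronglyMeasurable g circleMeasure)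
    (hfw : Integrable (fun θ => ‖f θ‖ ^ 2 * w θ) circleMeasure)
    (hgw : Integrable (fun θ => ‖g θ‖ ^ 2 * w θ) circleMeasure) :
    Integrable (fun θ => ‖f θ - g θ‖ ^ 2 * w θ) circleMeasure := by
  have := integrable_norm_sq_add hw0 hw hf hg.neg hfw (by simpa using hgw)
  simpa only [sub_eq_add_neg, Pi.neg_apply] using this

lemma PaleyWiener.nonneg {S : Torus → ℝ} (h : PaleyWiener S) : ∀ᵐ θ ∂circleMeasure, 0 ≤ S θ :=
  h.pos.mono fun _ h => h.le

section

variable {SZ : Torus → ℝ}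

lemma integrable_norm_sq_one_add (hSZ : Integrable SZ circleMeasure)
    (hw0 : ∀ᵐ θ ∂circleMeasure, 0 ≤ SZ θ) {B : Torus → ℂ}
    (hB : AEStronglyMeasurable B circleMeasure)
    (hBw : Integrable (fun θ => ‖B θ‖ ^ 2 * SZ θ) circleMeasure) :
    Integrable (fun θ => ‖1 + B θ‖ ^ 2 * SZ θ) circleMeasure :=
  integrable_norm_sq_add hw0 hSZ.aestronglyMeasurable aestronglyMeasurable_const hB
    (by simpa using hSZ) hBw

lemma PowerFeasible.integrable_output (hSZ : Integrable SZ circleMeasure)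
    (hw0 : ∀ᵐ θ ∂circleMeasure, 0 ≤ SZ θ) {P : ℝ} {SV : Torus → ℝ} {B : Torus → ℂ}
    (hB : AEStronglyMeasurable B circleMeasure) (h : PowerFeasible SZ P SV B) :
    Integrable (outputSpectrum SZ SV B) circleMeasure :=
  h.integrable.add (integrable_norm_sq_one_add hSZ hw0 hB h.integrable_filter)

lemma PowerFeasible.integrable_power {P : ℝ} {SV : Torus → ℝ} {B : Torus → ℂ}
    (h : PowerFeasible SZ P SV B) :
    Integrable (fun θ => SV θ + ‖B θ‖ ^ 2 * SZ θ) circleMeasure :=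
  h.integrable.add h.integrable_filter

lemma PowerFeasible.mix (hSZ : Integrable SZ circleMeasure)
    (hw0 : ∀ᵐ θ ∂circleMeasure, 0 ≤ SZ θ) {P₀ P₁ : ℝ} {SV₀ SV₁ : Torus → ℝ} {B₀ B₁ : Torus → ℂ}
    (hB₀ : AEStronglyMeasurable B₀ circleMeasure) (hB₁ : AEStronglyMeasurable B₁ circleMeasure)
    (h₀ : PowerFeasible SZ P₀ SV₀ B₀) (h₁ : PowerFeasible SZ P₁ SV₁ B₁) {t : ℝ} (ht : 0 ≤ t)
    (ht' : t ≤ 1) :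
    PowerFeasible SZ ((1 - t) * P₀ + t * P₁) (mixSignal SZ t SV₀ B₀ SV₁ B₁)
      (mixFilter t B₀ B₁) := by
  have hs : 0 ≤ 1 - t := by linarith
  have hi := integrable_norm_sq_sub hw0 hSZ.aestronglyMeasurable hB₀ hB₁ h₀.integrable_filter
    h₁.integrable_filter
  have hiS : Integrable (mixSignal SZ t SV₀ B₀ SV₁ B₁) circleMeasure :=
    ((h₀.integrable.const_mul _).add (h₁.integrable.const_mul _)).add (hi.const_mul _)
  have hiT : Integrable (fun θ => (1 - t) * (SV₀ θ + ‖B₀ θ‖ ^ 2 * SZ θ) +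
      t * (SV₁ θ + ‖B₁ θ‖ ^ 2 * SZ θ)) circleMeasure :=
    (h₀.integrable_power.const_mul _).add (h₁.integrable_power.const_mul _)
  refine ⟨?_, hiS, (hiT.sub hiS).congr (ae_of_all _ fun θ => ?_), ?_⟩
  · filter_upwards [h₀.nonneg, h₁.nonneg, hw0] with θ a b c
    rw [mixSignal]; positivity
  · simp only [Pi.sub_apply]
    rw [← mix_power]; ring
  · rw [inputPower]
    simp only [mix_power]
    rw [integral_add (h₀.integrable_power.const_mul _) (h₁.integrable_power.const_mul _),
      integral_const_mul, integral_const_mul]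
    exact add_le_add (mul_le_mul_of_nonneg_left h₀.power_le hs)
      (mul_le_mul_of_nonneg_left h₁.power_le ht)

/-- The upper bound for `log S` comes from `log S ≤ S - 1`. -/
lemma PaleyWiener.of_lowerBound {S g : Torus → ℝ} (hS : Integrable S circleMeasure)
    (hpos : ∀ᵐ θ ∂circleMeasure, 0 < S θ) (hg : Integrable g circleMeasure)
    (hle : ∀ᵐ θ ∂circleMeasure, g θ ≤ Real.log (S θ)) : PaleyWiener S := by
  refine ⟨hpos, Integrable.mono' (hg.norm.add hS.norm)
    (Real.measurable_log.comp_aemeasurable hS.aestronglyMeasurable.aemeasurable).aestronglyMeasurable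
    ?_⟩
  filter_upwards [hpos, hle] with θ h1 h2
  have h3 := Real.log_le_sub_one_of_pos h1
  simp only [Pi.add_apply, Real.norm_eq_abs]
  rw [abs_le]
  constructor
  · linarith [neg_abs_le (g θ), abs_nonneg (S θ)]
  · linarith [abs_nonneg (g θ), le_abs_self (S θ)]

lemma PaleyWiener.mono {S S' : Torus → ℝ} (h : PaleyWiener S) (hS' : Integrable S' circleMeasure)
    (hle : ∀ᵐ θ ∂circleMeasure, S θ ≤ S' θ) : PaleyWiener S' := by
  refine .of_lowerBound hS' ?_ h.integrable_log ?_
  · filter_upwards [h.pos, hle] with θ a b using a.trans_le b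
  · filter_upwards [h.pos, hle] with θ a b using Real.log_le_log a b

lemma log_segment_le {a b t : ℝ} (ha : 0 < a) (hb : 0 < b) (ht : 0 ≤ t) (ht' : t ≤ 1) :
    (1 - t) * Real.log a + t * Real.log b ≤ Real.log ((1 - t) * a + t * b) := by
  have := strictConcaveOn_log_Ioi.concaveOn.2 (Set.mem_Ioi.2 ha) (Set.mem_Ioi.2 hb)
    (by linarith : 0 ≤ 1 - t) ht (by ring)
  simpa using this

lemma PaleyWiener.segment {S₀ S₁ : Torus → ℝ} (h₀ : PaleyWiener S₀) (h₁ : PaleyWiener S₁)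
    (hi₀ : Integrable S₀ circleMeasure) (hi₁ : Integrable S₁ circleMeasure) {t : ℝ} (ht : 0 ≤ t)
    (ht' : t ≤ 1) : PaleyWiener (fun θ => (1 - t) * S₀ θ + t * S₁ θ) ∧
      (1 - t) * ∫ θ, Real.log (S₀ θ) ∂circleMeasure + t * ∫ θ, Real.log (S₁ θ) ∂circleMeasure ≤
        ∫ θ, Real.log ((1 - t) * S₀ θ + t * S₁ θ) ∂circleMeasure := by
  have hle : ∀ᵐ θ ∂circleMeasure, (1 - t) * Real.log (S₀ θ) + t * Real.log (S₁ θ) ≤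
      Real.log ((1 - t) * S₀ θ + t * S₁ θ) := by
    filter_upwards [h₀.pos, h₁.pos] with θ a b using log_segment_le a b ht ht'
  have hint := (h₀.integrable_log.const_mul (1 - t)).add (h₁.integrable_log.const_mul t)
  have hPW : PaleyWiener (fun θ => (1 - t) * S₀ θ + t * S₁ θ) := by
    refine .of_lowerBound ((hi₀.const_mul _).add (hi₁.const_mul _)) ?_ hint hle
    filter_upwards [h₀.pos, h₁.pos] with θ a b
    have hs : 0 ≤ 1 - t := by linarith
    rcases ht.eq_or_lt with rfl | h
    · simpa using a
    · positivity
  refine ⟨hPW, ?_⟩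
  rw [← integral_const_mul, ← integral_const_mul, ← integral_add (h₀.integrable_log.const_mul _)
    (h₁.integrable_log.const_mul _)]
  exact integral_mono_ae hint hPW.integrable_log hle

/-- Polynomial filters approximate the spectra `|1 + B|² S_Z` in `L₁` and the filter power. -/
lemma exists_causalPoly_spectrum_approx (hSZ : Integrable SZ circleMeasure)
    (hw0 : ∀ᵐ θ ∂circleMeasure, 0 ≤ SZ θ) (hEven : ∀ᵐ θ ∂circleMeasure, SZ (-θ) = SZ θ)
    {B : Torus → ℂ} (hB : StrictlyCausalH2 B)
    (hBw : Integrable (fun θ => ‖B θ‖ ^ 2 * SZ θ) circleMeasure) {κ : ℝ} (hκ : 0 < κ) :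
    ∃ (m : ℕ) (b : ℕ → ℝ),
      ∫ θ, |‖1 + B θ‖ ^ 2 * SZ θ - ‖1 + causalPoly m b θ‖ ^ 2 * SZ θ| ∂circleMeasure ≤ κ ∧
      ∫ θ, ‖causalPoly m b θ‖ ^ 2 * SZ θ ∂circleMeasure ≤
        ∫ θ, ‖B θ‖ ^ 2 * SZ θ ∂circleMeasure + κ := by
  have hi1 := integrable_norm_sq_one_add hSZ hw0 hB.memLp.aestronglyMeasurable hBw
  set C := ∫ θ, ‖1 + B θ‖ ^ 2 * SZ θ ∂circleMeasure with hC
  set D := ∫ θ, ‖B θ‖ ^ 2 * SZ θ ∂circleMeasure with hD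
  have hC0 : 0 ≤ C := integral_nonneg_of_ae (by filter_upwards [hw0] with θ h; positivity)
  have hD0 : 0 ≤ D := integral_nonneg_of_ae (by filter_upwards [hw0] with θ h; positivity)
  -- `η` is the weight in `||x|² - |y|²| ≤ (1 + 1/η) |x - y|² + η |x|²`
  set η := κ / (2 * (C + D + 1)) with hη
  have hη0 : 0 < η := by positivity
  have hηC : η * (C + D) ≤ κ / 2 := by
    rw [hη, div_mul_eq_mul_div, div_le_iff₀ (by positivity)]
    nlinarith
  obtain ⟨m, b, hi, hlt⟩ := exists_causalPoly_approx hSZ hw0 hEven hB hBw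
    (ε := κ / (2 * (1 + 1 / η))) (by positivity)
  set e := ∫ θ, ‖B θ - causalPoly m b θ‖ ^ 2 * SZ θ ∂circleMeasure with he
  have hee : (1 + 1 / η) * e ≤ κ / 2 := by
    rw [lt_div_iff₀ (by positivity)] at hlt
    linarith
  have hpt : ∀ x y : ℂ, |‖x‖ ^ 2 - ‖y‖ ^ 2| ≤ (1 + 1 / η) * ‖x - y‖ ^ 2 + η * ‖x‖ ^ 2 := by
    intro x y
    have h1 : |‖x‖ - ‖y‖| ≤ ‖x - y‖ := abs_norm_sub_norm_le x y
    have h2 : ‖x‖ + ‖y‖ ≤ 2 * ‖x‖ + ‖x - y‖ := by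
      have := norm_sub_norm_le y x
      rw [norm_sub_rev] at this; linarith
    have h3 : |‖x‖ ^ 2 - ‖y‖ ^ 2| = |‖x‖ - ‖y‖| * (‖x‖ + ‖y‖) := by
      have : ‖x‖ ^ 2 - ‖y‖ ^ 2 = (‖x‖ - ‖y‖) * (‖x‖ + ‖y‖) := by ring
      rw [this, abs_mul, abs_of_nonneg (by positivity : 0 ≤ ‖x‖ + ‖y‖)]
    have h4 : 2 * ‖x‖ * ‖x - y‖ ≤ 1 / η * ‖x - y‖ ^ 2 + η * ‖x‖ ^ 2 := by
      have : 0 ≤ (‖x - y‖ - η * ‖x‖) ^ 2 / η := by positivity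
      have h5 : (‖x - y‖ - η * ‖x‖) ^ 2 / η =
          1 / η * ‖x - y‖ ^ 2 + η * ‖x‖ ^ 2 - 2 * ‖x‖ * ‖x - y‖ := by
        field_simp; ring
      linarith
    rw [h3]
    have := mul_le_mul h1 h2 (by positivity) (norm_nonneg _)
    nlinarith
  have hip : Integrable (fun θ => ‖causalPoly m b θ‖ ^ 2 * SZ θ) circleMeasure :=
    Integrable.continuous_norm_sq_mul hSZ (continuous_causalPoly m b)
  have hi1p := integrable_norm_sq_one_add hSZ hw0
    (continuous_causalPoly m b).aestronglyMeasurable hip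
  have hiD : Integrable (fun θ => (1 + 1 / η) * (‖B θ - causalPoly m b θ‖ ^ 2 * SZ θ) +
      η * (‖B θ‖ ^ 2 * SZ θ)) circleMeasure := (hi.const_mul _).add (hBw.const_mul _)
  refine ⟨m, b, ?_, ?_⟩
  · calc _ ≤ ∫ θ, ((1 + 1 / η) * (‖B θ - causalPoly m b θ‖ ^ 2 * SZ θ) +
            η * (‖1 + B θ‖ ^ 2 * SZ θ)) ∂circleMeasure := by
          refine integral_mono_ae (hi1.sub hi1p).abs ((hi.const_mul _).add (hi1.const_mul _)) ?_
          filter_upwards [hw0] with θ h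
          have := hpt (1 + B θ) (1 + causalPoly m b θ)
          rw [add_sub_add_left_eq_sub] at this
          rw [← sub_mul, abs_mul, abs_of_nonneg h]
          nlinarith
      _ = (1 + 1 / η) * e + η * C := by
          rw [integral_add (hi.const_mul _) (hi1.const_mul _), integral_const_mul,
            integral_const_mul]
      _ ≤ κ := by nlinarith
  · calc _ ≤ ∫ θ, (‖B θ‖ ^ 2 * SZ θ + ((1 + 1 / η) * (‖B θ - causalPoly m b θ‖ ^ 2 * SZ θ) +
            η * (‖B θ‖ ^ 2 * SZ θ))) ∂circleMeasure := by
          refine integral_mono_ae hip (hBw.add hiD) ?_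
          filter_upwards [hw0] with θ h
          have := (abs_le.1 (hpt (B θ) (causalPoly m b θ))).1
          nlinarith
      _ = D + ((1 + 1 / η) * e + η * D) := by
          rw [integral_add hBw hiD,
            integral_add (hi.const_mul _) (hBw.const_mul _), integral_const_mul, integral_const_mul]
      _ ≤ D + κ := by nlinarith

lemma log_sub_le_of_le {a b ε : ℝ} (hε : 0 < ε) (ha : ε ≤ a) (hb : ε ≤ b) :
    Real.log b - |b - a| / ε ≤ Real.log a := by
  have ha0 := hε.trans_le ha
  have hb0 := hε.trans_le hb
  have h1 := Real.log_le_sub_one_of_pos (div_pos hb0 ha0)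
  rw [Real.log_div hb0.ne' ha0.ne'] at h1
  have h2 : b / a - 1 ≤ |b - a| / ε := by
    rw [div_sub_one ha0.ne']
    calc (b - a) / a ≤ |b - a| / a := by gcongr; exact le_abs_self _
      _ ≤ |b - a| / ε := by gcongr
  linarith

end

section

variable {SZ : Torus → ℝ}

lemma PowerFeasible.ae_eq_zero_of_nonpos (hw : ∀ᵐ θ ∂circleMeasure, 0 < SZ θ)
    {SV : Torus → ℝ} {B : Torus → ℂ} (h : PowerFeasible SZ 0 SV B) :
    ∀ᵐ θ ∂circleMeasure, SV θ = 0 ∧ B θ = 0 := by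
  have h0 : 0 ≤ᵐ[circleMeasure] fun θ => SV θ + ‖B θ‖ ^ 2 * SZ θ := by
    filter_upwards [h.nonneg, hw] with θ a b
    simp only [Pi.zero_apply]; positivity
  have hz := (integral_eq_zero_iff_of_nonneg_ae h0 h.integrable_power).1
    (le_antisymm h.power_le (integral_nonneg_of_ae h0))
  filter_upwards [hz, h.nonneg, hw] with θ a b c
  simp only [Pi.zero_apply] at a
  have h1 : 0 ≤ ‖B θ‖ ^ 2 * SZ θ := by positivity
  have h2 : ‖B θ‖ ^ 2 * SZ θ = 0 := by linarith
  refine ⟨by linarith, ?_⟩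
  simpa [c.ne'] using h2

lemma powerFeasible_zero {P : ℝ} (hP : 0 ≤ P) : PowerFeasible SZ P 0 0 :=
  ⟨by simp, integrable_zero _ _ _, by simp, by simpa [inputPower] using hP⟩

lemma outputSpectrum_zero : outputSpectrum SZ 0 0 = SZ := by
  ext θ; simp [outputSpectrum]

/-- Admitting filters in `H₂` does not raise the supremum over polynomial filters.  A polynomial
approximation of the filter may exceed the power bound and may spoil the integrability of the
logarithm; adding a small constant to `S_V` repairs the latter, and moving slightly towards the
pair `(0, 0)`, whose output is `S_Z`, repairs the former. -/
theorem logOutput_le_of_upperBound {P : ℝ} (hP : 0 ≤ P) (hSZ : Integrable SZ circleMeasure)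
    (hEven : ∀ᵐ θ ∂circleMeasure, SZ (-θ) = SZ θ) (hPW : PaleyWiener SZ)
    {SV : Torus → ℝ} {B : Torus → ℂ} (hB : StrictlyCausalH2 B) (h : PowerFeasible SZ P SV B)
    (hY : PaleyWiener (outputSpectrum SZ SV B)) {M : ℝ} (hM : M ∈ upperBounds (objectiveValues SZ P)) :
    logOutput SZ SV B ≤ M := by
  rcases hP.eq_or_lt with rfl | hP
  · have hz := h.ae_eq_zero_of_nonpos hPW.pos
    have hc : causalPoly 0 0 = 0 := by ext θ; simp [causalPoly]
    have : logOutput SZ SV B = logOutput SZ 0 (causalPoly 0 0) := by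
      apply integral_congr_ae
      filter_upwards [hz] with θ hθ
      rw [hc, outputSpectrum, outputSpectrum, hθ.1, hθ.2]; simp
    rw [this]
    refine hM ⟨0, 0, 0, ?_, ?_, rfl⟩
    · rw [hc]; exact powerFeasible_zero le_rfl
    · rw [hc, outputSpectrum_zero]; exact hPW
  have hw0 := hPW.nonneg
  set L := logOutput SZ SV B with hL
  set W := ∫ θ, Real.log (SZ θ) ∂circleMeasure with hW
  suffices hkey : ∀ t : ℝ, 0 < t → t < 1 → (1 - t) * L + t * W ≤ M by
    have hlim : Tendsto (fun t : ℝ => (1 - t) * L + t * W) (𝓝[>] 0) (𝓝 ((1 - 0) * L + 0 * W)) := by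
      refine Tendsto.mono_left (Continuous.tendsto ?_ 0) nhdsWithin_le_nhds
      fun_prop
    have := le_of_tendsto hlim (b := M) (by
      filter_upwards [Ioo_mem_nhdsGT (zero_lt_one' ℝ)] with t ht using hkey t ht.1 ht.2)
    simpa using this
  intro t ht ht1
  refine le_of_forall_pos_le_add fun δ hδ => ?_
  have hs : 0 < 1 - t := by linarith
  -- the approximating pair has power at most `P + 2 ε`, and `(1 - t) (P + 2 ε) ≤ P`
  set ε := t * P / 2 with hε
  have hε0 : 0 < ε := by positivity
  obtain ⟨m, b, hb1, hb2⟩ := exists_causalPoly_spectrum_approx hSZ hw0 hEven hB h.integrable_filter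
    (κ := ε * min 1 δ) (by positivity)
  have hpc := continuous_causalPoly m b
  have hip : Integrable (fun θ => ‖causalPoly m b θ‖ ^ 2 * SZ θ) circleMeasure :=
    Integrable.continuous_norm_sq_mul hSZ hpc
  have hiε : Integrable (fun θ => SV θ + ε) circleMeasure := h.integrable.add (integrable_const _)
  have hfε : PowerFeasible SZ (P + 2 * ε) (fun θ => SV θ + ε) (causalPoly m b) := by
    refine ⟨?_, hiε, hip, ?_⟩
    · filter_upwards [h.nonneg] with θ a using by positivity
    · rw [inputPower, integral_add hiε hip,
        integral_add h.integrable (integrable_const _), integral_const]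
      have h1 := h.power_le
      rw [inputPower, integral_add h.integrable h.integrable_filter] at h1
      have h2 : ε * min 1 δ ≤ ε := by
        nlinarith [min_le_left 1 δ]
      simp only [probReal_univ, one_smul]
      linarith
  have hiY := h.integrable_output hSZ hw0 hB.memLp.aestronglyMeasurable
  have hiYε := hfε.integrable_output hSZ hw0 hpc.aestronglyMeasurable
  have hYε : PaleyWiener (outputSpectrum SZ (fun θ => SV θ + ε) (causalPoly m b)) := by
    refine .of_lowerBound hiYε ?_ (integrable_const (Real.log ε)) ?_
    all_goals
      filter_upwards [h.nonneg, hw0] with θ a c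
      have : ε ≤ outputSpectrum SZ (fun θ => SV θ + ε) (causalPoly m b) θ := by
        have : 0 ≤ ‖1 + causalPoly m b θ‖ ^ 2 * SZ θ := by positivity
        rw [outputSpectrum]; linarith
    · exact hε0.trans_le this
    · exact Real.log_le_log hε0 this
  -- the logarithm loses at most `δ` through the approximation
  have hloss : L - δ ≤ ∫ θ, Real.log (outputSpectrum SZ (fun θ => SV θ + ε) (causalPoly m b) θ)
      ∂circleMeasure := by
    have hi1 := integrable_norm_sq_one_add hSZ hw0 hB.memLp.aestronglyMeasurable h.integrable_filter
    have hi2 := integrable_norm_sq_one_add hSZ hw0 hpc.aestronglyMeasurable hip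
    have hid : Integrable (fun θ => |‖1 + B θ‖ ^ 2 * SZ θ - ‖1 + causalPoly m b θ‖ ^ 2 * SZ θ| / ε)
        circleMeasure := (hi1.sub hi2).abs.div_const _
    calc L - δ ≤ L - ∫ θ, |‖1 + B θ‖ ^ 2 * SZ θ - ‖1 + causalPoly m b θ‖ ^ 2 * SZ θ| / ε
          ∂circleMeasure := by
          rw [integral_div]
          have : (∫ θ, |‖1 + B θ‖ ^ 2 * SZ θ - ‖1 + causalPoly m b θ‖ ^ 2 * SZ θ| ∂circleMeasure) / ε
              ≤ δ := by
            rw [div_le_iff₀ hε0]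
            nlinarith [min_le_right 1 δ]
          linarith
      _ = ∫ θ, (Real.log (outputSpectrum SZ SV B θ) -
            |‖1 + B θ‖ ^ 2 * SZ θ - ‖1 + causalPoly m b θ‖ ^ 2 * SZ θ| / ε) ∂circleMeasure := by
          rw [integral_sub hY.integrable_log hid]; rfl
      _ ≤ _ := by
          refine integral_mono_ae (hY.integrable_log.sub hid) hYε.integrable_log ?_
          filter_upwards [h.nonneg, hw0, hY.pos] with θ a c d
          have e1 : 0 ≤ ‖1 + B θ‖ ^ 2 * SZ θ := by positivity
          have e2 : 0 ≤ ‖1 + causalPoly m b θ‖ ^ 2 * SZ θ := by positivity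
          have e3 := log_sub_le_of_le (a := SV θ + ε + ‖1 + causalPoly m b θ‖ ^ 2 * SZ θ)
            (b := SV θ + ε + ‖1 + B θ‖ ^ 2 * SZ θ) hε0 (by linarith) (by linarith)
          rw [add_sub_add_left_eq_sub] at e3
          have e4 : Real.log (outputSpectrum SZ SV B θ) ≤
              Real.log (SV θ + ε + ‖1 + B θ‖ ^ 2 * SZ θ) := by
            refine Real.log_le_log d ?_
            rw [outputSpectrum]; linarith
          simp only [outputSpectrum] at e4 ⊢
          linarith
  have hmixF : mixFilter t (causalPoly m b) 0 = causalPoly m fun k => (1 - t) * b k := by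
    ext θ
    simp only [mixFilter, causalPoly, Finset.mul_sum, Pi.zero_apply, mul_zero, add_zero]
    refine Finset.sum_congr rfl fun k _ => ?_
    push_cast; ring
  have hmixY : outputSpectrum SZ (mixSignal SZ t (fun θ => SV θ + ε) (causalPoly m b) 0 0)
      (mixFilter t (causalPoly m b) 0) = fun θ =>
      (1 - t) * outputSpectrum SZ (fun θ => SV θ + ε) (causalPoly m b) θ + t * SZ θ := by
    ext θ
    rw [outputSpectrum_mix, outputSpectrum_zero]
  obtain ⟨hPWm, hlog⟩ := hYε.segment hPW hiYε hSZ ht.le ht1.le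
  have hfm := hfε.mix hSZ hw0 hpc.aestronglyMeasurable aestronglyMeasurable_const
    (powerFeasible_zero (SZ := SZ) le_rfl) ht.le ht1.le
  have hval := hM ⟨mixSignal SZ t (fun θ => SV θ + ε) (causalPoly m b) 0 0, m,
    fun k => (1 - t) * b k, by
      rw [← hmixF]
      refine ⟨hfm.nonneg, hfm.integrable, hfm.integrable_filter, hfm.power_le.trans ?_⟩
      rw [hε]; nlinarith [mul_pos ht ht, mul_pos (mul_pos ht ht) hP], by
      rw [← hmixF, hmixY]; exact hPWm, rfl⟩
  rw [← hmixF, logOutput, hmixY] at hval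
  have := hlog.trans hval
  nlinarith

end

/-! ### Necessary conditions: power and water-filling -/

section

variable {SZ : Torus → ℝ} {P : ℝ}

lemma IsOptimalPair.integrable_output (hSZ : Integrable SZ circleMeasure) (hPW : PaleyWiener SZ)
    {SV : Torus → ℝ} {B : Torus → ℂ} (h : IsOptimalPair SZ P SV B) :
    Integrable (outputSpectrum SZ SV B) circleMeasure :=
  h.feasible.integrable_output hSZ hPW.nonneg h.strictlyCausal.memLp.aestronglyMeasurable

/-- No feasible pair in `H₂` improves on an optimal pair. -/
lemma IsOptimalPair.logOutput_le (hP : 0 ≤ P) (hSZ : Integrable SZ circleMeasure)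
    (hEven : ∀ᵐ θ ∂circleMeasure, SZ (-θ) = SZ θ) (hPW : PaleyWiener SZ)
    {SV SV' : Torus → ℝ} {B B' : Torus → ℂ} (h : IsOptimalPair SZ P SV B)
    (hB' : StrictlyCausalH2 B') (hf' : PowerFeasible SZ P SV' B')
    (hY' : PaleyWiener (outputSpectrum SZ SV' B')) : logOutput SZ SV' B' ≤ logOutput SZ SV B :=
  logOutput_le_of_upperBound hP hSZ hEven hPW hB' hf' hY' h.isLUB.1

/-- An optimal pair uses the whole power, for unused power could be added to `S_V`. -/
theorem IsOptimalPair.inputPower_eq (hP : 0 ≤ P) (hSZ : Integrable SZ circleMeasure)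
    (hEven : ∀ᵐ θ ∂circleMeasure, SZ (-θ) = SZ θ) (hPW : PaleyWiener SZ)
    {SV : Torus → ℝ} {B : Torus → ℂ} (h : IsOptimalPair SZ P SV B) : inputPower SZ SV B = P := by
  by_contra hne
  have hlt : inputPower SZ SV B < P := lt_of_le_of_ne h.feasible.power_le hne
  set ε := P - inputPower SZ SV B with hε
  have hε0 : 0 < ε := by linarith
  have hiε : Integrable (fun θ => SV θ + ε) circleMeasure :=
    h.feasible.integrable.add (integrable_const _)
  have hf : PowerFeasible SZ P (fun θ => SV θ + ε) B := by
    refine ⟨?_, hiε, h.feasible.integrable_filter, ?_⟩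
    · filter_upwards [h.feasible.nonneg] with θ a using by positivity
    · have h1 : inputPower SZ SV B = _ := integral_add h.feasible.integrable
        h.feasible.integrable_filter
      rw [inputPower, integral_add hiε h.feasible.integrable_filter,
        integral_add h.feasible.integrable (integrable_const _), integral_const]
      simp only [probReal_univ, one_smul]
      linarith
  have hout : ∀ θ, outputSpectrum SZ (fun θ => SV θ + ε) B θ = outputSpectrum SZ SV B θ + ε := by
    intro θ; simp only [outputSpectrum]; ring
  have hPW' : PaleyWiener (outputSpectrum SZ (fun θ => SV θ + ε) B) :=
    h.paleyWiener.mono (hf.integrable_output hSZ hPW.nonneg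
      h.strictlyCausal.memLp.aestronglyMeasurable) (ae_of_all _ fun θ => by rw [hout]; linarith)
  have hle := h.logOutput_le hP hSZ hEven hPW h.strictlyCausal hf hPW'
  have hpos : ∀ᵐ θ ∂circleMeasure, 0 < Real.log (outputSpectrum SZ (fun θ => SV θ + ε) B θ) -
      Real.log (outputSpectrum SZ SV B θ) := by
    filter_upwards [h.paleyWiener.pos] with θ a
    rw [hout, sub_pos]
    exact Real.log_lt_log a (by linarith)
  have h0 := (integral_eq_zero_iff_of_nonneg_ae (hpos.mono fun _ h => h.le)
    (hPW'.integrable_log.sub h.paleyWiener.integrable_log)).1 (le_antisymm (by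
      rw [integral_sub hPW'.integrable_log h.paleyWiener.integrable_log]
      exact sub_nonpos.2 hle) (integral_nonneg_of_ae (hpos.mono fun _ h => h.le)))
  obtain ⟨θ, h1, h2⟩ := (hpos.and h0).exists
  simp only [Pi.zero_apply] at h2
  linarith

lemma sub_two_mul_sq_le_log_one_add {x : ℝ} (hx : -(1 / 2) ≤ x) :
    x - 2 * x ^ 2 ≤ Real.log (1 + x) := by
  have h0 : 0 < 1 + x := by linarith
  refine le_trans ?_ (Real.one_sub_inv_le_log_of_pos h0)
  have : 1 - (1 + x)⁻¹ = x / (1 + x) := by field_simp; ring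
  rw [this, le_div_iff₀ h0]
  nlinarith [mul_nonneg (sq_nonneg x) (by linarith : 0 ≤ 1 + 2 * x)]

/-- The first-order condition for variations of the signal spectrum alone. -/
lemma IsOptimalPair.integral_variation_nonpos (hP : 0 ≤ P) (hSZ : Integrable SZ circleMeasure)
    (hEven : ∀ᵐ θ ∂circleMeasure, SZ (-θ) = SZ θ) (hPW : PaleyWiener SZ)
    {SV : Torus → ℝ} {B : Torus → ℂ} (h : IsOptimalPair SZ P SV B) {D : Torus → ℝ}
    (hD : Integrable D circleMeasure) {K : ℝ} (hK : 0 < K)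
    (hDK : ∀ᵐ θ ∂circleMeasure, |D θ| ≤ K * outputSpectrum SZ SV B θ)
    (hD0 : ∫ θ, D θ ∂circleMeasure ≤ 0) (hDS : ∀ᵐ θ ∂circleMeasure, 0 ≤ SV θ + D θ) :
    ∫ θ, D θ / outputSpectrum SZ SV B θ ∂circleMeasure ≤ 0 := by
  have hY := h.integrable_output hSZ hPW
  have hratio : ∀ᵐ θ ∂circleMeasure, |D θ / outputSpectrum SZ SV B θ| ≤ K := by
    filter_upwards [hDK, h.paleyWiener.pos] with θ a b
    rw [abs_div, abs_of_pos b, div_le_iff₀ b]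
    exact a
  have hri : Integrable (fun θ => D θ / outputSpectrum SZ SV B θ) circleMeasure :=
    Integrable.of_bound (hD.aestronglyMeasurable.aemeasurable.div
      hY.aestronglyMeasurable.aemeasurable).aestronglyMeasurable K hratio
  have hstep : ∀ s : ℝ, 0 < s → s ≤ 1 → s * K ≤ 1 / 2 →
      ∫ θ, D θ / outputSpectrum SZ SV B θ ∂circleMeasure ≤ 2 * K ^ 2 * s := by
    intro s hs hs1 hsK
    have hiS : Integrable (fun θ => SV θ + s * D θ) circleMeasure :=
      h.feasible.integrable.add (hD.const_mul s)
    have hf : PowerFeasible SZ P (fun θ => SV θ + s * D θ) B := by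
      refine ⟨?_, hiS, h.feasible.integrable_filter, ?_⟩
      · filter_upwards [h.feasible.nonneg, hDS] with θ a b
        nlinarith
      · have h1 : inputPower SZ SV B = _ := integral_add h.feasible.integrable
          h.feasible.integrable_filter
        rw [inputPower, integral_add hiS h.feasible.integrable_filter,
          integral_add h.feasible.integrable (hD.const_mul s), integral_const_mul]
        have := h.feasible.power_le
        nlinarith
    have hout : ∀ θ, outputSpectrum SZ (fun θ => SV θ + s * D θ) B θ =
        outputSpectrum SZ SV B θ + s * D θ := by
      intro θ; simp only [outputSpectrum]; ring
    have hlow : ∀ᵐ θ ∂circleMeasure, 0 < outputSpectrum SZ SV B θ + s * D θ ∧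
        Real.log (outputSpectrum SZ SV B θ) + (s * (D θ / outputSpectrum SZ SV B θ) -
          2 * (s * K) ^ 2) ≤ Real.log (outputSpectrum SZ SV B θ + s * D θ) := by
      filter_upwards [hratio, h.paleyWiener.pos] with θ a b
      set x := D θ / outputSpectrum SZ SV B θ with hx
      have hDx : D θ = x * outputSpectrum SZ SV B θ := by rw [hx]; field_simp
      have hsx : |s * x| ≤ s * K := by
        rw [abs_mul, abs_of_pos hs]; gcongr
      have hx2 : -(1 / 2) ≤ s * x := by linarith [(abs_le.1 hsx).1]
      have hfac : outputSpectrum SZ SV B θ + s * D θ =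
          outputSpectrum SZ SV B θ * (1 + s * x) := by rw [hDx]; ring
      have h1 : 0 < 1 + s * x := by linarith
      rw [hfac]
      refine ⟨by positivity, ?_⟩
      rw [Real.log_mul b.ne' h1.ne']
      have h2 := sub_two_mul_sq_le_log_one_add hx2
      have h3 : (s * x) ^ 2 ≤ (s * K) ^ 2 := sq_le_sq' (abs_le.1 hsx).1 (abs_le.1 hsx).2
      linarith
    have hig : Integrable (fun θ => s * (D θ / outputSpectrum SZ SV B θ) - 2 * (s * K) ^ 2)
        circleMeasure := (hri.const_mul s).sub (integrable_const _)
    have hPW' : PaleyWiener (outputSpectrum SZ (fun θ => SV θ + s * D θ) B) := by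
      refine .of_lowerBound (hf.integrable_output hSZ hPW.nonneg
        h.strictlyCausal.memLp.aestronglyMeasurable) ?_ (h.paleyWiener.integrable_log.add hig) ?_
      · filter_upwards [hlow] with θ a
        rw [hout]; exact a.1
      · filter_upwards [hlow] with θ a
        rw [hout]; exact a.2
    have h1 := h.logOutput_le hP hSZ hEven hPW h.strictlyCausal hf hPW'
    have h2 : ∫ θ, (Real.log (outputSpectrum SZ SV B θ) +
        (s * (D θ / outputSpectrum SZ SV B θ) - 2 * (s * K) ^ 2)) ∂circleMeasure ≤
        logOutput SZ (fun θ => SV θ + s * D θ) B := by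
      refine integral_mono_ae (h.paleyWiener.integrable_log.add hig) hPW'.integrable_log ?_
      filter_upwards [hlow] with θ a
      simp only [hout]; exact a.2
    rw [integral_add h.paleyWiener.integrable_log hig,
      integral_sub (hri.const_mul s) (integrable_const _), integral_const_mul, integral_const] at h2
    simp only [probReal_univ, one_smul] at h2
    have h3 : logOutput SZ SV B = ∫ θ, Real.log (outputSpectrum SZ SV B θ) ∂circleMeasure := rfl
    rw [← h3] at h2
    have h4 : s * ∫ θ, D θ / outputSpectrum SZ SV B θ ∂circleMeasure ≤ s * (2 * K ^ 2 * s) := by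
      nlinarith
    exact le_of_mul_le_mul_left h4 hs
  have hlim : Tendsto (fun s : ℝ => 2 * K ^ 2 * s) (𝓝[>] 0) (𝓝 (2 * K ^ 2 * 0)) := by
    refine Tendsto.mono_left (Continuous.tendsto ?_ 0) nhdsWithin_le_nhds
    fun_prop
  rw [mul_zero] at hlim
  refine ge_of_tendsto hlim ?_
  filter_upwards [Ioo_mem_nhdsGT (lt_min one_pos (by positivity : 0 < 1 / (2 * K)))] with s hs
  have h1 : s ≤ 1 / (2 * K) := hs.2.le.trans (min_le_right _ _)
  refine hstep s hs.1 (hs.2.le.trans (min_le_left _ _)) ?_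
  rw [le_div_iff₀ (by positivity)] at h1
  linarith

lemma essInf_output_le {S : Torus → ℝ} (hS : ∀ᵐ θ ∂circleMeasure, 0 ≤ S θ) :
    ∀ᵐ θ ∂circleMeasure, essInf S circleMeasure ≤ S θ :=
  ae_essInf_le ⟨0, by simpa using hS⟩

lemma le_essInf_of_integrable {S : Torus → ℝ} (hS : Integrable S circleMeasure) {a : ℝ}
    (ha : ∀ᵐ θ ∂circleMeasure, a ≤ S θ) : a ≤ essInf S circleMeasure := by
  refine le_essInf_of_ae_le a ha ⟨∫ θ, S θ ∂circleMeasure, fun c hc => ?_⟩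
  simpa using integral_mono_ae (integrable_const c) hS hc

/-- The water-filling condition: moving signal power from frequencies with `S_Y > b` to frequencies
with `S_Y < a < b` would increase the objective. -/
theorem IsOptimalPair.waterFilling (hP : 0 ≤ P) (hSZ : Integrable SZ circleMeasure)
    (hEven : ∀ᵐ θ ∂circleMeasure, SZ (-θ) = SZ θ) (hPW : PaleyWiener SZ)
    {SV : Torus → ℝ} {B : Torus → ℂ} (h : IsOptimalPair SZ P SV B) :
    ∀ᵐ θ ∂circleMeasure, SV θ * (outputSpectrum SZ SV B θ -
        essInf (outputSpectrum SZ SV B) circleMeasure) = 0 := by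
  have hY := h.integrable_output hSZ hPW
  set S := outputSpectrum SZ SV B with hSdef
  set lam := essInf S circleMeasure with hlam
  have hge : ∀ᵐ θ ∂circleMeasure, lam ≤ S θ := essInf_output_le h.paleyWiener.nonneg
  obtain ⟨g, hgm, hSg⟩ := hY.aestronglyMeasurable
  have hgm := hgm.measurable
  have key : ∀ a b : ℝ, lam < a → a < b → ∀ᵐ θ ∂circleMeasure, b < S θ → SV θ = 0 := by
    intro a b hla hab
    have hlam0 : 0 ≤ lam := le_essInf_of_integrable hY h.paleyWiener.nonneg
    have ha0 : 0 < a := hlam0.trans_lt hla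
    have hb0 : 0 < b := ha0.trans hab
    obtain ⟨η, hη0, hE⟩ : ∃ η : ℝ, 0 < η ∧ circleMeasure {θ | η < g θ ∧ g θ < a} ≠ 0 := by
      by_contra! hcon
      have h1 : ∀ᵐ θ ∂circleMeasure, ∀ k : ℕ, ¬ (1 / ((k : ℝ) + 1) < g θ ∧ g θ < a) := by
        rw [ae_all_iff]; intro k
        rw [ae_iff]
        simpa using hcon (1 / ((k : ℝ) + 1)) (by positivity)
      have h2 : ∀ᵐ θ ∂circleMeasure, a ≤ S θ := by
        filter_upwards [h1, hSg, h.paleyWiener.pos] with θ c d e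
        by_contra! hlt
        obtain ⟨k, hk⟩ := exists_nat_one_div_lt (show 0 < S θ from e)
        exact c k ⟨d ▸ hk, d ▸ hlt⟩
      have h3 : a ≤ lam := le_essInf_of_integrable hY h2
      linarith
    -- the bound `η < g` on `E` keeps the relative variation `D / S` bounded
    set E := {θ | η < g θ ∧ g θ < a} with hEdef
    have hEm : MeasurableSet E :=
      (measurableSet_lt measurable_const hgm).inter (measurableSet_lt hgm measurable_const)
    set A := {θ | b < g θ} with hAdef
    have hAm : MeasurableSet A := measurableSet_lt measurable_const hgm
    set e := circleMeasure.real E with he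
    have he0 : 0 < e := ENNReal.toReal_pos hE (measure_ne_top _ _)
    set p := ∫ θ, A.indicator SV θ ∂circleMeasure with hp
    have hAi : Integrable (A.indicator SV) circleMeasure := h.feasible.integrable.indicator hAm
    have hAnn : ∀ᵐ θ ∂circleMeasure, 0 ≤ A.indicator SV θ := by
      filter_upwards [h.feasible.nonneg] with θ c
      exact Set.indicator_apply_nonneg fun _ => c
    have hp0 : 0 ≤ p := integral_nonneg_of_ae hAnn
    have hEi : Integrable (E.indicator fun _ => p / e) circleMeasure :=
      (integrable_const _).indicator hEm
    have hEint : ∀ c : ℝ, ∫ θ, E.indicator (fun _ => c) θ ∂circleMeasure = e * c := by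
      intro c
      rw [integral_indicator_const _ hEm, smul_eq_mul]
    -- the power `p` of the signal on `A` is spread uniformly over `E`
    set D : Torus → ℝ := fun θ => E.indicator (fun _ => p / e) θ - A.indicator SV θ with hD
    have hDi : Integrable D circleMeasure := hEi.sub hAi
    have hDK : ∀ᵐ θ ∂circleMeasure, |D θ| ≤ (p / (e * η) + 1) * S θ := by
      filter_upwards [h.feasible.nonneg, hPW.pos, h.paleyWiener.pos, hSg] with θ c d f k
      have h1 : |E.indicator (fun _ => p / e) θ| ≤ p / (e * η) * S θ := by
        by_cases hθ : θ ∈ E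
        · rw [Set.indicator_of_mem hθ, abs_of_nonneg (by positivity)]
          have : η < S θ := k ▸ hθ.1
          calc p / e = p / (e * η) * η := by field_simp
            _ ≤ _ := by gcongr
        · rw [Set.indicator_of_notMem hθ, abs_zero]
          have : 0 < S θ := f
          positivity
      have h2 : |A.indicator SV θ| ≤ S θ := by
        have h3 : SV θ ≤ S θ := by
          have : 0 ≤ ‖1 + B θ‖ ^ 2 * SZ θ := by positivity
          rw [hSdef, outputSpectrum]; linarith
        by_cases hθ : θ ∈ A
        · rwa [Set.indicator_of_mem hθ, abs_of_nonneg c]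
        · rw [Set.indicator_of_notMem hθ, abs_zero]; exact c.trans h3
      calc |D θ| ≤ |E.indicator (fun _ => p / e) θ| + |A.indicator SV θ| := abs_sub _ _
        _ ≤ _ := by linarith
    have hDS : Integrable (fun θ => D θ / S θ) circleMeasure := by
      refine Integrable.of_bound (hDi.aestronglyMeasurable.aemeasurable.div
        hY.aestronglyMeasurable.aemeasurable).aestronglyMeasurable (p / (e * η) + 1) ?_
      filter_upwards [hDK, h.paleyWiener.pos] with θ c d
      rw [Real.norm_eq_abs, abs_div, abs_of_pos (show 0 < S θ from d), div_le_iff₀ d]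
      exact c
    have hvar := h.integral_variation_nonpos hP hSZ hEven hPW hDi (K := p / (e * η) + 1)
      (by positivity) hDK ?_ ?_
    · have hlow : ∫ θ, (E.indicator (fun _ => p / e / a) θ - A.indicator SV θ / b) ∂circleMeasure ≤
          ∫ θ, D θ / S θ ∂circleMeasure := by
        refine integral_mono_ae (((integrable_const _).indicator hEm).sub (hAi.div_const b)) hDS ?_
        filter_upwards [h.feasible.nonneg, h.paleyWiener.pos, hSg] with θ c d k
        have hd : 0 < S θ := d
        have h1 : E.indicator (fun _ => p / e / a) θ ≤ E.indicator (fun _ => p / e) θ / S θ := by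
          by_cases hθ : θ ∈ E
          · rw [Set.indicator_of_mem hθ, Set.indicator_of_mem hθ]
            have : S θ < a := k ▸ hθ.2
            gcongr
          · simp [hθ]
        have h2 : A.indicator SV θ / S θ ≤ A.indicator SV θ / b := by
          by_cases hθ : θ ∈ A
          · rw [Set.indicator_of_mem hθ]
            have : b < S θ := k ▸ hθ
            gcongr
          · simp [hθ]
        rw [hD, sub_div]
        linarith
      rw [integral_sub ((integrable_const _).indicator hEm) (hAi.div_const b), hEint,
        integral_div, ← hp] at hlow
      have h1 : e * (p / e / a) = p / a := by field_simp
      rw [h1] at hlow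
      have h2 : p / a ≤ p / b := by linarith
      have h3 : p = 0 := by
        rw [div_le_div_iff₀ ha0 hb0] at h2
        nlinarith
      have h4 := (integral_eq_zero_iff_of_nonneg_ae hAnn hAi).1 h3
      filter_upwards [h4, hSg] with θ c d hbS
      have : θ ∈ A := by rw [hAdef, Set.mem_ofPred_eq, ← d]; exact hbS
      simpa [this] using c
    · rw [integral_sub hEi hAi, hEint, ← hp]
      field_simp; simp
    · filter_upwards [h.feasible.nonneg] with θ c
      have h1 : A.indicator SV θ ≤ SV θ := Set.indicator_apply_le' (fun _ => le_rfl) fun _ => c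
      have h2 : 0 ≤ E.indicator (fun _ => p / e) θ :=
        Set.indicator_apply_nonneg fun _ => by positivity
      rw [hD]; linarith
  have hall : ∀ᵐ θ ∂circleMeasure, ∀ q r : ℚ, lam < q → (q : ℝ) < r → (r : ℝ) < S θ → SV θ = 0 := by
    simp only [ae_all_iff, Filter.eventually_imp_distrib_left]
    intro q r hq hr
    exact key q r hq hr
  filter_upwards [hge, hall] with θ h1 h2
  rcases h1.eq_or_lt with h3 | h3
  · rw [← h3, sub_self, mul_zero]
  · obtain ⟨r, hr1, hr2⟩ := exists_rat_btwn h3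
    obtain ⟨q, hq1, hq2⟩ := exists_rat_btwn hr1
    rw [h2 q r hq1 hq2 hr2, zero_mul]

end

/-! ### Necessary conditions: orthogonality -/

/-- The case of Jensen's formula without zeros: `1 - t zⁿ` has geometric mean `1` on the circle. -/
lemma integral_log_norm_one_sub_fourier {n : ℕ} (hn : 0 < n) {t : ℝ} (ht : |t| < 1) :
    ∫ θ, Real.log ‖1 - (t : ℂ) * fourier (n : ℤ) θ‖ ∂circleMeasure = 0 := by
  have hcont : ∀ k : ℕ, Continuous fun θ : Torus => ((t : ℂ) * fourier (n : ℤ) θ) ^ k / (k : ℂ) :=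
    fun k => ((continuous_const.mul (fourier (n : ℤ)).continuous).pow k).div_const _
  have hint : ∀ k : ℕ, Integrable (fun θ : Torus => ((t : ℂ) * fourier (n : ℤ) θ) ^ k / (k : ℂ))
      circleMeasure := fun k =>
    (hcont k).integrable_of_hasCompactSupport (HasCompactSupport.of_compactSpace _)
  have hnorm : ∀ (k : ℕ) (θ : Torus), ‖((t : ℂ) * fourier (n : ℤ) θ) ^ k / (k : ℂ)‖ ≤ |t| ^ k := by
    intro k θ
    rw [norm_div, norm_pow, norm_mul, norm_fourier_apply, mul_one, Complex.norm_real,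
      Real.norm_eq_abs, Complex.norm_natCast]
    rcases k.eq_zero_or_pos with rfl | hk
    · simp
    · exact div_le_self (by positivity) (by exact_mod_cast hk)
  have hsum := hasSum_integral_of_summable_integral_norm hint (by
    refine Summable.of_nonneg_of_le (fun k => integral_nonneg fun θ => norm_nonneg _) (fun k => ?_)
      (summable_geometric_of_lt_one (abs_nonneg t) ht)
    calc _ ≤ ∫ θ : Torus, |t| ^ k ∂circleMeasure :=
          integral_mono (hint k).norm (integrable_const _) (hnorm k)
      _ = |t| ^ k := by simp)
  have hzero : ∀ k : ℕ, ∫ θ, ((t : ℂ) * fourier (n : ℤ) θ) ^ k / (k : ℂ) ∂circleMeasure = 0 := by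
    intro k
    rcases k.eq_zero_or_pos with rfl | hk
    · simp
    · have h1 : ∀ θ : Torus, ((t : ℂ) * fourier (n : ℤ) θ) ^ k / (k : ℂ) =
          ((t : ℂ) ^ k / k) * fourier ((n * k : ℕ) : ℤ) θ := by
        intro θ
        have h2 : (fourier (n : ℤ) θ : ℂ) ^ k = fourier ((n * k : ℕ) : ℤ) θ := by
          rw [fourier_natCast_eq_pow n, fourier_natCast_eq_pow (n * k), pow_mul]; rfl
        rw [mul_pow, h2]; ring
      simp_rw [h1]
      rw [integral_const_mul]
      have h3 := congrFun (fourierCoeff_fourier (T := 2 * Real.pi) ((n * k : ℕ) : ℤ)) 0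
      rw [fourierCoeff, Pi.single_eq_of_ne (by positivity)] at h3
      simp only [neg_zero, fourier_zero, one_smul] at h3
      rw [h3, mul_zero]
  simp_rw [hzero] at hsum
  have h0 := hsum.unique hasSum_zero
  have hlt : ∀ θ : Torus, ‖(t : ℂ) * fourier (n : ℤ) θ‖ < 1 := by
    intro θ
    rwa [norm_mul, norm_fourier_apply, mul_one, Complex.norm_real, Real.norm_eq_abs]
  simp_rw [fun θ : Torus => (Complex.hasSum_taylorSeries_neg_log (hlt θ)).tsum_eq] at h0
  have hlogint : Integrable (fun θ : Torus => -Complex.log (1 - (t : ℂ) * fourier (n : ℤ) θ))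
      circleMeasure := by
    refine Continuous.integrable_of_hasCompactSupport (Continuous.neg ?_)
      (HasCompactSupport.of_compactSpace _)
    refine Continuous.clog (continuous_const.sub
      (continuous_const.mul (fourier (n : ℤ)).continuous)) fun θ => ?_
    left
    have h1 := (Complex.re_le_norm ((t : ℂ) * fourier (n : ℤ) θ)).trans_lt (hlt θ)
    rw [Complex.sub_re, Complex.one_re]; linarith
  have h1 := integral_re hlogint
  rw [h0] at h1
  simp only [RCLike.re_to_complex, Complex.neg_re, Complex.log_re, Complex.zero_re] at h1
  rw [integral_neg] at h1
  linarith

lemma fourierCoeff_fourier_mul (m n : ℤ) (f : Torus → ℂ) :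
    fourierCoeff (fun θ => fourier m θ * f θ) n = fourierCoeff f (n - m) := by
  rw [fourierCoeff, fourierCoeff]
  congr 1; ext θ
  rw [smul_eq_mul, smul_eq_mul, ← mul_assoc, ← fourier_add]
  congr 3; ring

/-- The filter `B'` with `1 + B' = (1 - t zⁿ) (1 + B)`. -/
lemma StrictlyCausalH2.precode {B : Torus → ℂ} (hB : StrictlyCausalH2 B) {n : ℕ} (hn : 0 < n)
    (t : ℝ) : StrictlyCausalH2 (fun θ => B θ - t * fourier (n : ℤ) θ * (1 + B θ)) := by
  have hone : MemLp (fun _ : Torus => (1 : ℂ)) 2 circleMeasure := memLp_const 1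
  have h1 : MemLp (fun θ => 1 + B θ) 2 circleMeasure := hone.add hB.memLp
  have h2 : MemLp (fun θ => fourier (n : ℤ) θ * (1 + B θ)) 2 circleMeasure := by
    refine h1.of_le (((fourier (n : ℤ)).continuous.aestronglyMeasurable).mul
      h1.aestronglyMeasurable) (ae_of_all _ fun θ => ?_)
    rw [norm_mul, norm_fourier_apply, one_mul]
  have h3 := h2.const_smul (-t : ℂ)
  have heq : (fun θ => B θ - t * fourier (n : ℤ) θ * (1 + B θ)) =
      B + (-t : ℂ) • fun θ => fourier (n : ℤ) θ * (1 + B θ) := by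
    ext θ; simp only [Pi.add_apply, Pi.smul_apply, smul_eq_mul]; ring
  have hone_co : ∀ k : ℤ, fourierCoeff (fun _ : Torus => (1 : ℂ)) k = if k = 0 then 1 else 0 := by
    intro k
    have := congrFun (fourierCoeff_fourier (T := 2 * Real.pi) 0) k
    rw [Pi.single_apply] at this
    rw [← this]
    congr 1; ext θ; simp
  have hco : ∀ k, fourierCoeff (fun θ => B θ - t * fourier (n : ℤ) θ * (1 + B θ)) k =
      fourierCoeff B k - t * ((if k - n = 0 then 1 else 0) + fourierCoeff B (k - n)) := by
    intro k
    have h4 : fourierCoeff (fun θ => 1 + B θ) (k - n) = _ :=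
      congrFun (fourierCoeff.add (hone.integrable (by norm_num))
        (hB.memLp.integrable (by norm_num))) (k - n)
    rw [heq, fourierCoeff.add (hB.memLp.integrable (by norm_num)) (h3.integrable (by norm_num)),
      Pi.add_apply, fourierCoeff.const_smul, fourierCoeff_fourier_mul, h4, Pi.add_apply, hone_co,
      smul_eq_mul]
    ring
  refine ⟨heq ▸ hB.memLp.add h3, fun k hk => ?_, fun k => ?_⟩
  · rw [hco, hB.coeff_eq_zero k hk, hB.coeff_eq_zero (k - n) (by omega),
      if_neg (by omega)]
    simp
  · rw [hco]
    split_ifs <;> simp [hB.coeff_real]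

section

variable {SZ : Torus → ℝ} {P : ℝ}

/-- The cross-spectrum of input and output. -/
noncomputable def crossSpectrum (SZ SV : Torus → ℝ) (B : Torus → ℂ) (θ : Torus) : ℂ :=
  (SV θ : ℂ) + B θ * (SZ θ : ℂ) * (1 + conj (B θ))

lemma PowerFeasible.integrable_crossSpectrum (hSZ : Integrable SZ circleMeasure)
    (hw0 : ∀ᵐ θ ∂circleMeasure, 0 ≤ SZ θ) {SV : Torus → ℝ} {B : Torus → ℂ}
    (hB : AEStronglyMeasurable B circleMeasure) (h : PowerFeasible SZ P SV B) :
    Integrable (crossSpectrum SZ SV B) circleMeasure := by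
  refine h.integrable.ofReal.add (Integrable.mono' (h.integrable_filter.add
    (integrable_norm_sq_one_add hSZ hw0 hB h.integrable_filter)) ?_ ?_)
  · exact (hB.mul (Complex.continuous_ofReal.comp_aestronglyMeasurable
      hSZ.aestronglyMeasurable)).mul (aestronglyMeasurable_const.add hB.star)
  · filter_upwards [hw0] with θ a
    rw [norm_mul, norm_mul, Complex.norm_real, Real.norm_of_nonneg a]
    have h1 : ‖1 + conj (B θ)‖ = ‖1 + B θ‖ := by
      rw [← Complex.norm_conj (1 + B θ), map_add, map_one]
    rw [h1]
    simp only [Pi.add_apply]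
    have h2 : ‖B θ‖ * ‖1 + B θ‖ ≤ ‖B θ‖ ^ 2 + ‖1 + B θ‖ ^ 2 := by
      nlinarith [sq_nonneg (‖B θ‖ - ‖1 + B θ‖), sq_nonneg (‖B θ‖ + ‖1 + B θ‖)]
    nlinarith

/-- The power after the change `1 + x ↦ (1 - t e) (1 + x)`, `s_V ↦ |1 - t e|² s_V`, as a
polynomial in `t` with the cross-spectrum in the linear term and the output in the quadratic one. -/
lemma power_precode (x : ℂ) (sv w t : ℝ) {e : ℂ} (he : ‖e‖ = 1) :
    ‖1 - (t : ℂ) * e‖ ^ 2 * sv + ‖x - t * e * (1 + x)‖ ^ 2 * w =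
      (sv + ‖x‖ ^ 2 * w) - 2 * t * (conj e * ((sv : ℂ) + x * (w : ℂ) * (1 + conj x))).re +
        t ^ 2 * (sv + ‖1 + x‖ ^ 2 * w) := by
  have he2 : e.re * e.re + e.im * e.im = 1 := by
    rw [← Complex.normSq_apply, ← Complex.sq_norm, he, one_pow]
  simp only [Complex.sq_norm, Complex.normSq_apply, Complex.add_re, Complex.add_im, Complex.mul_re,
    Complex.mul_im, Complex.ofReal_re, Complex.ofReal_im, Complex.sub_re, Complex.sub_im,
    Complex.one_re, Complex.one_im, Complex.conj_re, Complex.conj_im]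
  linear_combination (t ^ 2 * sv + t ^ 2 * w * ((1 + x.re) ^ 2 + x.im ^ 2)) * he2

/-- Multiplying the output by `1 - t zⁿ` keeps the objective but changes the power to first order by
`-2 t` times the `n`-th coefficient of the cross-spectrum. -/
lemma IsOptimalPair.fourierCoeff_crossSpectrum_re (hP : 0 ≤ P) (hSZ : Integrable SZ circleMeasure)
    (hEven : ∀ᵐ θ ∂circleMeasure, SZ (-θ) = SZ θ) (hPW : PaleyWiener SZ)
    {SV : Torus → ℝ} {B : Torus → ℂ} (h : IsOptimalPair SZ P SV B) {n : ℕ} (hn : 0 < n) :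
    (fourierCoeff (crossSpectrum SZ SV B) n).re = 0 := by
  have hw0 := hPW.nonneg
  have hBm := h.strictlyCausal.memLp.aestronglyMeasurable
  have hY := h.integrable_output hSZ hPW
  have hc := h.feasible.integrable_crossSpectrum hSZ hw0 hBm
  set R := (fourierCoeff (crossSpectrum SZ SV B) n).re with hR
  set Y := ∫ θ, outputSpectrum SZ SV B θ ∂circleMeasure with hYdef
  have hY0 : 0 ≤ Y := integral_nonneg_of_ae h.paleyWiener.nonneg
  by_contra hR0
  have hRpos : 0 < |R| := abs_pos.2 hR0
  -- `t` has the sign of `R`, makes `-2 t R + t² Y` negative and satisfies `|t| < 1`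
  set t := R / (Y + |R| + 1) with ht
  have hden : 0 < Y + |R| + 1 := by positivity
  have ht1 : |t| < 1 := by
    rw [ht, abs_div, abs_of_pos hden, div_lt_one hden]; linarith
  have htR : R = t * (Y + |R| + 1) := by rw [ht]; field_simp
  have ht0 : t ≠ 0 := by
    rintro h0; rw [h0, zero_mul] at htR; exact hR0 htR
  have hgain : - 2 * t * R + t ^ 2 * Y < 0 := by
    have h1 : 0 < t ^ 2 := by positivity
    have h2 : t * R = t ^ 2 * (Y + |R| + 1) := by rw [ht]; field_simp
    nlinarith
  set e : Torus → ℂ := fun θ => fourier (n : ℤ) θ with he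
  have hec : Continuous e := (fourier (n : ℤ)).continuous
  have hen : ∀ θ, ‖e θ‖ = 1 := norm_fourier_apply _
  set SV' : Torus → ℝ := fun θ => ‖1 - (t : ℂ) * e θ‖ ^ 2 * SV θ with hSV'
  set B' : Torus → ℂ := fun θ => B θ - t * e θ * (1 + B θ) with hB'
  have hB'c : StrictlyCausalH2 B' := h.strictlyCausal.precode hn t
  have hSV'i : Integrable SV' circleMeasure :=
    Integrable.continuous_norm_sq_mul h.feasible.integrable (by fun_prop)
  have hci : Integrable (fun θ => (conj (e θ) * crossSpectrum SZ SV B θ).re) circleMeasure := by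
    have := (hc.fourier_mul (-n)).re
    refine this.congr (ae_of_all _ fun θ => ?_)
    simp only [fourier_neg]; rfl
  have hcR : ∫ θ, (conj (e θ) * crossSpectrum SZ SV B θ).re ∂circleMeasure = R := by
    have h1 := integral_re (hc.fourier_mul (-n))
    rw [hR, fourierCoeff]
    refine Eq.trans (integral_congr_ae (ae_of_all _ fun θ => ?_)) h1
    simp only [fourier_neg]; rfl
  have hpow : ∀ θ, SV' θ + ‖B' θ‖ ^ 2 * SZ θ = (SV θ + ‖B θ‖ ^ 2 * SZ θ) -
      2 * t * (conj (e θ) * crossSpectrum SZ SV B θ).re + t ^ 2 * outputSpectrum SZ SV B θ :=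
    fun θ => power_precode (B θ) (SV θ) (SZ θ) t (hen θ)
  have hp1 : Integrable (fun θ => (SV θ + ‖B θ‖ ^ 2 * SZ θ) -
      2 * t * (conj (e θ) * crossSpectrum SZ SV B θ).re) circleMeasure :=
    h.feasible.integrable_power.sub (hci.const_mul _)
  have hpi : Integrable (fun θ => SV' θ + ‖B' θ‖ ^ 2 * SZ θ) circleMeasure := by
    simp only [hpow]
    exact hp1.add (hY.const_mul _)
  have hB'i : Integrable (fun θ => ‖B' θ‖ ^ 2 * SZ θ) circleMeasure := by
    refine (hpi.sub hSV'i).congr (ae_of_all _ fun θ => ?_)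
    simp
  have hpower : inputPower SZ SV' B' < P := by
    have h1 : inputPower SZ SV' B' = inputPower SZ SV B - 2 * t * R + t ^ 2 * Y := by
      rw [inputPower]
      simp only [hpow]
      rw [integral_add hp1 (hY.const_mul _), integral_sub h.feasible.integrable_power
        (hci.const_mul _), integral_const_mul, integral_const_mul, hcR]
      rfl
    linarith [h.feasible.power_le]
  have hf' : PowerFeasible SZ P SV' B' := by
    refine ⟨?_, hSV'i, hB'i, hpower.le⟩
    filter_upwards [h.feasible.nonneg] with θ a
    rw [hSV']; positivity
  have hout : ∀ θ, outputSpectrum SZ SV' B' θ =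
      ‖1 - (t : ℂ) * e θ‖ ^ 2 * outputSpectrum SZ SV B θ := by
    intro θ
    have h1 : 1 + B' θ = (1 - (t : ℂ) * e θ) * (1 + B θ) := by rw [hB']; ring
    rw [outputSpectrum, h1, norm_mul, outputSpectrum, hSV']; ring
  have hne : ∀ θ, 0 < ‖1 - (t : ℂ) * e θ‖ := by
    intro θ
    rw [norm_pos_iff, sub_ne_zero]
    intro h1
    have := congrArg norm h1
    rw [norm_one, norm_mul, hen, mul_one, Complex.norm_real, Real.norm_eq_abs] at this
    linarith
  have hlogi : Integrable (fun θ => Real.log ‖1 - (t : ℂ) * e θ‖) circleMeasure := by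
    refine Continuous.integrable_of_hasCompactSupport ?_ (HasCompactSupport.of_compactSpace _)
    exact Continuous.log (by fun_prop) fun θ => (hne θ).ne'
  have hlog : ∀ᵐ θ ∂circleMeasure, Real.log (outputSpectrum SZ SV' B' θ) =
      2 * Real.log ‖1 - (t : ℂ) * e θ‖ + Real.log (outputSpectrum SZ SV B θ) := by
    filter_upwards [h.paleyWiener.pos] with θ a
    rw [hout, Real.log_mul (by have := hne θ; positivity) a.ne', Real.log_pow]
    norm_num
  have hPW' : PaleyWiener (outputSpectrum SZ SV' B') := by
    refine ⟨?_, ((hlogi.const_mul 2).add h.paleyWiener.integrable_log).congr (hlog.mono fun _ h => h.symm)⟩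
    filter_upwards [h.paleyWiener.pos] with θ a
    rw [hout]
    have := hne θ
    positivity
  have hobj : logOutput SZ SV' B' = logOutput SZ SV B := by
    rw [logOutput, integral_congr_ae hlog,
      integral_add (hlogi.const_mul 2) h.paleyWiener.integrable_log, integral_const_mul,
      integral_log_norm_one_sub_fourier hn ht1, mul_zero, zero_add, logOutput]
  have hopt' : IsOptimalPair SZ P SV' B' := ⟨hB'c, hf', hPW', hobj ▸ h.isLUB⟩
  exact hpower.ne (hopt'.inputPower_eq hP hSZ hEven hPW)

/-- By water-filling, `S_V` is the positive part of `λ - |1 + B|² S_Z`, hence even. -/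
lemma IsOptimalPair.signal_even (hP : 0 ≤ P) (hSZ : Integrable SZ circleMeasure)
    (hEven : ∀ᵐ θ ∂circleMeasure, SZ (-θ) = SZ θ) (hPW : PaleyWiener SZ)
    {SV : Torus → ℝ} {B : Torus → ℂ} (h : IsOptimalPair SZ P SV B) :
    ∀ᵐ θ ∂circleMeasure, SV (-θ) = SV θ := by
  have hmax : ∀ᵐ θ ∂circleMeasure, SV θ = max (essInf (outputSpectrum SZ SV B) circleMeasure -
      ‖1 + B θ‖ ^ 2 * SZ θ) 0 := by
    filter_upwards [h.waterFilling hP hSZ hEven hPW, h.feasible.nonneg,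
      essInf_output_le h.paleyWiener.nonneg] with θ a b c
    rcases mul_eq_zero.1 a with d | d
    · rw [outputSpectrum] at c
      rw [max_eq_right (by linarith), d]
    · nth_rw 1 [outputSpectrum] at d
      rw [max_eq_left (by linarith)]; linarith
  filter_upwards [hmax, ae_comp_neg hmax, hEven, h.strictlyCausal.comp_neg] with θ a b c d
  rw [a, b, c, d]
  have : ‖1 + conj (B θ)‖ = ‖1 + B θ‖ := by
    rw [← Complex.norm_conj (1 + B θ), map_add, map_one]
  rw [this]

/-- The cross-spectrum of an optimal pair is anticausal.  Its real parts vanish by the first-order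
condition, its imaginary parts because `S_V`, like `S_Z`, is even. -/
theorem IsOptimalPair.anticausal (hP : 0 ≤ P) (hSZ : Integrable SZ circleMeasure)
    (hEven : ∀ᵐ θ ∂circleMeasure, SZ (-θ) = SZ θ) (hPW : PaleyWiener SZ)
    {SV : Torus → ℝ} {B : Torus → ℂ} (h : IsOptimalPair SZ P SV B) :
    Anticausal (crossSpectrum SZ SV B) := by
  refine ⟨h.feasible.integrable_crossSpectrum hSZ hPW.nonneg
    h.strictlyCausal.memLp.aestronglyMeasurable, fun n hn => ?_⟩
  obtain ⟨k, rfl⟩ := Int.eq_ofNat_of_zero_le hn.le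
  apply Complex.ext
  · exact h.fourierCoeff_crossSpectrum_re hP hSZ hEven hPW (by simpa using hn)
  · have hsym : (fun θ => crossSpectrum SZ SV B (-θ)) =ᵐ[circleMeasure]
        fun θ => conj (crossSpectrum SZ SV B θ) := by
      filter_upwards [h.signal_even hP hSZ hEven hPW, hEven, h.strictlyCausal.comp_neg] with θ a b c
      simp only [crossSpectrum, a, b, c, map_add, map_mul, map_one, Complex.conj_ofReal]
    have h1 := congrFun (fourierCoeff_congr_ae hsym) (-(k : ℤ))
    rw [fourierCoeff_comp_neg, fourierCoeff_conj, neg_neg] at h1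
    exact Complex.conj_eq_iff_im.1 h1.symm

end

/-! ### Existence of an optimal pair -/

section

variable {SZ : Torus → ℝ} {P : ℝ}

/-- The competitors of the relaxed problem: feasible pairs with a filter in `H₂` and a finite
objective. -/
structure Admissible (SZ : Torus → ℝ) (P : ℝ) (SV : Torus → ℝ) (B : Torus → ℂ) : Prop where
  strictlyCausal : StrictlyCausalH2 B
  feasible : PowerFeasible SZ P SV B
  paleyWiener : PaleyWiener (outputSpectrum SZ SV B)

lemma admissible_zero (hP : 0 ≤ P) (hPW : PaleyWiener SZ) : Admissible SZ P 0 0 := by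
  refine ⟨?_, powerFeasible_zero hP, by rw [outputSpectrum_zero]; exact hPW⟩
  have : (0 : Torus → ℂ) = causalPoly 0 0 := by ext θ; simp [causalPoly]
  rw [this]
  exact strictlyCausalH2_causalPoly 0 0

lemma Admissible.integrable_output (hSZ : Integrable SZ circleMeasure) (hPW : PaleyWiener SZ)
    {SV : Torus → ℝ} {B : Torus → ℂ} (h : Admissible SZ P SV B) :
    Integrable (outputSpectrum SZ SV B) circleMeasure :=
  h.feasible.integrable_output hSZ hPW.nonneg h.strictlyCausal.memLp.aestronglyMeasurable

lemma Admissible.mix (hSZ : Integrable SZ circleMeasure) (hPW : PaleyWiener SZ)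
    {SV₀ SV₁ : Torus → ℝ} {B₀ B₁ : Torus → ℂ} (h₀ : Admissible SZ P SV₀ B₀)
    (h₁ : Admissible SZ P SV₁ B₁) {t : ℝ} (ht : 0 ≤ t) (ht' : t ≤ 1) :
    Admissible SZ P (mixSignal SZ t SV₀ B₀ SV₁ B₁) (mixFilter t B₀ B₁) ∧
      (1 - t) * logOutput SZ SV₀ B₀ + t * logOutput SZ SV₁ B₁ ≤
        logOutput SZ (mixSignal SZ t SV₀ B₀ SV₁ B₁) (mixFilter t B₀ B₁) := by
  have hf := h₀.feasible.mix hSZ hPW.nonneg h₀.strictlyCausal.memLp.aestronglyMeasurable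
    h₁.strictlyCausal.memLp.aestronglyMeasurable h₁.feasible ht ht'
  have hout : outputSpectrum SZ (mixSignal SZ t SV₀ B₀ SV₁ B₁) (mixFilter t B₀ B₁) = fun θ =>
      (1 - t) * outputSpectrum SZ SV₀ B₀ θ + t * outputSpectrum SZ SV₁ B₁ θ :=
    funext (outputSpectrum_mix SZ t SV₀ B₀ SV₁ B₁)
  obtain ⟨h1, h2⟩ := h₀.paleyWiener.segment h₁.paleyWiener (h₀.integrable_output hSZ hPW)
    (h₁.integrable_output hSZ hPW) ht ht'
  refine ⟨⟨h₀.strictlyCausal.mix h₁.strictlyCausal t, ?_, hout ▸ h1⟩, ?_⟩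
  · have e : (1 - t) * P + t * P = P := by ring
    rwa [e] at hf
  · rw [logOutput, logOutput, logOutput, hout]; exact h2

lemma PowerFeasible.integral_output_le (hSZ : Integrable SZ circleMeasure)
    (hw0 : ∀ᵐ θ ∂circleMeasure, 0 ≤ SZ θ) {SV : Torus → ℝ} {B : Torus → ℂ}
    (hB : AEStronglyMeasurable B circleMeasure) (h : PowerFeasible SZ P SV B) :
    ∫ θ, outputSpectrum SZ SV B θ ∂circleMeasure ≤ 2 * P + 2 * ∫ θ, SZ θ ∂circleMeasure := by
  calc _ ≤ ∫ θ, (2 * (SV θ + ‖B θ‖ ^ 2 * SZ θ) + 2 * SZ θ) ∂circleMeasure := by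
        refine integral_mono_ae (h.integrable_output hSZ hw0 hB)
          ((h.integrable_power.const_mul _).add (hSZ.const_mul _)) ?_
        filter_upwards [h.nonneg, hw0] with θ a b
        rw [outputSpectrum]
        have := norm_add_sq_le_two 1 (B θ)
        rw [norm_one] at this
        nlinarith
    _ = 2 * inputPower SZ SV B + 2 * ∫ θ, SZ θ ∂circleMeasure := by
        rw [integral_add (h.integrable_power.const_mul _) (hSZ.const_mul _), integral_const_mul,
          integral_const_mul, inputPower]
    _ ≤ _ := by linarith [h.power_le]

lemma objectiveValues_nonempty (hP : 0 ≤ P) (hPW : PaleyWiener SZ) :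
    (objectiveValues SZ P).Nonempty := by
  have h := admissible_zero hP hPW
  have : (0 : Torus → ℂ) = causalPoly 0 0 := by ext θ; simp [causalPoly]
  rw [this] at h
  exact ⟨_, 0, 0, 0, h.feasible, h.paleyWiener, rfl⟩

lemma objectiveValues_bddAbove (hSZ : Integrable SZ circleMeasure) (hPW : PaleyWiener SZ) :
    BddAbove (objectiveValues SZ P) := by
  refine ⟨2 * P + 2 * ∫ θ, SZ θ ∂circleMeasure, ?_⟩
  rintro v ⟨SV, m, b, hf, hY, rfl⟩
  have hm := (continuous_causalPoly m b).aestronglyMeasurable (μ := circleMeasure)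
  refine le_trans (integral_mono_ae hY.integrable_log (hf.integrable_output hSZ hPW.nonneg hm) ?_)
    (hf.integral_output_le hSZ hPW.nonneg hm)
  filter_upwards [hY.pos] with θ a
  exact (Real.log_le_sub_one_of_pos a).trans (by linarith)

/-- A quantitative form of the strict concavity of the logarithm. -/
lemma abs_sqrt_sub_sqrt_le {a b η : ℝ} (ha : 0 < a) (hb : 0 < b) (hη : 0 < η) :
    |Real.sqrt a - Real.sqrt b| ≤
      1 / η * (Real.log ((1 - 1 / 2) * a + 1 / 2 * b) -
        ((1 - 1 / 2) * Real.log a + 1 / 2 * Real.log b)) + η * (a + b) := by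
  set x := Real.sqrt a with hx
  set y := Real.sqrt b with hy
  have hx0 : 0 < x := Real.sqrt_pos.2 ha
  have hy0 : 0 < y := Real.sqrt_pos.2 hb
  have hxa : a = x ^ 2 := (Real.sq_sqrt ha.le).symm
  have hyb : b = y ^ 2 := (Real.sq_sqrt hb.le).symm
  have hs : 0 < x ^ 2 + y ^ 2 := by positivity
  have h1 : (x - y) ^ 2 / (x ^ 2 + y ^ 2) ≤ Real.log ((1 - 1 / 2) * a + 1 / 2 * b) -
      ((1 - 1 / 2) * Real.log a + 1 / 2 * Real.log b) := by
    have h2 := Real.log_le_sub_one_of_pos (show 0 < x * y / ((x ^ 2 + y ^ 2) / 2) by positivity)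
    rw [Real.log_div (by positivity) (by positivity), Real.log_mul hx0.ne' hy0.ne'] at h2
    have h3 : x * y / ((x ^ 2 + y ^ 2) / 2) - 1 = - ((x - y) ^ 2 / (x ^ 2 + y ^ 2)) := by
      field_simp; ring
    have h4 : (1 - 1 / 2) * a + 1 / 2 * b = (x ^ 2 + y ^ 2) / 2 := by rw [hxa, hyb]; ring
    rw [h4, hxa, hyb, Real.log_pow, Real.log_pow]
    push_cast
    linarith
  have h5 : |x - y| ≤ 1 / η * ((x - y) ^ 2 / (x ^ 2 + y ^ 2)) + η * (x ^ 2 + y ^ 2) := by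
    set u := |x - y| with hu
    have hu2 : (x - y) ^ 2 = u ^ 2 := by rw [hu, sq_abs]
    have hu0 : 0 ≤ u := abs_nonneg _
    rw [hu2]
    set s := x ^ 2 + y ^ 2 with hsdef
    have h6 : 0 ≤ (u - η * s) ^ 2 / (η * s) := by positivity
    have h7 : (u - η * s) ^ 2 / (η * s) = 1 / η * (u ^ 2 / s) + η * s - 2 * u := by
      field_simp; ring
    linarith
  calc |x - y| ≤ _ := h5
    _ ≤ _ := by rw [hxa, hyb] at *; gcongr

/-- Fatou's lemma for real functions with converging bounds on the integrals. -/
lemma lintegral_liminf_ofReal_le {α : Type*} [MeasurableSpace α] {ν : Measure α} {f : ℕ → α → ℝ}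
    (hf : ∀ k, Integrable (f k) ν) (h0 : ∀ k, 0 ≤ᵐ[ν] f k) {C : ℕ → ℝ} {c : ℝ}
    (hC : ∀ k, ∫ x, f k x ∂ν ≤ C k) (hlim : Tendsto C atTop (𝓝 c)) :
    ∫⁻ x, liminf (fun k => ENNReal.ofReal (f k x)) atTop ∂ν ≤ ENNReal.ofReal c := by
  refine (lintegral_liminf_le' fun k => (hf k).aestronglyMeasurable.aemeasurable.ennreal_ofReal).trans ?_
  have h1 : Tendsto (fun k => ENNReal.ofReal (C k)) atTop (𝓝 (ENNReal.ofReal c)) :=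
    ENNReal.tendsto_ofReal hlim
  rw [← h1.liminf_eq]
  refine liminf_le_liminf (Eventually.of_forall fun k => ?_)
  rw [← ofReal_integral_eq_lintegral_ofReal (hf k) (h0 k)]
  exact ENNReal.ofReal_le_ofReal (hC k)

lemma integrable_and_integral_le_of_lintegral_le {α : Type*} [MeasurableSpace α] {ν : Measure α}
    {g : α → ℝ} (hg : AEStronglyMeasurable g ν) (h0 : 0 ≤ᵐ[ν] g) {c : ℝ} (hc : 0 ≤ c)
    (h : ∫⁻ x, ENNReal.ofReal (g x) ∂ν ≤ ENNReal.ofReal c) : Integrable g ν ∧ ∫ x, g x ∂ν ≤ c := by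
  have hi : Integrable g ν := by
    refine ⟨hg, ?_⟩
    rw [hasFiniteIntegral_iff_ofReal h0]
    exact h.trans_lt ENNReal.ofReal_lt_top
  refine ⟨hi, ?_⟩
  rw [← ofReal_integral_eq_lintegral_ofReal hi h0] at h
  exact (ENNReal.ofReal_le_ofReal_iff hc).1 h

/-- The integral of the logarithm is upper semicontinuous: Fatou's lemma for `u - log u ≥ 0`. -/
lemma integral_log_ge_of_tendsto {u : ℕ → Torus → ℝ} {v : Torus → ℝ}
    (hu : ∀ k, PaleyWiener (u k)) (hui : ∀ k, Integrable (u k) circleMeasure)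
    (hv : Integrable v circleMeasure)
    (hlim : ∀ᵐ θ ∂circleMeasure, Tendsto (fun k => u k θ) atTop (𝓝 (v θ)))
    (hint : Tendsto (fun k => ∫ θ, u k θ ∂circleMeasure) atTop (𝓝 (∫ θ, v θ ∂circleMeasure)))
    {l : ℕ → ℝ} {m : ℝ} (hl : ∀ k, l k ≤ ∫ θ, Real.log (u k θ) ∂circleMeasure)
    (hlm : Tendsto l atTop (𝓝 m)) :
    PaleyWiener v ∧ m ≤ ∫ θ, Real.log (v θ) ∂circleMeasure := by
  have hsub : ∀ k, ∀ᵐ θ ∂circleMeasure, 0 ≤ u k θ - Real.log (u k θ) := fun k => by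
    filter_upwards [(hu k).pos] with θ a
    linarith [Real.log_le_sub_one_of_pos a]
  have hfat := lintegral_liminf_ofReal_le (f := fun k θ => u k θ - Real.log (u k θ))
    (fun k => (hui k).sub (hu k).integrable_log) hsub
    (C := fun k => ∫ θ, u k θ ∂circleMeasure - l k) (fun k => by
      rw [integral_sub (hui k) (hu k).integrable_log]; linarith [hl k]) (hint.sub hlm)
  have hposk : ∀ᵐ θ ∂circleMeasure, ∀ k, 0 < u k θ := by
    rw [ae_all_iff]; exact fun k => (hu k).pos
  have hmeas : AEMeasurable (fun θ => liminf (fun k => ENNReal.ofReal (u k θ - Real.log (u k θ)))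
      atTop) circleMeasure := by
    simp only [liminf_eq_iSup_iInf_of_nat']
    exact .iSup fun n => .iInf fun i => ((hui (i + n)).sub
      (hu (i + n)).integrable_log).aestronglyMeasurable.aemeasurable.ennreal_ofReal
  have hfin := ae_lt_top' hmeas (hfat.trans_lt ENNReal.ofReal_lt_top).ne
  have hvpos : ∀ᵐ θ ∂circleMeasure, 0 < v θ := by
    filter_upwards [hfin, hlim, hposk] with θ a b c
    refine lt_of_le_of_ne (ge_of_tendsto' b fun k => (c k).le) fun h0 => ?_
    rw [← h0] at b
    have h1 : Tendsto (fun k => u k θ) atTop (𝓝[>] 0) :=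
      tendsto_nhdsWithin_iff.2 ⟨b, Eventually.of_forall c⟩
    have h2 : Tendsto (fun k => u k θ - Real.log (u k θ)) atTop atTop := by
      simp only [sub_eq_add_neg]
      exact b.add_atTop (tendsto_neg_atBot_atTop.comp (Real.tendsto_log_nhdsGT_zero.comp h1))
    exact a.ne (ENNReal.tendsto_ofReal_atTop.comp h2).liminf_eq
  have hfat' : ∫⁻ θ, ENNReal.ofReal (v θ - Real.log (v θ)) ∂circleMeasure ≤
      ENNReal.ofReal (∫ θ, v θ ∂circleMeasure - m) := by
    refine le_trans (le_of_eq (lintegral_congr_ae ?_)) hfat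
    filter_upwards [hlim, hvpos] with θ a b
    exact ((ENNReal.tendsto_ofReal (a.sub (a.log b.ne'))).liminf_eq).symm
  have hc : 0 ≤ ∫ θ, v θ ∂circleMeasure - m := by
    refine ge_of_tendsto' (hint.sub hlm) fun k => ?_
    have := integral_nonneg_of_ae (hsub k)
    rw [integral_sub (hui k) (hu k).integrable_log] at this
    linarith [hl k]
  obtain ⟨hi, hle⟩ := integrable_and_integral_le_of_lintegral_le
    (hv.aestronglyMeasurable.sub (Real.measurable_log.comp_aemeasurable
      hv.aestronglyMeasurable.aemeasurable).aestronglyMeasurable) (by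
      filter_upwards [hvpos] with θ a
      change 0 ≤ v θ - Real.log (v θ)
      linarith [Real.log_le_sub_one_of_pos a]) hc hfat'
  have hlogi : Integrable (fun θ => Real.log (v θ)) circleMeasure := by
    refine (hv.sub hi).congr (ae_of_all _ fun θ => ?_)
    simp
  refine ⟨⟨hvpos, hlogi⟩, ?_⟩
  have h1 : ∫ θ, (v θ - Real.log (v θ)) ∂circleMeasure ≤ ∫ θ, v θ ∂circleMeasure - m := hle
  rw [integral_sub hv hlogi] at h1
  linarith

/-- Maximizing sequences can be chosen with almost minimal filter power; by the parallelogram law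
their filters then form a Cauchy sequence. -/
lemma exists_maximizing_sequence (hSZ : Integrable SZ circleMeasure)
    (hPW : PaleyWiener SZ) {M : ℝ} (hM : IsLUB (objectiveValues SZ P) M) :
    ∃ (SV : ℕ → Torus → ℝ) (B : ℕ → Torus → ℂ) (β : ℕ → ℝ), Tendsto β atTop (𝓝 0) ∧
      (∀ k, Admissible SZ P (SV k) (B k)) ∧
      (∀ k : ℕ, M - 1 / ((k : ℝ) + 1) ≤ logOutput SZ (SV k) (B k)) ∧
      ∀ N j k, N ≤ j → N ≤ k → ∫ θ, ‖B j θ - B k θ‖ ^ 2 * SZ θ ∂circleMeasure ≤ β N := by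
  have hw0 := hPW.nonneg
  let C : ℕ → Set ℝ := fun k => {x | ∃ SV B, Admissible SZ P SV B ∧
    M - 1 / ((k : ℝ) + 1) ≤ logOutput SZ SV B ∧ x = ∫ θ, ‖B θ‖ ^ 2 * SZ θ ∂circleMeasure}
  have hCne : ∀ k, (C k).Nonempty := by
    intro k
    obtain ⟨v, ⟨SV, m, b, hf, hY, rfl⟩, hlt, -⟩ := hM.exists_between
      (show M - 1 / ((k : ℝ) + 1) < M by linarith [show (0 : ℝ) < 1 / ((k : ℝ) + 1) by positivity])
    exact ⟨_, SV, _, ⟨strictlyCausalH2_causalPoly m b, hf, hY⟩, hlt.le, rfl⟩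
  have hC0 : ∀ k, ∀ x ∈ C k, 0 ≤ x := by
    rintro k x ⟨SV, B, -, -, rfl⟩
    exact integral_nonneg_of_ae (by filter_upwards [hw0] with θ a; positivity)
  have hCP : ∀ k, ∀ x ∈ C k, x ≤ P := by
    rintro k x ⟨SV, B, h, -, rfl⟩
    have h1 := h.feasible.power_le
    rw [inputPower, integral_add h.feasible.integrable h.feasible.integrable_filter] at h1
    linarith [integral_nonneg_of_ae h.feasible.nonneg]
  have hbdd : ∀ k, BddBelow (C k) := fun k => ⟨0, hC0 k⟩
  let d : ℕ → ℝ := fun k => sInf (C k)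
  have hmono : Monotone d := by
    refine monotone_nat_of_le_succ fun k => csInf_le_csInf (hbdd k) (hCne _) ?_
    rintro x ⟨SV, B, h, h1, rfl⟩
    refine ⟨SV, B, h, le_trans ?_ h1, rfl⟩
    have : 1 / (((k + 1 : ℕ) : ℝ) + 1) ≤ 1 / ((k : ℝ) + 1) := by
      apply one_div_le_one_div_of_le (by positivity); push_cast; linarith
    linarith
  have hdP : BddAbove (Set.range d) := by
    refine ⟨P, ?_⟩
    rintro _ ⟨k, rfl⟩
    obtain ⟨x, hx⟩ := hCne k
    exact (csInf_le (hbdd k) hx).trans (hCP k x hx)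
  have hdlim := tendsto_atTop_ciSup hmono hdP
  set D := ⨆ k, d k with hD
  have hch : ∀ k : ℕ, ∃ SV B, Admissible SZ P SV B ∧ M - 1 / ((k : ℝ) + 1) ≤ logOutput SZ SV B ∧
      ∫ θ, ‖B θ‖ ^ 2 * SZ θ ∂circleMeasure ≤ d k + 1 / ((k : ℝ) + 1) := by
    intro k
    obtain ⟨x, ⟨SV, B, h, h1, rfl⟩, hx⟩ := exists_lt_of_csInf_lt (hCne k)
      (show sInf (C k) < d k + 1 / ((k : ℝ) + 1) by
        linarith [show (0 : ℝ) < 1 / ((k : ℝ) + 1) by positivity, show d k = sInf (C k) from rfl])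
    exact ⟨SV, B, h, h1, hx.le⟩
  choose SV B hadm hval hpow using hch
  refine ⟨SV, B, fun N => 4 * (D + 1 / ((N : ℝ) + 1)) - 4 * d N, ?_, hadm, hval, ?_⟩
  · have := ((tendsto_one_div_add_atTop_nhds_zero_nat (𝕜 := ℝ)).const_add D).const_mul 4 |>.sub
      (hdlim.const_mul 4)
    simpa using this
  · intro N j k hj hk
    obtain ⟨hmix, hlog⟩ := (hadm j).mix hSZ hPW (hadm k) (t := 1 / 2) (by norm_num) (by norm_num)
    have hle : ∀ i, N ≤ i → 1 / ((i : ℝ) + 1) ≤ 1 / ((N : ℝ) + 1) := by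
      intro i hi
      apply one_div_le_one_div_of_le (by positivity)
      have : (N : ℝ) ≤ i := by exact_mod_cast hi
      linarith
    have hmem : d N ≤ ∫ θ, ‖mixFilter (1 / 2) (B j) (B k) θ‖ ^ 2 * SZ θ ∂circleMeasure :=
      csInf_le (hbdd N) ⟨_, _, hmix, by linarith [hval j, hval k, hle j hj, hle k hk], rfl⟩
    have hij := (hadm j).feasible.integrable_filter
    have hik := (hadm k).feasible.integrable_filter
    have hid := integrable_norm_sq_sub hw0 hSZ.aestronglyMeasurable
      (hadm j).strictlyCausal.memLp.aestronglyMeasurable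
      (hadm k).strictlyCausal.memLp.aestronglyMeasurable hij hik
    have hpar : ∫ θ, ‖mixFilter (1 / 2) (B j) (B k) θ‖ ^ 2 * SZ θ ∂circleMeasure =
        1 / 2 * ∫ θ, ‖B j θ‖ ^ 2 * SZ θ ∂circleMeasure +
        1 / 2 * ∫ θ, ‖B k θ‖ ^ 2 * SZ θ ∂circleMeasure -
        1 / 4 * ∫ θ, ‖B j θ - B k θ‖ ^ 2 * SZ θ ∂circleMeasure := by
      rw [← integral_const_mul, ← integral_const_mul, ← integral_const_mul,
        ← integral_add (hij.const_mul _) (hik.const_mul _),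
        ← integral_sub (by exact (hij.const_mul _).add (hik.const_mul _)) (hid.const_mul _)]
      congr 1; ext θ
      rw [mixFilter, norm_sq_segment]; ring
    have h1 : d j ≤ D := le_ciSup hdP j
    have h2 : d k ≤ D := le_ciSup hdP k
    simp only
    linarith [hpow j, hpow k, hle j hj, hle k hk]

end

section

variable {SZ : Torus → ℝ} {P : ℝ}

lemma StrictlyCausalH2.of_tendsto {B : ℕ → Torus → ℂ} (hB : ∀ k, StrictlyCausalH2 (B k))
    {b : Lp ℂ 2 circleMeasure}
    (h : Tendsto (fun k => (hB k).memLp.toLp (B k)) atTop (𝓝 b)) : StrictlyCausalH2 b := by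
  have hco : ∀ n, Tendsto (fun k => fourierCoeff (B k) n) atTop (𝓝 (fourierCoeff b n)) := by
    intro n
    have h1 := (continuous_const.inner continuous_id (𝕜 := ℂ)
      (f := fun _ : Lp ℂ 2 circleMeasure => (fourierLp 2 n : Lp ℂ 2 circleMeasure))).tendsto b
      |>.comp h
    simp only [id_eq, inner_fourierLp, Function.comp_def, fourierCoeff_memLp_toLp] at h1
    exact h1
  refine ⟨Lp.memLp b, fun n hn => ?_, fun n => ?_⟩
  · refine tendsto_nhds_unique (hco n) ?_
    simp only [fun k => (hB k).coeff_eq_zero n hn]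
    exact tendsto_const_nhds
  · refine tendsto_nhds_unique ((Complex.continuous_im.tendsto _).comp (hco n)) ?_
    simp only [Function.comp_def, fun k => (hB k).coeff_real n]
    exact tendsto_const_nhds

lemma integrable_sqrt {S : Torus → ℝ} (hS : Integrable S circleMeasure)
    (h0 : ∀ᵐ θ ∂circleMeasure, 0 ≤ S θ) :
    Integrable (fun θ => Real.sqrt (S θ)) circleMeasure := by
  refine Integrable.mono' ((integrable_const (1 : ℝ)).add hS)
    hS.aestronglyMeasurable.aemeasurable.sqrt.aestronglyMeasurable ?_
  filter_upwards [h0] with θ a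
  rw [Real.norm_of_nonneg (Real.sqrt_nonneg _)]
  simp only [Pi.add_apply]
  rw [Real.sqrt_le_left (by positivity)]
  nlinarith

lemma PaleyWiener.sqrt {S : Torus → ℝ} (h : PaleyWiener S) :
    PaleyWiener (fun θ => Real.sqrt (S θ)) ∧
      ∫ θ, Real.log (Real.sqrt (S θ)) ∂circleMeasure =
        (∫ θ, Real.log (S θ) ∂circleMeasure) / 2 := by
  have h1 : ∀ᵐ θ ∂circleMeasure, Real.log (Real.sqrt (S θ)) = Real.log (S θ) / 2 := by
    filter_upwards [h.pos] with θ a using Real.log_sqrt a.le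
  refine ⟨⟨h.pos.mono fun θ a => Real.sqrt_pos.2 a,
    (h.integrable_log.div_const 2).congr (h1.mono fun _ h => h.symm)⟩, ?_⟩
  rw [integral_congr_ae h1, integral_div]

/-- Two nearly maximizing pairs have output spectra whose square roots are close in `L₁`, for
otherwise the objective at their midpoint would exceed the supremum. -/
lemma integral_abs_sqrt_sub_sqrt_le (hP : 0 ≤ P) (hSZ : Integrable SZ circleMeasure)
    (hEven : ∀ᵐ θ ∂circleMeasure, SZ (-θ) = SZ θ) (hPW : PaleyWiener SZ) {M : ℝ}
    (hM : IsLUB (objectiveValues SZ P) M) {SV₀ SV₁ : Torus → ℝ} {B₀ B₁ : Torus → ℂ}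
    (h₀ : Admissible SZ P SV₀ B₀) (h₁ : Admissible SZ P SV₁ B₁) {η : ℝ} (hη : 0 < η)
    (hv₀ : M - η ^ 2 ≤ logOutput SZ SV₀ B₀) (hv₁ : M - η ^ 2 ≤ logOutput SZ SV₁ B₁) :
    ∫ θ, |Real.sqrt (outputSpectrum SZ SV₀ B₀ θ) - Real.sqrt (outputSpectrum SZ SV₁ B₁ θ)|
      ∂circleMeasure ≤ η * (1 + 2 * (2 * P + 2 * ∫ θ, SZ θ ∂circleMeasure)) := by
  obtain ⟨hm, -⟩ := h₀.mix hSZ hPW h₁ (t := 1 / 2) (by norm_num) (by norm_num)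
  have hle := logOutput_le_of_upperBound hP hSZ hEven hPW hm.strictlyCausal hm.feasible
    hm.paleyWiener hM.1
  have hout : outputSpectrum SZ (mixSignal SZ (1 / 2) SV₀ B₀ SV₁ B₁) (mixFilter (1 / 2) B₀ B₁) =
      fun θ => (1 - 1 / 2) * outputSpectrum SZ SV₀ B₀ θ + 1 / 2 * outputSpectrum SZ SV₁ B₁ θ :=
    funext (outputSpectrum_mix SZ _ SV₀ B₀ SV₁ B₁)
  have hl := hm.paleyWiener.integrable_log
  rw [logOutput] at hle
  simp only [hout] at hl hle
  have hY₀ := h₀.integrable_output hSZ hPW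
  have hY₁ := h₁.integrable_output hSZ hPW
  have hl₀ := h₀.paleyWiener.integrable_log
  have hl₁ := h₁.paleyWiener.integrable_log
  have hl01 : Integrable (fun θ => (1 - 1 / 2) * Real.log (outputSpectrum SZ SV₀ B₀ θ) +
      1 / 2 * Real.log (outputSpectrum SZ SV₁ B₁ θ)) circleMeasure :=
    (hl₀.const_mul _).add (hl₁.const_mul _)
  have hY01 : Integrable (fun θ => outputSpectrum SZ SV₀ B₀ θ + outputSpectrum SZ SV₁ B₁ θ)
      circleMeasure := hY₀.add hY₁
  have hmain := integral_mono_ae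
    ((integrable_sqrt hY₀ h₀.paleyWiener.nonneg).sub
      (integrable_sqrt hY₁ h₁.paleyWiener.nonneg)).abs
    (((hl.sub hl01).const_mul (1 / η)).add (hY01.const_mul η)) (by
      filter_upwards [h₀.paleyWiener.pos, h₁.paleyWiener.pos] with θ a b
      exact abs_sqrt_sub_sqrt_le a b hη)
  refine hmain.trans ?_
  have e1 : ∫ θ, (1 / η * (Real.log ((1 - 1 / 2) * outputSpectrum SZ SV₀ B₀ θ +
      1 / 2 * outputSpectrum SZ SV₁ B₁ θ) - ((1 - 1 / 2) * Real.log (outputSpectrum SZ SV₀ B₀ θ) +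
      1 / 2 * Real.log (outputSpectrum SZ SV₁ B₁ θ))) +
      η * (outputSpectrum SZ SV₀ B₀ θ + outputSpectrum SZ SV₁ B₁ θ)) ∂circleMeasure =
      1 / η * ((∫ θ, Real.log ((1 - 1 / 2) * outputSpectrum SZ SV₀ B₀ θ +
      1 / 2 * outputSpectrum SZ SV₁ B₁ θ) ∂circleMeasure) - ((1 - 1 / 2) * logOutput SZ SV₀ B₀ +
      1 / 2 * logOutput SZ SV₁ B₁)) + η * ((∫ θ, outputSpectrum SZ SV₀ B₀ θ ∂circleMeasure) +
      ∫ θ, outputSpectrum SZ SV₁ B₁ θ ∂circleMeasure) := by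
    rw [integral_add (by exact (hl.sub hl01).const_mul (1 / η)) (hY01.const_mul η),
      integral_const_mul, integral_const_mul, integral_sub hl hl01,
      integral_add (hl₀.const_mul _) (hl₁.const_mul _), integral_add hY₀ hY₁,
      integral_const_mul, integral_const_mul, logOutput, logOutput]
  refine le_trans (le_of_eq e1) ?_
  have hb₀ := h₀.feasible.integral_output_le hSZ hPW.nonneg
    h₀.strictlyCausal.memLp.aestronglyMeasurable
  have hb₁ := h₁.feasible.integral_output_le hSZ hPW.nonneg
    h₁.strictlyCausal.memLp.aestronglyMeasurable
  calc _ ≤ 1 / η * η ^ 2 + η * (2 * (2 * P + 2 * ∫ θ, SZ θ ∂circleMeasure)) := by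
        gcongr
        · linarith
        · linarith
    _ = _ := by field_simp

/-- An optimal pair exists when `S_Z` is bounded below.  The limit of the output spectra is
taken through their square roots, for which strict concavity yields a Cauchy sequence in `L₁`; the
signal spectrum is recovered as `S_Y - |1 + B|² S_Z`. -/
theorem exists_isOptimalPair (hP : 0 ≤ P) (hSZ : Integrable SZ circleMeasure)
    (hEven : ∀ᵐ θ ∂circleMeasure, SZ (-θ) = SZ θ) (hPW : PaleyWiener SZ)
    (hc : 0 < essInf SZ circleMeasure) :
    ∃ (SV : Torus → ℝ) (B : Torus → ℂ), IsOptimalPair SZ P SV B := by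
  set c := essInf SZ circleMeasure with hcdef
  have hwc : ∀ᵐ θ ∂circleMeasure, c ≤ SZ θ := essInf_output_le hPW.nonneg
  have hM := isLUB_csSup (objectiveValues_nonempty hP hPW)
    (objectiveValues_bddAbove (P := P) hSZ hPW)
  set M := sSup (objectiveValues SZ P) with hMdef
  obtain ⟨SV, B, β, hβ, hadm, hval, hcau⟩ := exists_maximizing_sequence hSZ hPW hM
  -- the square roots of the output spectra converge in `L₁`
  let u : ℕ → Torus → ℝ := fun k θ => Real.sqrt (outputSpectrum SZ (SV k) (B k) θ)
  have hui : ∀ k, Integrable (u k) circleMeasure := fun k =>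
    integrable_sqrt ((hadm k).integrable_output hSZ hPW) (hadm k).paleyWiener.nonneg
  set C := 1 + 2 * (2 * P + 2 * ∫ θ, SZ θ ∂circleMeasure) with hC
  have hucau : CauchySeq fun k => (hui k).toL1 (u k) := by
    refine cauchySeq_of_le_tendsto_0 (fun N : ℕ => Real.sqrt (1 / ((N : ℝ) + 1)) * C) ?_ ?_
    · intro j k N hj hk
      have hle : ∀ i, N ≤ i → 1 / ((i : ℝ) + 1) ≤ 1 / ((N : ℝ) + 1) := by
        intro i hi
        apply one_div_le_one_div_of_le (by positivity)
        have : (N : ℝ) ≤ i := by exact_mod_cast hi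
        linarith
      have hsq : Real.sqrt (1 / ((N : ℝ) + 1)) ^ 2 = 1 / ((N : ℝ) + 1) :=
        Real.sq_sqrt (by positivity)
      have := integral_abs_sqrt_sub_sqrt_le hP hSZ hEven hPW hM (hadm j) (hadm k)
        (η := Real.sqrt (1 / ((N : ℝ) + 1))) (Real.sqrt_pos.2 (by positivity))
        (by rw [hsq]; linarith [hval j, hle j hj]) (by rw [hsq]; linarith [hval k, hle k hk])
      refine le_trans (le_of_eq ?_) this
      rw [dist_eq_norm, ← Integrable.toL1_sub, L1.norm_eq_integral_norm]
      apply integral_congr_ae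
      filter_upwards [Integrable.coeFn_toL1 ((hui j).sub (hui k))] with θ a
      rw [a]; rfl
    · have h1 : Tendsto (fun N : ℕ => Real.sqrt (1 / ((N : ℝ) + 1)) * C) atTop
          (𝓝 (Real.sqrt 0 * C)) :=
        ((Real.continuous_sqrt.tendsto 0).comp tendsto_one_div_add_atTop_nhds_zero_nat).mul_const C
      simpa using h1
  obtain ⟨r, hr⟩ := cauchySeq_tendsto_of_complete hucau
  have hrint : Tendsto (fun k => ∫ θ, u k θ ∂circleMeasure) atTop (𝓝 (∫ θ, r θ ∂circleMeasure)) := by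
    have := (continuous_integral (μ := circleMeasure) (G := ℝ)).tendsto r |>.comp hr
    refine this.congr fun k => ?_
    exact integral_congr_ae (Integrable.coeFn_toL1 (hui k))
  -- the filters converge in `L₂`
  have hBcau : CauchySeq fun k => (hadm k).strictlyCausal.memLp.toLp (B k) := by
    refine cauchySeq_of_le_tendsto_0 (fun N : ℕ => Real.sqrt (β N / c)) ?_ ?_
    · intro j k N hj hk
      apply Real.le_sqrt_of_sq_le
      rw [dist_eq_norm, ← MemLp.toLp_sub, norm_toLp_sq, le_div_iff₀ hc, ← integral_mul_const]
      refine le_trans (integral_mono_ae ?_ ?_ ?_) (hcau N j k hj hk)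
      · exact ((memLp_two_iff_integrable_sq_norm ((hadm j).strictlyCausal.memLp.sub
          (hadm k).strictlyCausal.memLp).aestronglyMeasurable).1
          ((hadm j).strictlyCausal.memLp.sub (hadm k).strictlyCausal.memLp)).mul_const _
      · exact integrable_norm_sq_sub hPW.nonneg hSZ.aestronglyMeasurable
          (hadm j).strictlyCausal.memLp.aestronglyMeasurable
          (hadm k).strictlyCausal.memLp.aestronglyMeasurable (hadm j).feasible.integrable_filter
          (hadm k).feasible.integrable_filter
      · filter_upwards [hwc] with θ a
        simp only [Pi.sub_apply]
        gcongr
    · have h1 : Tendsto (fun N : ℕ => Real.sqrt (β N / c)) atTop (𝓝 (Real.sqrt (0 / c))) :=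
        (Real.continuous_sqrt.tendsto _).comp (hβ.div_const c)
      simpa using h1
  obtain ⟨b, hb⟩ := cauchySeq_tendsto_of_complete hBcau
  have hbH : StrictlyCausalH2 b := .of_tendsto (fun k => (hadm k).strictlyCausal) hb
  -- a subsequence along which both converge almost everywhere
  obtain ⟨ns, hns, hlimu⟩ := exists_subseq_tendsto_ae (by norm_num)
    (fun j => Lp.aestronglyMeasurable _) (Lp.aestronglyMeasurable _)
    ((Lp.tendsto_Lp_iff_tendsto_eLpNorm' _ _).1 hr)
  obtain ⟨ms, hms, hlimB⟩ := exists_subseq_tendsto_ae (by norm_num)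
    (fun j => Lp.aestronglyMeasurable _) (Lp.aestronglyMeasurable _)
    ((Lp.tendsto_Lp_iff_tendsto_eLpNorm' _ _).1 (hb.comp hns.tendsto_atTop))
  let σ : ℕ → ℕ := fun k => ns (ms k)
  have hσ : Tendsto σ atTop atTop := hns.tendsto_atTop.comp hms.tendsto_atTop
  have hlim : ∀ᵐ θ ∂circleMeasure, Tendsto (fun k => u (σ k) θ) atTop (𝓝 (r θ)) ∧
      Tendsto (fun k => B (σ k) θ) atTop (𝓝 (b θ)) := by
    have h1 : ∀ᵐ θ ∂circleMeasure, ∀ k, (hui k).toL1 (u k) θ = u k θ := by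
      rw [ae_all_iff]; exact fun k => Integrable.coeFn_toL1 (hui k)
    have h2 : ∀ᵐ θ ∂circleMeasure, ∀ k, (hadm k).strictlyCausal.memLp.toLp (B k) θ = B k θ := by
      rw [ae_all_iff]; exact fun k => MemLp.coeFn_toLp _
    filter_upwards [hlimu, hlimB, h1, h2] with θ a1 a2 a3 a4
    refine ⟨(a1.comp hms.tendsto_atTop).congr fun k => a3 _, a2.congr fun k => a4 _⟩
  obtain ⟨hrPW, hrM⟩ := integral_log_ge_of_tendsto (u := fun k => u (σ k)) (v := r)
    (fun k => (hadm _).paleyWiener.sqrt.1) (fun k => hui _) (L1.integrable_coeFn r)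
    (hlim.mono fun θ a => a.1) (hrint.comp hσ)
    (l := fun k => (M - 1 / ((σ k : ℝ) + 1)) / 2) (m := M / 2) (fun k => by
      rw [(hadm (σ k)).paleyWiener.sqrt.2]
      have := hval (σ k)
      rw [logOutput] at this
      linarith) (by
      have := ((tendsto_one_div_add_atTop_nhds_zero_nat (𝕜 := ℝ)).comp hσ).const_sub M
        |>.div_const 2
      simpa using this)
  let SV' : Torus → ℝ := fun θ => r θ ^ 2 - ‖1 + b θ‖ ^ 2 * SZ θ
  have hout : outputSpectrum SZ SV' b = fun θ => r θ ^ 2 := by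
    ext θ; simp [outputSpectrum, SV']
  have hSVlim : ∀ᵐ θ ∂circleMeasure, Tendsto (fun k => SV (σ k) θ) atTop (𝓝 (SV' θ)) := by
    have hpos : ∀ᵐ θ ∂circleMeasure, ∀ k, 0 ≤ outputSpectrum SZ (SV k) (B k) θ := by
      rw [ae_all_iff]; exact fun k => (hadm k).paleyWiener.nonneg
    filter_upwards [hlim, hpos] with θ a d
    have h1 : Tendsto (fun k => u (σ k) θ ^ 2 - ‖1 + B (σ k) θ‖ ^ 2 * SZ θ) atTop (𝓝 (SV' θ)) :=
      (a.1.pow 2).sub ((((a.2.const_add 1).norm).pow 2).mul_const _)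
    refine h1.congr fun k => ?_
    rw [Real.sq_sqrt (d _), outputSpectrum]; ring
  have hSV0 : ∀ᵐ θ ∂circleMeasure, 0 ≤ SV' θ := by
    have hpos : ∀ᵐ θ ∂circleMeasure, ∀ k, 0 ≤ SV k θ := by
      rw [ae_all_iff]; exact fun k => (hadm k).feasible.nonneg
    filter_upwards [hSVlim, hpos] with θ a d
    exact ge_of_tendsto' a fun k => d _
  have hbm : AEStronglyMeasurable b circleMeasure := Lp.aestronglyMeasurable b
  have hSVm : AEStronglyMeasurable SV' circleMeasure :=
    ((Lp.aestronglyMeasurable r).pow 2).sub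
      (((aestronglyMeasurable_const.add hbm).norm.pow 2).mul hSZ.aestronglyMeasurable)
  have hFm : AEStronglyMeasurable (fun θ => ‖b θ‖ ^ 2 * SZ θ) circleMeasure :=
    (hbm.norm.pow 2).mul hSZ.aestronglyMeasurable
  have hfat := lintegral_liminf_ofReal_le
    (f := fun k θ => SV (σ k) θ + ‖B (σ k) θ‖ ^ 2 * SZ θ)
    (fun k => (hadm _).feasible.integrable_power) (fun k => by
      filter_upwards [(hadm (σ k)).feasible.nonneg, hPW.nonneg] with θ a d
      simp only [Pi.zero_apply]; positivity) (C := fun _ => P)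
    (fun k => (hadm (σ k)).feasible.power_le) tendsto_const_nhds
  obtain ⟨hti, htP⟩ := integrable_and_integral_le_of_lintegral_le
    (g := fun θ => SV' θ + ‖b θ‖ ^ 2 * SZ θ) (hSVm.add hFm) (by
      filter_upwards [hSV0, hPW.nonneg] with θ a d
      simp only [Pi.zero_apply]; positivity) hP (by
      refine le_trans (le_of_eq (lintegral_congr_ae ?_)) hfat
      filter_upwards [hlim, hSVlim] with θ a d
      exact ((ENNReal.tendsto_ofReal (d.add ((a.2.norm.pow 2).mul_const _))).liminf_eq).symm)
  have hfeas : PowerFeasible SZ P SV' b := by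
    refine ⟨hSV0, hti.mono' hSVm ?_, hti.mono' hFm ?_, htP⟩
    all_goals
      filter_upwards [hSV0, hPW.nonneg] with θ a d
      rw [Real.norm_of_nonneg (by positivity)]
      have : 0 ≤ ‖b θ‖ ^ 2 * SZ θ := by positivity
      linarith
  have hlog : ∀ θ, Real.log (outputSpectrum SZ SV' b θ) = 2 * Real.log (r θ) := by
    intro θ; rw [hout, Real.log_pow]; norm_num
  have hPW' : PaleyWiener (outputSpectrum SZ SV' b) := by
    refine ⟨?_, ?_⟩
    · filter_upwards [hrPW.pos] with θ a
      rw [hout]; positivity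
    · simp only [hlog]; exact hrPW.integrable_log.const_mul 2
  have hge : M ≤ logOutput SZ SV' b := by
    rw [logOutput]
    simp only [hlog]
    rw [integral_const_mul]; linarith
  have heq : logOutput SZ SV' b = M :=
    le_antisymm (logOutput_le_of_upperBound hP hSZ hEven hPW hbH hfeas hPW' hM.1) hge
  exact ⟨SV', b, hbH, hfeas, hPW', heq ▸ hM⟩

end

/-! ### Mean square limits of Gaussian processes -/

lemma tendsto_integral_mul_conj {α 𝕜 : Type*} [RCLike 𝕜] [MeasurableSpace α] {ν : Measure α}
    {f g : ℕ → α → 𝕜} {f₀ g₀ : α → 𝕜} (hf : ∀ j, MemLp (f j) 2 ν) (hf₀ : MemLp f₀ 2 ν)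
    (hg : ∀ j, MemLp (g j) 2 ν) (hg₀ : MemLp g₀ 2 ν)
    (hfl : Tendsto (fun j => eLpNorm (fun x => f₀ x - f j x) 2 ν) atTop (𝓝 0))
    (hgl : Tendsto (fun j => eLpNorm (fun x => g₀ x - g j x) 2 ν) atTop (𝓝 0)) :
    Tendsto (fun j => ∫ x, f j x * conj (g j x) ∂ν) atTop (𝓝 (∫ x, f₀ x * conj (g₀ x) ∂ν)) := by
  have hlp : ∀ {h : ℕ → α → 𝕜} {h₀ : α → 𝕜} (hh : ∀ j, MemLp (h j) 2 ν) (hh₀ : MemLp h₀ 2 ν),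
      Tendsto (fun j => eLpNorm (fun x => h₀ x - h j x) 2 ν) atTop (𝓝 0) →
      Tendsto (fun j => (hh j).toLp (h j)) atTop (𝓝 (hh₀.toLp h₀)) := by
    intro h h₀ hh hh₀ hl
    rw [Lp.tendsto_Lp_iff_tendsto_eLpNorm']
    refine hl.congr fun j => ?_
    rw [← eLpNorm_neg]
    apply eLpNorm_congr_ae
    filter_upwards [(hh j).coeFn_toLp, hh₀.coeFn_toLp] with x a b
    simp [a, b]
  have hin : ∀ {a b : α → 𝕜} (ha : MemLp a 2 ν) (hb : MemLp b 2 ν),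
      inner 𝕜 (hb.toLp b) (ha.toLp a) = ∫ x, a x * conj (b x) ∂ν := by
    intro a b ha hb
    rw [L2.inner_def]
    apply integral_congr_ae
    filter_upwards [ha.coeFn_toLp, hb.coeFn_toLp] with x h1 h2
    rw [h1, h2, RCLike.inner_apply]
  have := (hlp hg hg₀ hgl).inner (𝕜 := 𝕜) (hlp hf hf₀ hfl)
  simpa only [hin] using this

lemma tendsto_integral_mul {α : Type*} [MeasurableSpace α] {ν : Measure α}
    {f g : ℕ → α → ℝ} {f₀ g₀ : α → ℝ} (hf : ∀ j, MemLp (f j) 2 ν) (hf₀ : MemLp f₀ 2 ν)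
    (hg : ∀ j, MemLp (g j) 2 ν) (hg₀ : MemLp g₀ 2 ν)
    (hfl : Tendsto (fun j => eLpNorm (fun x => f₀ x - f j x) 2 ν) atTop (𝓝 0))
    (hgl : Tendsto (fun j => eLpNorm (fun x => g₀ x - g j x) 2 ν) atTop (𝓝 0)) :
    Tendsto (fun j => ∫ x, f j x * g j x ∂ν) atTop (𝓝 (∫ x, f₀ x * g₀ x ∂ν)) := by
  simpa using tendsto_integral_mul_conj hf hf₀ hg hg₀ hfl hgl

section

variable {Ω : Type*} [MeasurableSpace Ω] {μ : Measure Ω}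

lemma IsGaussianProcess.of_mem_span {S T : Type*} {W : S → Ω → ℝ} (hW : IsGaussianProcess W μ)
    {A : T → Ω → ℝ} (hA : ∀ t, A t ∈ Submodule.span ℝ (Set.range W)) : IsGaussianProcess A μ := by
  refine hW.of_isGaussianProcess fun t => ?_
  obtain ⟨c, hc⟩ := Finsupp.mem_span_range_iff_exists_finsupp.1 (hA t)
  refine ⟨c.support, ∑ i : c.support, c i • ContinuousLinearMap.proj i, fun ω => ?_⟩
  rw [← hc, Finsupp.sum, Finset.sum_apply, ← Finset.sum_coe_sort]
  simp

/-- Two independent Gaussian processes are jointly Gaussian. -/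
lemma IsGaussianProcess.sumElim {S T : Type*} {V : S → Ω → ℝ} {Z : T → Ω → ℝ}
    (hV : IsGaussianProcess V μ) (hZ : IsGaussianProcess Z μ)
    (h : IndepFun (fun ω s => V s ω) (fun ω t => Z t ω) μ) : IsGaussianProcess (Sum.elim V Z) μ := by
  refine ⟨fun I => ?_⟩
  have hpair := IndepFun.hasGaussianLaw (hV.hasGaussianLaw I.toLeft) (hZ.hasGaussianLaw I.toRight)
    (h.comp (Finset.measurable_restrict I.toLeft) (Finset.measurable_restrict I.toRight))
  let L : ((I.toLeft → ℝ) × (I.toRight → ℝ)) →ₗ[ℝ] (I → ℝ) :=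
    { toFun := fun x i => match i with
        | ⟨.inl a, ha⟩ => x.1 ⟨a, Finset.mem_toLeft.2 ha⟩
        | ⟨.inr b, hb⟩ => x.2 ⟨b, Finset.mem_toRight.2 hb⟩
      map_add' := fun x y => by ext ⟨a | a, ha⟩ <;> rfl
      map_smul' := fun c x => by ext ⟨a | a, ha⟩ <;> rfl }
  have := hpair.map_fun L.toContinuousLinearMap
  refine this.congr (ae_of_all _ fun ω => ?_)
  ext ⟨a | a, ha⟩ <;> rfl

lemma tendsto_eLpNorm_sum_const_mul {ι : Type*} [Fintype ι] (c : ι → ℝ) {D : ι → ℕ → Ω → ℝ}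
    (hD : ∀ i j, MemLp (D i j) 2 μ) (hlim : ∀ i, Tendsto (fun j => eLpNorm (D i j) 2 μ) atTop (𝓝 0)) :
    Tendsto (fun j => eLpNorm (fun ω => ∑ i, c i * D i j ω) 2 μ) atTop (𝓝 0) := by
  have hz : Tendsto (fun j => ∑ i, ‖c i‖ₑ * eLpNorm (D i j) 2 μ) atTop (𝓝 0) := by
    have : Tendsto (fun j => ∑ i, ‖c i‖ₑ * eLpNorm (D i j) 2 μ) atTop (𝓝 (∑ i, ‖c i‖ₑ * 0)) :=
      tendsto_finsetSum _ fun i _ => ENNReal.Tendsto.const_mul (hlim i) (Or.inr enorm_ne_top)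
    simpa using this
  refine tendsto_of_tendsto_of_tendsto_of_le_of_le tendsto_const_nhds hz (fun _ => zero_le)
    fun j => ?_
  have h1 : (fun ω => ∑ i, c i * D i j ω) = ∑ i, c i • D i j := by
    ext ω
    simp [Finset.sum_apply]
  simp only [h1]
  exact (eLpNorm_sum_le (fun i _ => (hD i j).aestronglyMeasurable.const_smul _) (by norm_num)).trans
    (Finset.sum_le_sum fun i _ => eLpNorm_const_smul_le)

variable [IsProbabilityMeasure μ]

lemma tendsto_integral_of_eLpNorm_two {f : ℕ → Ω → ℝ} {f₀ : Ω → ℝ} (hf : ∀ j, MemLp (f j) 2 μ)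
    (hf₀ : MemLp f₀ 2 μ) (hfl : Tendsto (fun j => eLpNorm (fun x => f₀ x - f j x) 2 μ) atTop (𝓝 0)) :
    Tendsto (fun j => ∫ x, f j x ∂μ) atTop (𝓝 (∫ x, f₀ x ∂μ)) := by
  simpa using tendsto_integral_mul hf hf₀ (fun _ => memLp_const (1 : ℝ)) (memLp_const (1 : ℝ)) hfl
    (by simp)

/-- The characteristic functions of a mean square convergent sequence converge, and so do the means
and the variances. -/
lemma HasGaussianLaw.of_tendsto {Y : ℕ → Ω → ℝ} {Y₀ : Ω → ℝ} (hY : ∀ j, HasGaussianLaw (Y j) μ)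
    (hY₀ : MemLp Y₀ 2 μ)
    (hlim : Tendsto (fun j => eLpNorm (fun ω => Y₀ ω - Y j ω) 2 μ) atTop (𝓝 0)) :
    HasGaussianLaw Y₀ μ := by
  have hmem : ∀ j, MemLp (Y j) 2 μ := fun j => (hY j).memLp_two
  obtain ⟨ns, hns, hae⟩ := exists_subseq_tendsto_ae (p := 2) (f := Y) (g := Y₀) (by norm_num)
    (fun j => (hmem j).aestronglyMeasurable) hY₀.aestronglyMeasurable (hlim.congr fun j => by
      rw [← eLpNorm_neg]; congr 1; ext ω; simp)
  rw [hasGaussianLaw_iff_charFun_map_eq hY₀.aestronglyMeasurable.aemeasurable]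
  intro t
  have hchar : ∀ {f : Ω → ℝ}, AEMeasurable f μ →
      charFun (μ.map f) t = ∫ ω, Complex.exp (t * f ω * Complex.I) ∂μ := by
    intro f hf
    rw [charFun_apply_real, integral_map hf (by fun_prop)]
  have hmean := (tendsto_integral_of_eLpNorm_two hmem hY₀ hlim).comp hns.tendsto_atTop
  have hsq := (tendsto_integral_mul hmem hY₀ hmem hY₀ hlim hlim).comp hns.tendsto_atTop
  have hm : ∀ f : Ω → ℝ, ∫ ω, inner ℝ t (f ω) ∂μ = t * ∫ ω, f ω ∂μ := by
    intro f
    rw [← integral_const_mul]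
    congr 1; ext ω; simp [mul_comm]
  have hv : ∀ f : Ω → ℝ, MemLp f 2 μ → Var[fun ω => inner ℝ t (f ω); μ] =
      t ^ 2 * (∫ ω, f ω * f ω ∂μ - (∫ ω, f ω ∂μ) ^ 2) := by
    intro f hf
    have h1 : (fun ω => inner ℝ t (f ω)) = fun ω => t * f ω := by ext ω; simp [mul_comm]
    rw [h1, variance_const_mul, variance_eq_sub hf]
    congr 2
    apply integral_congr_ae
    exact ae_of_all _ fun ω => by simp [pow_two]
  have hL : Tendsto (fun i => charFun (μ.map (Y (ns i))) t) atTop (𝓝 (charFun (μ.map Y₀) t)) := by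
    rw [hchar hY₀.aestronglyMeasurable.aemeasurable]
    simp only [fun i => hchar (hmem (ns i)).aestronglyMeasurable.aemeasurable]
    refine tendsto_integral_of_dominated_convergence (fun _ => 1) (fun i => ?_)
      (integrable_const _) (fun i => ae_of_all _ fun ω => ?_) ?_
    · exact (by fun_prop : Continuous fun x : ℝ => Complex.exp (t * x * Complex.I)).comp_aestronglyMeasurable
        (hmem (ns i)).aestronglyMeasurable
    · rw [← Complex.ofReal_mul, Complex.norm_exp_ofReal_mul_I]
    · filter_upwards [hae] with ω h
      exact ((by fun_prop : Continuous fun x : ℝ => Complex.exp (t * x * Complex.I)).tendsto _).comp h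
  have hR : Tendsto (fun i => charFun (μ.map (Y (ns i))) t) atTop
      (𝓝 (Complex.exp ((∫ ω, inner ℝ t (Y₀ ω) ∂μ : ℝ) * Complex.I -
        Var[fun ω => inner ℝ t (Y₀ ω); μ] / 2))) := by
    simp only [fun i => (hY (ns i)).charFun_map_eq t]
    simp only [hm, hv _ hY₀, fun i => hv _ (hmem (ns i))]
    have h1 := hmean.const_mul t
    have h2 := (hsq.sub (hmean.pow 2)).const_mul (t ^ 2)
    exact (Complex.continuous_exp.tendsto _).comp
      ((((Complex.continuous_ofReal.tendsto _).comp h1).mul_const _).sub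
        (((Complex.continuous_ofReal.tendsto _).comp h2).div_const _))
  exact tendsto_nhds_unique hL hR

/-- Mean square limits of linear combinations of a Gaussian process form a Gaussian process. -/
lemma IsGaussianProcess.of_tendsto {S T : Type*} {W : S → Ω → ℝ} (hW : IsGaussianProcess W μ)
    {Y : T → Ω → ℝ} (hY : ∀ t, MemLp (Y t) 2 μ)
    (h : ∀ t, ∃ A : ℕ → Ω → ℝ, (∀ j, A j ∈ Submodule.span ℝ (Set.range W)) ∧
      Tendsto (fun j => eLpNorm (fun ω => Y t ω - A j ω) 2 μ) atTop (𝓝 0)) :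
    IsGaussianProcess Y μ := by
  classical
  choose A hA hlim using h
  have hAg : ∀ j, IsGaussianProcess (fun t => A t j) μ := fun j =>
    IsGaussianProcess.of_mem_span hW fun t => hA t j
  have hAm : ∀ t j, MemLp (A t j) 2 μ := fun t j => ((hAg j).hasGaussianLaw_eval t).memLp_two
  refine ⟨fun I => ⟨?_⟩⟩
  have hYm : AEMeasurable (fun ω => I.restrict (Y · ω)) μ :=
    aemeasurable_pi_lambda _ fun i => (hY i).aestronglyMeasurable.aemeasurable
  refine isGaussian_of_isGaussian_map fun L => ?_
  rw [AEMeasurable.map_map_of_aemeasurable (by fun_prop) hYm]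
  have hL : ∀ (F : T → Ω → ℝ) ω, L (I.restrict (F · ω)) =
      ∑ i : I, L (Pi.single i 1) * F i ω := by
    intro F ω
    rw [← L.sum_comp_single]
    refine Finset.sum_congr rfl fun i _ => ?_
    have : (Pi.single i (F i ω) : I → ℝ) = F i ω • Pi.single i 1 := by
      rw [← Pi.single_smul]; simp
    simp [Finset.restrict, this, mul_comm]
  have hcomb : ∀ F : T → Ω → ℝ, (∀ t, MemLp (F t) 2 μ) →
      MemLp (fun ω => ∑ i : I, L (Pi.single i 1) * F i ω) 2 μ := fun F hF =>
    memLp_finsetSum _ fun i _ => (hF i).const_mul _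
  refine (HasGaussianLaw.of_tendsto (Y := fun j ω => ∑ i : I, L (Pi.single i 1) * A i j ω)
    (Y₀ := L ∘ fun ω => I.restrict (Y · ω)) (fun j => ?_) ?_ ?_).isGaussian_map
  · have := ((hAg j).hasGaussianLaw I).map_fun L
    simpa only [hL] using this
  · have : (L ∘ fun ω => I.restrict (Y · ω)) = fun ω => ∑ i : I, L (Pi.single i 1) * Y i ω := by
      ext ω; exact hL Y ω
    rw [this]; exact hcomb Y hY
  · have h1 : ∀ j, (fun ω => (L ∘ fun ω => I.restrict (Y · ω)) ω -
        ∑ i : I, L (Pi.single i 1) * A i j ω) =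
        fun ω => ∑ i : I, L (Pi.single i 1) * (Y i ω - A i j ω) := by
      intro j
      ext ω
      rw [Function.comp_apply, hL]
      simp only [mul_sub, Finset.sum_sub_distrib]
    simp only [h1]
    exact tendsto_eLpNorm_sum_const_mul _ (fun i j => (hY i).sub (hAm i j)) fun i => hlim i

end

/-! ### Independence of the current input and the past output -/

/-- The transfer function `∑_k c_k e^{-ikθ}` of the linear combination `∑_k c_k Z_k`. -/
noncomputable def transferFunction : (ℤ →₀ ℝ) →ₗ[ℝ] (Torus → ℂ) :=
  Finsupp.linearCombination ℝ fun (k : ℤ) (θ : Torus) => (fourier (-k) θ : ℂ)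

lemma transferFunction_single (k : ℤ) (a : ℝ) (θ : Torus) :
    transferFunction (Finsupp.single k a) θ = a * fourier (-k) θ := by
  simp [transferFunction]

lemma transferFunction_apply (c : ℤ →₀ ℝ) (θ : Torus) :
    transferFunction c θ = ∑ k ∈ c.support, (c k : ℂ) * fourier (-k) θ := by
  simp [transferFunction, Finsupp.linearCombination_apply, Finsupp.sum]

lemma continuous_transferFunction (c : ℤ →₀ ℝ) : Continuous (transferFunction c) := by
  have : transferFunction c = fun θ => ∑ k ∈ c.support, (c k : ℂ) * fourier (-k) θ :=
    funext (transferFunction_apply c)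
  rw [this]
  exact continuous_finsetSum _ fun k _ => continuous_const.mul (map_continuous _)

section

variable {Ω : Type*} [MeasurableSpace Ω] {μ : Measure Ω} {w : Torus → ℝ} {Z : ℤ → Ω → ℝ}

/-- `U` belongs to the closed linear span of the process `Z` in mean square, and `f ∈ L₂(w)`
corresponds to it in the spectral representation `Z_k ↦ e^{-ikθ}`: finite linear combinations of
the `Z_k` tend to `U` while their transfer functions tend to `f`.  The norm of `L₂(w)` is expressed
by the factor `√w`. -/
structure HasTransferFunction (w : Torus → ℝ) (Z : ℤ → Ω → ℝ) (μ : Measure Ω) (U : Ω → ℝ)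
    (f : Torus → ℂ) : Prop where
  memLp : MemLp U 2 μ
  memLp_sqrt : MemLp (fun θ => (Real.sqrt (w θ) : ℂ) * f θ) 2 circleMeasure
  exists_tendsto : ∃ c : ℕ → ℤ →₀ ℝ,
    Tendsto (fun j => eLpNorm (fun ω => U ω - Finsupp.linearCombination ℝ Z (c j) ω) 2 μ)
      atTop (𝓝 0) ∧
    Tendsto (fun j => eLpNorm (fun θ => (Real.sqrt (w θ) : ℂ) * f θ -
      (Real.sqrt (w θ) : ℂ) * transferFunction (c j) θ) 2 circleMeasure) atTop (𝓝 0)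

lemma IsStationaryGaussian.memLp (hZ : IsStationaryGaussian w Z μ) (k : ℤ) : MemLp (Z k) 2 μ :=
  (hZ.gaussian.hasGaussianLaw_eval k).memLp_two

lemma IsStationaryGaussian.memLp_linearCombination (hZ : IsStationaryGaussian w Z μ)
    (c : ℤ →₀ ℝ) : MemLp (Finsupp.linearCombination ℝ Z c) 2 μ := by
  rw [Finsupp.linearCombination_apply, Finsupp.sum]
  exact memLp_finsetSum' _ fun k _ => (hZ.memLp k).const_smul _

lemma memLp_sqrt_mul_continuous (hw : Integrable w circleMeasure)
    (hw0 : ∀ᵐ θ ∂circleMeasure, 0 ≤ w θ) {p : Torus → ℂ} (hp : Continuous p) :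
    MemLp (fun θ => (Real.sqrt (w θ) : ℂ) * p θ) 2 circleMeasure :=
  memLp_sqrt_mul hw hw0 hp.aestronglyMeasurable (Integrable.continuous_norm_sq_mul hw hp)

lemma IsStationaryGaussian.integral_linearCombination_mul (hZ : IsStationaryGaussian w Z μ)
    (hw : Integrable w circleMeasure) (c d : ℤ →₀ ℝ) :
    ((∫ ω, Finsupp.linearCombination ℝ Z c ω * Finsupp.linearCombination ℝ Z d ω ∂μ : ℝ) : ℂ) =
      ∫ θ, transferFunction c θ * conj (transferFunction d θ) * w θ ∂circleMeasure := by
  have h1 : ∀ ω, Finsupp.linearCombination ℝ Z c ω * Finsupp.linearCombination ℝ Z d ω =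
      ∑ k ∈ c.support, ∑ l ∈ d.support, (c k * d l) * (Z k ω * Z l ω) := by
    intro ω
    simp only [Finsupp.linearCombination_apply, Finsupp.sum, Finset.sum_apply, Pi.smul_apply,
      smul_eq_mul, Finset.sum_mul_sum]
    exact Finset.sum_congr rfl fun k _ => Finset.sum_congr rfl fun l _ => by ring
  have h2 : ∀ θ, transferFunction c θ * conj (transferFunction d θ) * w θ =
      ∑ k ∈ c.support, ∑ l ∈ d.support, ((c k * d l : ℝ) : ℂ) * (fourier (l - k) θ * (w θ : ℂ)) := by
    intro θ
    rw [transferFunction_apply, transferFunction_apply, map_sum, Finset.sum_mul_sum, Finset.sum_mul]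
    simp only [Finset.sum_mul]
    refine Finset.sum_congr rfl fun k _ => Finset.sum_congr rfl fun l _ => ?_
    rw [map_mul, Complex.conj_ofReal, ← fourier_neg, neg_neg, sub_eq_add_neg, fourier_add]
    push_cast; ring
  have hi : ∀ k l, Integrable (fun ω => (c k * d l) * (Z k ω * Z l ω)) μ := fun k l =>
    ((hZ.memLp k).integrable_mul (hZ.memLp l)).const_mul _
  have hj : ∀ k l : ℤ, Integrable (fun θ => ((c k * d l : ℝ) : ℂ) *
      (fourier (l - k) θ * (w θ : ℂ))) circleMeasure := fun k l =>
    (Integrable.fourier_mul hw.ofReal (l - k)).const_mul _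
  simp only [h1, h2]
  rw [integral_finsetSum _ fun k _ => integrable_finsetSum _ fun l _ => hi k l,
    integral_finsetSum _ fun k _ => integrable_finsetSum _ fun l _ => hj k l, Complex.ofReal_sum]
  refine Finset.sum_congr rfl fun k _ => ?_
  rw [integral_finsetSum _ fun l _ => hi k l, integral_finsetSum _ fun l _ => hj k l,
    Complex.ofReal_sum]
  refine Finset.sum_congr rfl fun l _ => ?_
  rw [integral_const_mul, integral_const_mul, Complex.ofReal_mul]
  congr 1
  simp only [mul_comm (Z k _)]
  rw [hZ.covariance l k, fourierCoeff]
  simp only [smul_eq_mul, neg_sub]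

/-- The spectral representation is an isometry. -/
lemma HasTransferFunction.integral_mul (hZ : IsStationaryGaussian w Z μ)
    (hw : Integrable w circleMeasure) (hw0 : ∀ᵐ θ ∂circleMeasure, 0 ≤ w θ)
    {U U' : Ω → ℝ} {f f' : Torus → ℂ} (h : HasTransferFunction w Z μ U f)
    (h' : HasTransferFunction w Z μ U' f') :
    ((∫ ω, U ω * U' ω ∂μ : ℝ) : ℂ) = ∫ θ, f θ * conj (f' θ) * w θ ∂circleMeasure := by
  obtain ⟨c, hc, hcf⟩ := h.exists_tendsto
  obtain ⟨d, hd, hdf⟩ := h'.exists_tendsto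
  have h1 := (Complex.continuous_ofReal.tendsto _).comp
    (tendsto_integral_mul (fun j => hZ.memLp_linearCombination (c j)) h.memLp
      (fun j => hZ.memLp_linearCombination (d j)) h'.memLp hc hd)
  have h2 := tendsto_integral_mul_conj
    (fun j => memLp_sqrt_mul_continuous hw hw0 (continuous_transferFunction (c j))) h.memLp_sqrt
    (fun j => memLp_sqrt_mul_continuous hw hw0 (continuous_transferFunction (d j))) h'.memLp_sqrt
    hcf hdf
  have h3 : ∀ a b : Torus → ℂ, ∫ θ, (Real.sqrt (w θ) : ℂ) * a θ *
      conj ((Real.sqrt (w θ) : ℂ) * b θ) ∂circleMeasure =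
      ∫ θ, a θ * conj (b θ) * w θ ∂circleMeasure := by
    intro a b
    apply integral_congr_ae
    filter_upwards [hw0] with θ h0
    have : (w θ : ℂ) = (Real.sqrt (w θ) : ℂ) * (Real.sqrt (w θ) : ℂ) := by
      rw [← Complex.ofReal_mul, Real.mul_self_sqrt h0]
    rw [map_mul, Complex.conj_ofReal, this]
    ring
  simp only [h3] at h2
  refine tendsto_nhds_unique h1 (h2.congr fun j => ?_)
  exact (hZ.integral_linearCombination_mul hw _ _).symm

lemma HasTransferFunction.add_noise (hw : Integrable w circleMeasure)
    (hw0 : ∀ᵐ θ ∂circleMeasure, 0 ≤ w θ) (hZ : IsStationaryGaussian w Z μ) {U : Ω → ℝ}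
    {f : Torus → ℂ} (h : HasTransferFunction w Z μ U f) (k : ℤ) :
    HasTransferFunction w Z μ (fun ω => U ω + Z k ω) (fun θ => f θ + fourier (-k) θ) := by
  obtain ⟨c, hc, hcf⟩ := h.exists_tendsto
  refine ⟨h.memLp.add (hZ.memLp k), ?_, fun j => c j + Finsupp.single k 1, ?_, ?_⟩
  · simp only [mul_add]
    exact h.memLp_sqrt.add (memLp_sqrt_mul_continuous hw hw0 (map_continuous _))
  · refine hc.congr fun j => ?_
    congr 1; ext ω
    simp
  · refine hcf.congr fun j => ?_
    congr 1; ext θ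
    rw [map_add, Pi.add_apply, transferFunction_single]
    push_cast; ring

lemma tendsto_eLpNorm_sqrt_mul (hw0 : ∀ᵐ θ ∂circleMeasure, 0 ≤ w θ) {g : ℕ → Torus → ℂ}
    (h : Tendsto (fun j => ∫⁻ θ, ENNReal.ofReal (‖g j θ‖ ^ 2 * w θ) ∂circleMeasure) atTop (𝓝 0)) :
    Tendsto (fun j => eLpNorm (fun θ => (Real.sqrt (w θ) : ℂ) * g j θ) 2 circleMeasure)
      atTop (𝓝 0) := by
  have h1 : ∀ j, eLpNorm (fun θ => (Real.sqrt (w θ) : ℂ) * g j θ) 2 circleMeasure =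
      (∫⁻ θ, ENNReal.ofReal (‖g j θ‖ ^ 2 * w θ) ∂circleMeasure) ^ (1 / 2 : ℝ) := by
    intro j
    rw [eLpNorm_eq_lintegral_rpow_enorm_toReal (by norm_num) (by norm_num)]
    simp only [ENNReal.toReal_ofNat]
    congr 1
    apply lintegral_congr_ae
    filter_upwards [hw0] with θ h0
    rw [← norm_sqrt_mul_sq h0, ← ofReal_norm, ENNReal.ofReal_pow (norm_nonneg _)]
    exact ENNReal.rpow_ofNat _ 2
  simp only [h1]
  have := (ENNReal.continuous_rpow_const (y := (1 / 2 : ℝ))).tendsto 0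
  rw [ENNReal.zero_rpow_of_pos (by norm_num)] at this
  exact this.comp h

lemma IsFilterOutput.hasTransferFunction (hw : Integrable w circleMeasure)
    (hw0 : ∀ᵐ θ ∂circleMeasure, 0 ≤ w θ) {B : Torus → ℂ}
    (hB : AEStronglyMeasurable B circleMeasure)
    (hBw : Integrable (fun θ => ‖B θ‖ ^ 2 * w θ) circleMeasure) {n : ℤ} {U : Ω → ℝ}
    (h : IsFilterOutput w B Z μ n U) :
    HasTransferFunction w Z μ U (fun θ => fourier (-n) θ * B θ) := by
  obtain ⟨hU, m, b, hb, hlim⟩ := h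
  refine ⟨hU, ?_, fun j => ∑ k ∈ Finset.Icc 1 (m j), Finsupp.single (n - (k : ℤ)) (b j k), ?_, ?_⟩
  · refine memLp_sqrt_mul hw hw0 ((map_continuous _).aestronglyMeasurable.mul hB) ?_
    simpa only [norm_mul, norm_fourier_apply, one_mul] using hBw
  · refine hlim.congr fun j => ?_
    congr 1; ext ω
    simp [map_sum, Finset.sum_apply]
  · have hp : ∀ j θ, transferFunction (∑ k ∈ Finset.Icc 1 (m j),
        Finsupp.single (n - (k : ℤ)) (b j k)) θ = fourier (-n) θ * causalPoly (m j) (b j) θ := by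
      intro j θ
      rw [map_sum, Finset.sum_apply, causalPoly, Finset.mul_sum]
      refine Finset.sum_congr rfl fun k _ => ?_
      rw [transferFunction_single, neg_sub, sub_eq_neg_add, fourier_add]
      ring
    have := tendsto_eLpNorm_sqrt_mul hw0
      (g := fun j θ => fourier (-n) θ * (B θ - causalPoly (m j) (b j) θ))
      (by simpa only [norm_mul, norm_fourier_apply, one_mul] using hb)
    refine this.congr fun j => ?_
    congr 1; ext θ
    rw [hp]
    ring

/-- A variable independent of each `Z_k` is uncorrelated with their closed linear span. -/
lemma HasTransferFunction.integral_mul_eq_zero_of_indepFun (hZ : IsStationaryGaussian w Z μ)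
    {U : Ω → ℝ} {f : Torus → ℂ} (h : HasTransferFunction w Z μ U f) {v : Ω → ℝ} (hv : MemLp v 2 μ)
    (hv0 : ∫ ω, v ω ∂μ = 0) (hi : ∀ k, IndepFun v (Z k) μ) : ∫ ω, v ω * U ω ∂μ = 0 := by
  obtain ⟨c, hc, -⟩ := h.exists_tendsto
  refine tendsto_nhds_unique (tendsto_integral_mul (fun _ => hv) hv
    (fun j => hZ.memLp_linearCombination (c j)) h.memLp (by simp) hc)
    (tendsto_const_nhds.congr fun j => ?_)
  have hvZ : ∀ k, Integrable (fun ω => c j k * (v ω * Z k ω)) μ := fun k =>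
    (hv.integrable_mul (hZ.memLp k)).const_mul _
  simp only [Finsupp.linearCombination_apply, Finsupp.sum, Finset.sum_apply, Pi.smul_apply,
    Finset.mul_sum, smul_eq_mul, mul_left_comm (v _)]
  rw [integral_finsetSum _ fun k _ => hvZ k]
  refine (Finset.sum_eq_zero fun k _ => ?_).symm
  rw [integral_const_mul, (hi k).integral_fun_mul_eq_mul_integral hv.aestronglyMeasurable
    (hZ.memLp k).aestronglyMeasurable, hv0, zero_mul, mul_zero]

variable [IsProbabilityMeasure μ]

lemma HasTransferFunction.integral_eq_zero (hZ : IsStationaryGaussian w Z μ) {U : Ω → ℝ}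
    {f : Torus → ℂ} (h : HasTransferFunction w Z μ U f) : ∫ ω, U ω ∂μ = 0 := by
  obtain ⟨c, hc, -⟩ := h.exists_tendsto
  refine tendsto_nhds_unique (tendsto_integral_of_eLpNorm_two
    (fun j => hZ.memLp_linearCombination (c j)) h.memLp hc) (tendsto_const_nhds.congr fun j => ?_)
  have hi : ∀ k, Integrable (fun ω => c j k * Z k ω) μ := fun k =>
    ((hZ.memLp k).integrable (by norm_num)).const_mul _
  simp only [Finsupp.linearCombination_apply, Finsupp.sum, Finset.sum_apply, Pi.smul_apply,
    smul_eq_mul]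
  rw [integral_finsetSum _ fun k _ => hi k]
  simp [integral_const_mul, hZ.mean_zero]

/-- The input at time `n` and the output at time `i` have the covariance prescribed by the cross
spectrum; when the latter is anticausal, they are uncorrelated for `i < n`, hence independent, all
variables being jointly Gaussian. -/
theorem IsFeedbackChannel.indepFun {SZ SV : Torus → ℝ} {P : ℝ} {B : Torus → ℂ}
    {V X Y : ℤ → Ω → ℝ} (hch : IsFeedbackChannel SZ SV B μ Z V X Y)
    (hSZ : Integrable SZ circleMeasure) (hw0 : ∀ᵐ θ ∂circleMeasure, 0 ≤ SZ θ)
    (hB : AEStronglyMeasurable B circleMeasure) (hf : PowerFeasible SZ P SV B)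
    (hanti : Anticausal (crossSpectrum SZ SV B)) (n : ℤ) :
    IndepFun (X n) (fun ω (i : Set.Iio n) => Y i ω) μ := by
  have hZ := hch.noise
  have hV := hch.signal
  have hU : ∀ k, HasTransferFunction SZ Z μ (fun ω => X k ω - V k ω)
      (fun θ => fourier (-k) θ * B θ) := fun k =>
    (hch.input k).hasTransferFunction hSZ hw0 hB hf.integrable_filter
  have hQ : ∀ k, HasTransferFunction SZ Z μ (fun ω => (X k ω - V k ω) + Z k ω)
      (fun θ => fourier (-k) θ * B θ + fourier (-k) θ) := fun k => (hU k).add_noise hSZ hw0 hZ k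
  have hYeq : ∀ k, Y k = fun ω => V k ω + ((X k ω - V k ω) + Z k ω) := fun k => by
    ext ω; rw [hch.output]; ring
  have hXeq : ∀ k, X k = fun ω => V k ω + (X k ω - V k ω) := fun k => by ext ω; ring
  have hXm : ∀ k, MemLp (X k) 2 μ := fun k => by
    rw [hXeq k]; exact (hV.memLp k).add (hU k).memLp
  have hYm : ∀ k, MemLp (Y k) 2 μ := fun k => by
    rw [hYeq k]; exact (hV.memLp k).add (hQ k).memLp
  have hVZ : ∀ k l, IndepFun (V k) (Z l) μ := fun k l =>
    hch.indep.comp (measurable_pi_apply k) (measurable_pi_apply l)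
  have hX0 : ∫ ω, X n ω ∂μ = 0 := by
    have := (hU n).integral_eq_zero hZ
    rw [integral_sub ((hXm n).integrable (by norm_num)) ((hV.memLp n).integrable (by norm_num)),
      hV.mean_zero, sub_zero] at this
    exact this
  have hcov : ∀ i : ℤ, i < n → ∫ ω, X n ω * Y i ω ∂μ = 0 := by
    intro i hi
    have hVQ := (hQ i).integral_mul_eq_zero_of_indepFun hZ (hV.memLp n) (hV.mean_zero n) (hVZ n)
    have hVU := (hU n).integral_mul_eq_zero_of_indepFun hZ (hV.memLp i) (hV.mean_zero i) (hVZ i)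
    have hUQ := HasTransferFunction.integral_mul hZ hSZ hw0 (hU n) (hQ i)
    have hVV := hV.covariance i n
    have e : ∀ ω, X n ω * Y i ω = (V i ω * V n ω + V n ω * ((X i ω - V i ω) + Z i ω)) +
        (V i ω * (X n ω - V n ω) + (X n ω - V n ω) * ((X i ω - V i ω) + Z i ω)) := fun ω => by
      rw [hch.output]; ring
    have i1 : Integrable (fun ω => V i ω * V n ω) μ := (hV.memLp i).integrable_mul (hV.memLp n)
    have i2 : Integrable (fun ω => V n ω * ((X i ω - V i ω) + Z i ω)) μ :=
      (hV.memLp n).integrable_mul (hQ i).memLp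
    have i3 : Integrable (fun ω => V i ω * (X n ω - V n ω)) μ :=
      (hV.memLp i).integrable_mul (hU n).memLp
    have i4 : Integrable (fun ω => (X n ω - V n ω) * ((X i ω - V i ω) + Z i ω)) μ :=
      (hU n).memLp.integrable_mul (hQ i).memLp
    apply Complex.ofReal_injective
    have h12 : Integrable (fun ω => V i ω * V n ω + V n ω * ((X i ω - V i ω) + Z i ω)) μ := i1.add i2
    have h34 : Integrable (fun ω => V i ω * (X n ω - V n ω) +
        (X n ω - V n ω) * ((X i ω - V i ω) + Z i ω)) μ := i3.add i4
    simp only [e]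
    rw [integral_add h12 h34, integral_add i1 i2, integral_add i3 i4, hVQ, hVU,
      add_zero, zero_add, Complex.ofReal_add, hVV, hUQ, Complex.ofReal_zero,
      ← hanti.2 (n - i) (by omega), fourierCoeff, fourierCoeff]
    have hc := Integrable.fourier_mul hanti.1 (-(n - i))
    have hs := Integrable.fourier_mul (hf.integrable.ofReal (𝕜 := ℂ)) (-(n - i))
    have hd : ∀ θ, (fourier (-n) θ * B θ : ℂ) *
        conj (fourier (-i) θ * B θ + fourier (-i) θ) * SZ θ =
        fourier (-(n - i)) θ * crossSpectrum SZ SV B θ - fourier (-(n - i)) θ * (SV θ : ℂ) := by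
      intro θ
      have hni : (fourier (-(n - i)) θ : ℂ) = fourier (-n) θ * fourier i θ := by
        rw [← fourier_add]; congr 2; ring
      rw [map_add, map_mul, ← fourier_neg, neg_neg, hni, crossSpectrum]
      ring
    exact (congrArg _ ((integral_congr_ae (ae_of_all _ hd)).trans (integral_sub hc hs))).trans
      (add_sub_cancel _ _)
  have hW := IsGaussianProcess.sumElim hV.gaussian hZ.gaussian hch.indep
  have hmono : Submodule.span ℝ (Set.range Z) ≤ Submodule.span ℝ (Set.range (Sum.elim V Z)) :=
    Submodule.span_mono (by rintro _ ⟨k, rfl⟩; exact ⟨.inr k, rfl⟩)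
  have happrox : ∀ k {Q : Ω → ℝ} {f : Torus → ℂ}, HasTransferFunction SZ Z μ Q f →
      ∃ A : ℕ → Ω → ℝ, (∀ j, A j ∈ Submodule.span ℝ (Set.range (Sum.elim V Z))) ∧
      Tendsto (fun j => eLpNorm (fun ω => (V k ω + Q ω) - A j ω) 2 μ) atTop (𝓝 0) := by
    intro k Q f hQf
    obtain ⟨c, hc, -⟩ := hQf.exists_tendsto
    refine ⟨fun j => V k + Finsupp.linearCombination ℝ Z (c j), fun j => add_mem
      (Submodule.subset_span ⟨.inl k, rfl⟩)
      (hmono (Finsupp.range_linearCombination ℝ (v := Z) ▸ LinearMap.mem_range_self _ _)), ?_⟩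
    refine hc.congr fun j => ?_
    congr 1; ext ω
    simp
  have hG : IsGaussianProcess (Sum.elim (fun _ : Unit => X n) fun i : Set.Iio n => Y i) μ := by
    refine IsGaussianProcess.of_tendsto hW ?_ ?_
    · rintro (_ | i)
      · exact hXm n
      · exact hYm i
    · rintro (_ | i)
      · simp only [Sum.elim_inl]
        rw [hXeq n]
        exact happrox n (hU n)
      · simp only [Sum.elim_inr]
        rw [hYeq i]
        exact happrox i (hQ i)
  have hind := hG.indepFun_of_covariance_eq_zero
    (fun _ => (hXm n).aestronglyMeasurable.aemeasurable)
    (fun i => (hYm i).aestronglyMeasurable.aemeasurable) fun _ i => by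
      rw [covariance_eq_sub (hXm n) (hYm i), hX0, zero_mul, sub_zero]
      exact hcov i i.2
  exact hind.comp (measurable_pi_apply ()) measurable_id

end

theorem proposition4
    (SZ : Torus → ℝ) (P : ℝ) (hP : 0 ≤ P)
    (hSZ : Integrable SZ circleMeasure)
    (hEven : ∀ᵐ θ ∂circleMeasure, SZ (-θ) = SZ θ)
    (hPW : PaleyWiener SZ) :
    (∀ (SV : Torus → ℝ) (B : Torus → ℂ), IsOptimalPair SZ P SV B →
      -- power
      inputPower SZ SV B = P ∧
      -- water-filling
      (∀ᵐ θ ∂circleMeasure, SV θ * (outputSpectrum SZ SV B θ -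
        essInf (outputSpectrum SZ SV B) circleMeasure) = 0) ∧
      -- orthogonality, in the form of independence of the current input and the past output
      (∀ {Ω : Type*} [MeasurableSpace Ω] (μ : Measure Ω) [IsProbabilityMeasure μ]
        (Z V X Y : ℤ → Ω → ℝ), IsFeedbackChannel SZ SV B μ Z V X Y →
        ∀ n : ℤ, IndepFun (X n) (fun ω (i : Set.Iio n) => Y i ω) μ) ∧
      -- orthogonality, in the form of anticausality
      Anticausal (fun θ => (SV θ : ℂ) + B θ * (SZ θ : ℂ) * (1 + conj (B θ)))) ∧
    -- existence
    (0 < essInf SZ circleMeasure →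
      ∃ (SV : Torus → ℝ) (B : Torus → ℂ), IsOptimalPair SZ P SV B) := by
  refine ⟨fun SV B h => ?_, exists_isOptimalPair hP hSZ hEven hPW⟩
  have hanti := h.anticausal hP hSZ hEven hPW
  exact ⟨h.inputPower_eq hP hSZ hEven hPW, h.waterFilling hP hSZ hEven hPW,
    fun μ _ Z V X Y hch n => hch.indepFun hSZ hPW.nonneg h.strictlyCausal.memLp.aestronglyMeasurable
      h.feasible hanti n, hanti⟩
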